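/- Let $d\ge 1$ and $0<\alpha<1$, and let $|x|=\max_i|x_i|$ on $\mathbb{R}^d$. "Cube" means a cube $Q=\prod_i[a_i,a_i+\ell)$ with $\ell>0$. *Weights.* Let $w:\mathbb{R}^d\to\mathbb{R}$ be locally integrable and positive almost everywhere, and write $w(Q)=\int_Q w$. Put $$[w]_{A_2}=\sup_Q\frac{w(Q)\,w^{-1}(Q)}{|Q|^2},\qquad [w]_{A_\infty}=\sup_Q\frac1{w(Q)}\int_Q M(w1_Q)\,dx,$$ the suprema being over all cubes $Q$. Here $M$ is the dyadic maximal operator of the dyadic system generated by $Q=a+[0,\ell)^d$, that is, $Mf(x)=\sup_{P\ni x}|P|^{-1}\int_P|f|$ over the cubes $P=a+2^{-k}\ell([0,1)^d+m)$ with $k\in\mathbb{Z}$, $m\in\mathbb{Z}^d$. Write $w\in A_2$ if $[w]_{A_2}<\infty$. *Operators.* Let $T$ be a bounded linear operator on $L^2(\mathbb{R}^d)$ (real- or complex-valued functions) that is a Calderón–Zygmund operator with kernel $K$. This means that, for all $f$ in some dense subspace of $L^2(\mathbb{R}^d)$ that contains the indicators of cubes, $$Tf(x)=\int K(x,y)f(y)\,dy\quad\text{for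 a.e. }x\notin\operatorname{supp}f,$$ and that $K$ satisfies, for some finite constants $C_0$ and $C_\alpha$, the estimate $|K(x,y)|\le C_0|x-y|^{-d}$ for $x\ne y$ and $$|K(x,y)-K(x',y)|+|K(y,x)-K(y,x')|\le\frac{C_\alpha}{|x-y|^{d}}\Big(\frac{|x-x'|}{|x-y|}\Big)^{\alpha}\quad\text{whenever }|x-y|>2|x-x'|.$$ Let $\|K\|_{CZ_\alpha}$ be the smallest admissible $C_\alpha$. **Theorem ($A_2$ theorem).** There is a finite constant $C$, depending only on $d$ and $\alpha$, such that for all such $T$ and $K$ and every $w\in A_2$, the restriction of $T$ to $L^2\cap L^2(w)$ extends uniquely to a bounded operator on $L^2(w)$, and $$\|T\|_{L^2(w)\to L^2(w)}\le C\,\big(\|T\|_{L^2\to L^2}+\|K\|_{CZ_\alpha}\big)[w]_{A_2}^{1/2}\big([w]_{A_\infty}^{1/2}+[w^{-1}]_{A_\infty}^{1/2}\big).$$ Moreover, $$\big(\|T\|_{L^2\to L^2}+\|K\|_{CZ_\alpha}\big)[w]_{A_2}^{1/2}\big([w]_{A_\infty}^{1/2}+[w^{-1}]_{A_\infty}^{1/2}\big)\le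 C\,\big(\|T\|_{L^2\to L^2}+\|K\|_{CZ_\alpha}\big)[w]_{A_2}.$$ -/

import Mathlib

open MeasureTheory Topology
open scoped ENNReal NNReal

noncomputable section

/- Throughout, `ℝ^d` is `Fin d → ℝ`, whose norm is the `ℓ^∞` norm and whose `volume` is
Lebesgue measure. -/

/-- The axis-parallel half-open cube `a + [0, l)^d`. -/
def cube {d : ℕ} (a : Fin d → ℝ) (l : ℝ) : Set (Fin d → ℝ) :=
  {x | ∀ i, a i ≤ x i ∧ x i < a i + l}

/-! ### Weights and their characteristics -/

/-- The measure `w(x) dx`. -/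
def weightMeasure {d : ℕ} (w : (Fin d → ℝ) → ℝ) : Measure (Fin d → ℝ) :=
  volume.withDensity fun x => ENNReal.ofReal (w x)

/-- `[w]_{A_2} = sup_Q w(Q) w⁻¹(Q) / |Q|²`, the supremum over all cubes. -/
def a2Const {d : ℕ} (w : (Fin d → ℝ) → ℝ) : ℝ≥0∞ :=
  ⨆ (a : Fin d → ℝ) (l : ℝ) (_ : 0 < l),
    weightMeasure w (cube a l) * weightMeasure (fun x => (w x)⁻¹) (cube a l) /
      volume (cube a l) ^ 2

/-- The cubes `a + l 2^{-k} ([0,1)^d + m)`, with `k ∈ ℤ` and `m ∈ ℤ^d`, of the dyadic system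
that contains the cube `a + [0, l)^d`: the image of the standard system
`{2^{-k} ([0,1)^d + m)}` under `x ↦ a + l x`. -/
def dyadicCube {d : ℕ} (a : Fin d → ℝ) (l : ℝ) (k : ℤ) (m : Fin d → ℤ) : Set (Fin d → ℝ) :=
  cube (fun i => a i + l * (2 : ℝ) ^ (-k) * (m i : ℝ)) (l * (2 : ℝ) ^ (-k))

/-- The dyadic maximal operator, `M f(x) = sup_{P ∋ x} |P|⁻¹ ∫_P |f|`, the supremum over the
cubes `P` of the dyadic system that contains `a + [0, l)^d`. -/
def dyadicMaximal {d : ℕ} (a : Fin d → ℝ) (l : ℝ) (f : (Fin d → ℝ) → ℝ) (x : Fin d → ℝ) :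
    ℝ≥0∞ :=
  ⨆ (k : ℤ) (m : Fin d → ℤ) (_ : x ∈ dyadicCube a l k m),
    (∫⁻ y in dyadicCube a l k m, ‖f y‖ₑ) / volume (dyadicCube a l k m)

/-- `[w]_{A_∞} = sup_Q w(Q)⁻¹ ∫_Q M(w 1_Q)`, the supremum over all cubes, where `M` is the
dyadic maximal operator of the dyadic system that contains `Q`. -/
def aInftyConst {d : ℕ} (w : (Fin d → ℝ) → ℝ) : ℝ≥0∞ :=
  ⨆ (a : Fin d → ℝ) (l : ℝ) (_ : 0 < l),
    (∫⁻ x in cube a l, dyadicMaximal a l ((cube a l).indicator w) x) /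
      weightMeasure w (cube a l)

/-- `w ∈ A_2`. -/
structure IsA2Weight {d : ℕ} (w : (Fin d → ℝ) → ℝ) : Prop where
  locallyIntegrable : LocallyIntegrable w volume
  pos : ∀ᵐ x, 0 < w x
  a2Const_lt_top : a2Const w < ∞

/-! ### Calderón–Zygmund operators -/

/-- The size estimate `|K(x,y)| ≤ C / |x-y|^d` off the diagonal. -/
def KernelSizeBound {d : ℕ} {𝕜 : Type*} [RCLike 𝕜] (K : (Fin d → ℝ) → (Fin d → ℝ) → 𝕜)
    (C : ℝ≥0) : Prop :=
  ∀ x y, x ≠ y → ‖K x y‖ ≤ C / ‖x - y‖ ^ d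

/-- The smoothness estimate
`|K(x,y) - K(x',y)| + |K(y,x) - K(y,x')| ≤ C |x-y|^{-d} (|x-x'| / |x-y|)^α`
for `|x-y| > 2 |x-x'|`. -/
def KernelHolderBound {d : ℕ} {𝕜 : Type*} [RCLike 𝕜] (K : (Fin d → ℝ) → (Fin d → ℝ) → 𝕜)
    (α : ℝ) (C : ℝ≥0) : Prop :=
  ∀ x x' y, 2 * ‖x - x'‖ < ‖x - y‖ →
    ‖K x y - K x' y‖ + ‖K y x - K y x'‖ ≤
      C / ‖x - y‖ ^ d * (‖x - x'‖ / ‖x - y‖) ^ α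

/-- `‖K‖_{CZ_α}`, the smallest admissible constant in the smoothness estimate. -/
def kernelHolderNorm {d : ℕ} {𝕜 : Type*} [RCLike 𝕜] (K : (Fin d → ℝ) → (Fin d → ℝ) → 𝕜)
    (α : ℝ) : ℝ≥0∞ :=
  ⨅ (C : ℝ≥0) (_ : KernelHolderBound K α C), (C : ℝ≥0∞)

/-- `T` is an `L²`-bounded Calderón–Zygmund operator with kernel `K` of Hölder exponent `α`:
the kernel satisfies the standard estimates, and `T f(x) = ∫ K(x,y) f(y) dy` for almost every
`x` outside the support of `f`, for all `f` in some dense subspace of `L²` that contains the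
indicators of cubes. -/
structure IsCalderonZygmund {d : ℕ} {𝕜 : Type*} [RCLike 𝕜]
    (T : Lp 𝕜 2 (volume : Measure (Fin d → ℝ)) →L[𝕜] Lp 𝕜 2 (volume : Measure (Fin d → ℝ)))
    (K : (Fin d → ℝ) → (Fin d → ℝ) → 𝕜) (α : ℝ) : Prop where
  size : ∃ C, KernelSizeBound K C
  holder : ∃ C, KernelHolderBound K α C
  kernel_rep : ∃ D : Submodule 𝕜 (Lp 𝕜 2 (volume : Measure (Fin d → ℝ))),
    Dense (D : Set (Lp 𝕜 2 (volume : Measure (Fin d → ℝ)))) ∧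
    (∀ a l, 0 < l → ∃ f ∈ D, f =ᵐ[volume] (cube a l).indicator fun _ => (1 : 𝕜)) ∧
    ∀ f ∈ D, ∀ᵐ x, (∃ U ∈ 𝓝 x, f =ᵐ[volume.restrict U] 0) → T f x = ∫ y, K x y * f y

/-- The bounded operator `S` on `L²(w)` agrees with `T` on `L² ∩ L²(w)`. -/
def AgreesOnWeighted {d : ℕ} {𝕜 : Type*} [RCLike 𝕜] (w : (Fin d → ℝ) → ℝ)
    (T : Lp 𝕜 2 (volume : Measure (Fin d → ℝ)) →L[𝕜] Lp 𝕜 2 (volume : Measure (Fin d → ℝ)))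
    (S : Lp 𝕜 2 (weightMeasure w) →L[𝕜] Lp 𝕜 2 (weightMeasure w)) : Prop :=
  ∀ (f : Lp 𝕜 2 (volume : Measure (Fin d → ℝ))) (g : Lp 𝕜 2 (weightMeasure w)),
    g =ᵐ[volume] f → S g =ᵐ[volume] T f

end

/-! ### Dyadic geometry -/

section Geometry

variable {d : ℕ}

/-! The proof is by sparse domination. For step functions `f` and `g`, the form `∫ |Tf| |g|` is
bounded by sums `∑ |P|⁻¹ ∫_{5P} |f| ∫_P |g|` over dyadic cubes `P` that own pairwise disjoint sets
`E_P ⊆ P` with `|P| ≤ 2 |E_P|`. Such sums are positive dyadic forms, and bounding them on `L²(w)` is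
a two-weight testing problem.

Domination. Dividing `T` and `K` by a common bound leaves an operator of norm at most one and Hölder
constant one, so the Calderón–Zygmund decomposition gives a weak-type (1,1) constant depending on
`d` and `α` only (`IsStepCZ.weak_type`). In a cube `Q` put `a = |Q|⁻¹ ∫_{5Q} |f|` and `F = f
1_{5Q}`. The recursion stops at the maximal subcubes `P` in which `{|TF| > A a}` has a fixed
proportion, or for which `∫_{5P} |f| > A a |P|`. Weak-type bounds for `T` and for averages make
these occupy at most half of `Q` (`IsStepCZ.sum_volume_stopping_le`). On a stopped `P` the function
`T(f 1_{5Q ∖ 5P})` is given by the kernel; it oscillates by `O(a)`, since the cubes between `P` and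
`Q` carry small averages, and it is `O(a)` at some point of `P`, since the exceptional sets do not
fill `P`. Hence `|TF| ≤ |T(f 1_{5P})| + O(a)` there (`IsStepCZ.ae_le_localize`). Unstopped cubes of
the finest scale, where `f` and `g` are constant, are handled by the `L²` bound. A step function has
a finest scale, so the recursion is finite (`IsStepCZ.exists_sparse_le`). Each `5P` lies in a
comparable cube of one of `2^d` translated grids (`exists_shift_dilate_subset`), which turns the
sums into sparse forms on dyadic cubes.

Weighted bound. The testing theorem `dyadic_form_sq_le` separates the cubes according to which of
the two functions has the larger normalised average, and in each half organises them under the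
record cubes of that function. For sparse forms with the measures `w⁻¹ dx` and `w dx`, the testing
constant is a multiple of `[w]_{A_2} [w]_{A_∞}` or of its dual (`sparse_testing`): expanding the
square leaves nested pairs, `A_2` and packing remove the inner sum, and `A_∞` sums the masses
`w(Q)`.

The second inequality rests on `[w]_{A_∞} ≤ 4 [w]_{A_2}` (`aInftyConst_le`). By `A_2`, the average
`w(P)/|P|` is at most `[w]_{A_2} |P| / w⁻¹(P)`, and `|P| / w⁻¹(P)` is the average of `w` with
respect to `w⁻¹ dx`, whose dyadic maximal operator is bounded on `L²(w⁻¹)` uniformly in `w`.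

Duality with step functions turns the form estimate into a norm estimate on step functions,
approximation and Fatou's lemma carry it to `L² ∩ L²(w)`, and density gives the unique extension
(`exists_unique_extension`). -/

theorem cube_eq_pi (a : Fin d → ℝ) (l : ℝ) :
    cube a l = Set.pi Set.univ fun i => Set.Ico (a i) (a i + l) := by
  ext x; simp [cube, Set.mem_Ico]

theorem measurableSet_cube (a : Fin d → ℝ) (l : ℝ) : MeasurableSet (cube a l) := by
  rw [cube_eq_pi]; exact MeasurableSet.univ_pi fun _ => measurableSet_Ico

theorem volume_cube (a : Fin d → ℝ) (l : ℝ) : volume (cube a l) = ENNReal.ofReal l ^ d := by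
  rw [cube_eq_pi, Real.volume_pi_Ico]; simp

theorem volume_cube_ne_zero (a : Fin d → ℝ) {l : ℝ} (hl : 0 < l) : volume (cube a l) ≠ 0 := by
  rw [volume_cube]; exact pow_ne_zero _ (by simpa using hl)

theorem volume_cube_ne_top (a : Fin d → ℝ) (l : ℝ) : volume (cube a l) ≠ ∞ := by
  rw [volume_cube]; exact ENNReal.pow_ne_top ENNReal.ofReal_ne_top

theorem cube_subset_cube {a b : Fin d → ℝ} {l m : ℝ} (hl : 0 < l) (h : cube a l ⊆ cube b m) :
    ∀ i, b i ≤ a i ∧ a i + l ≤ b i + m := by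
  intro i
  have key : ∀ t, 0 ≤ t → t < l → b i ≤ a i + t ∧ a i + t < b i + m := by
    intro t ht htl
    have hx : (fun i => a i + t) ∈ cube a l := fun j => ⟨by simpa using ht, by simpa using htl⟩
    exact h hx i
  refine ⟨by simpa using (key 0 le_rfl hl).1, ?_⟩
  by_contra hlt
  push Not at hlt
  have h0 := (key 0 le_rfl hl).2
  have := (key (b i + m - a i) (by linarith) (by linarith)).2
  linarith

theorem cube_mono {a b : Fin d → ℝ} {l m : ℝ} (h : ∀ i, b i ≤ a i ∧ a i + l ≤ b i + m) :
    cube a l ⊆ cube b m := fun _ hx i =>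
  ⟨(h i).1.trans (hx i).1, (hx i).2.trans_le (h i).2⟩

theorem isBounded_cube (a : Fin d → ℝ) (l : ℝ) : Bornology.IsBounded (cube a l) := by
  refine (Metric.isBounded_Icc a (fun i => a i + l)).subset ?_
  intro x hx
  exact ⟨fun i => (hx i).1, fun i => (hx i).2.le⟩

/-- Indices `(k, m)` of the cubes of a dyadic system; the cube has side `l 2^{-k}`. -/
abbrev Idx (d : ℕ) := ℤ × (Fin d → ℤ)

/-- The cube with a given index. -/
def gridCube (a : Fin d → ℝ) (l : ℝ) (q : Idx d) : Set (Fin d → ℝ) := dyadicCube a l q.1 q.2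

/-- The position of the cube of generation `k` containing `x`. -/
noncomputable def gridIndex (a : Fin d → ℝ) (l : ℝ) (k : ℤ) (x : Fin d → ℝ) : Fin d → ℤ :=
  fun i => ⌊(x i - a i) / (l * (2 : ℝ) ^ (-k))⌋

/-- The cube concentric with a dyadic cube, of five times its side. -/
def dilate (a : Fin d → ℝ) (l : ℝ) (q : Idx d) : Set (Fin d → ℝ) :=
  cube (fun i => a i + l * (2 : ℝ) ^ (-q.1) * q.2 i - 2 * (l * (2 : ℝ) ^ (-q.1)))
    (5 * (l * (2 : ℝ) ^ (-q.1)))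

variable {a : Fin d → ℝ} {l : ℝ}

theorem side_pos (hl : 0 < l) (k : ℤ) : 0 < l * (2 : ℝ) ^ (-k) := by positivity

theorem measurableSet_gridCube (q : Idx d) : MeasurableSet (gridCube a l q) :=
  measurableSet_cube _ _

theorem measurableSet_dilate (q : Idx d) : MeasurableSet (dilate a l q) :=
  measurableSet_cube _ _

theorem volume_gridCube (q : Idx d) :
    volume (gridCube a l q) = ENNReal.ofReal (l * (2 : ℝ) ^ (-q.1)) ^ d := volume_cube _ _

theorem volume_gridCube_ne_zero (hl : 0 < l) (q : Idx d) : volume (gridCube a l q) ≠ 0 :=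
  volume_cube_ne_zero _ (side_pos hl _)

theorem volume_gridCube_ne_top (q : Idx d) : volume (gridCube a l q) ≠ ∞ :=
  volume_cube_ne_top _ _

theorem volume_dilate (q : Idx d) :
    volume (dilate a l q) = 5 ^ d * volume (gridCube a l q) := by
  rw [volume_gridCube, dilate, volume_cube, ENNReal.ofReal_mul (by norm_num), mul_pow]
  norm_num

theorem mem_gridCube_iff (hl : 0 < l) {q : Idx d} {x : Fin d → ℝ} :
    x ∈ gridCube a l q ↔ gridIndex a l q.1 x = q.2 := by
  have hs := side_pos hl q.1
  simp only [gridCube, dyadicCube, cube, Set.mem_ofPred_eq, gridIndex, funext_iff, Int.floor_eq_iff]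
  refine forall_congr' fun i => ?_
  rw [le_div_iff₀ hs, div_lt_iff₀ hs]
  constructor
  · rintro ⟨h1, h2⟩; constructor <;> nlinarith
  · rintro ⟨h1, h2⟩; constructor <;> nlinarith

theorem mem_gridCube_gridIndex (hl : 0 < l) (k : ℤ) (x : Fin d → ℝ) :
    x ∈ gridCube a l (k, gridIndex a l k x) := (mem_gridCube_iff hl).2 rfl

/-- The index at generation `j` is the integer quotient by `2 ^ r` of the index at generation `j +
r`, so the finer index determines the coarser one. This is the nestedness of the dyadic system. -/
theorem gridIndex_eq_of_le {j k : ℤ} (hjk : j ≤ k) {x y : Fin d → ℝ}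
    (h : gridIndex a l k x = gridIndex a l k y) : gridIndex a l j x = gridIndex a l j y := by
  obtain ⟨r, rfl⟩ := Int.le.dest hjk
  have key : ∀ z : Fin d → ℝ, ∀ i, gridIndex a l j z i = gridIndex a l (j + r) z i / (2 ^ r : ℕ) := by
    intro z i
    rw [gridIndex, gridIndex, ← Int.floor_div_natCast]
    congr 1
    rw [div_div, mul_assoc]
    congr 2
    push_cast
    rw [← zpow_natCast, ← zpow_add₀ (by norm_num)]
    congr 1; ring
  funext i
  rw [key, key, h]

theorem gridCube_subset_of_mem (hl : 0 < l) {p q : Idx d} (h : p.1 ≤ q.1) {x : Fin d → ℝ}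
    (hp : x ∈ gridCube a l p) (hq : x ∈ gridCube a l q) : gridCube a l q ⊆ gridCube a l p := by
  intro y hy
  rw [mem_gridCube_iff hl] at *
  rw [← hp]
  exact gridIndex_eq_of_le h (hy.trans hq.symm)

theorem eq_of_mem_gridCube (hl : 0 < l) {p q : Idx d} (h : p.1 = q.1) {x : Fin d → ℝ}
    (hp : x ∈ gridCube a l p) (hq : x ∈ gridCube a l q) : p = q := by
  rw [mem_gridCube_iff hl] at *
  exact Prod.ext h (by rw [← hp, ← hq, h])

theorem gridCube_nonempty (hl : 0 < l) (q : Idx d) : (gridCube a l q).Nonempty :=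
  ⟨fun i => a i + l * (2 : ℝ) ^ (-q.1) * q.2 i, fun i => ⟨le_rfl, by
    have := side_pos hl q.1; simpa using this⟩⟩

theorem disjoint_gridCube_of_ne (hl : 0 < l) {p q : Idx d} (h : p.1 = q.1) (hne : p ≠ q) :
    Disjoint (gridCube a l p) (gridCube a l q) :=
  Set.disjoint_left.2 fun _ hp hq => hne (eq_of_mem_gridCube hl h hp hq)

theorem finite_setOf_gridCube_inter (hl : 0 < l) {S : Set (Fin d → ℝ)}
    (hS : Bornology.IsBounded S) (j k : ℤ) :
    {q : Idx d | j ≤ q.1 ∧ q.1 ≤ k ∧ (gridCube a l q ∩ S).Nonempty}.Finite := by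
  obtain ⟨R, hR⟩ := hS.exists_norm_le
  have : {q : Idx d | j ≤ q.1 ∧ q.1 ≤ k ∧ (gridCube a l q ∩ S).Nonempty} ⊆
      ⋃ i ∈ Set.Icc j k, (fun m => (i, m)) ''
        Set.Icc (fun t : Fin d => ⌊(-R - a t) / (l * (2 : ℝ) ^ (-i))⌋)
          (fun t : Fin d => ⌊(R - a t) / (l * (2 : ℝ) ^ (-i))⌋) := by
    rintro ⟨i, m⟩ ⟨h1, h2, x, hx, hxS⟩
    simp only [Set.mem_iUnion]
    refine ⟨i, ⟨h1, h2⟩, m, ?_, rfl⟩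
    rw [mem_gridCube_iff hl] at hx
    have hs := side_pos hl i
    have hxR := (pi_norm_le_iff_of_nonneg ((norm_nonneg x).trans (hR x hxS))).1 (hR x hxS)
    simp only at hx
    rw [← hx]
    constructor <;> intro t <;> apply Int.floor_le_floor <;>
      apply div_le_div_of_nonneg_right _ hs.le <;> have := abs_le.1 (hxR t) <;> linarith [this.1, this.2]
  exact ((Set.finite_Icc j k).biUnion fun i _ => (Set.finite_Icc _ _).image _).subset this

/-- The maximal cubes of a finite collection. -/
noncomputable def maximalCubes (a : Fin d → ℝ) (l : ℝ) (s : Finset (Idx d)) : Finset (Idx d) :=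
  @Finset.filter _ (fun q => ∀ p ∈ s, p.1 < q.1 → Disjoint (gridCube a l p) (gridCube a l q))
    (Classical.decPred _) s

theorem maximalCubes_subset (s : Finset (Idx d)) : maximalCubes a l s ⊆ s :=
  @Finset.filter_subset _ _ (Classical.decPred _) _

theorem disjoint_of_mem_maximalCubes (hl : 0 < l) {s : Finset (Idx d)} {p q : Idx d}
    (hp : p ∈ maximalCubes a l s) (hq : q ∈ maximalCubes a l s) (hne : p ≠ q) :
    Disjoint (gridCube a l p) (gridCube a l q) := by
  simp only [maximalCubes, Finset.mem_filter] at hp hq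
  rcases lt_trichotomy p.1 q.1 with h | h | h
  · exact hq.2 p hp.1 h
  · exact disjoint_gridCube_of_ne hl h hne
  · exact (hp.2 q hq.1 h).symm

/-- A member of least generation among those containing `q` is maximal: any larger member meeting it
would contain it, and with it `q`. -/
theorem exists_mem_maximalCubes (hl : 0 < l) {s : Finset (Idx d)} {q : Idx d} (hq : q ∈ s) :
    ∃ p ∈ maximalCubes a l s, p.1 ≤ q.1 ∧ gridCube a l q ⊆ gridCube a l p := by
  classical
  obtain ⟨p, hp, hmin⟩ := (s.filter fun p => p.1 ≤ q.1 ∧ gridCube a l q ⊆ gridCube a l p).exists_min_image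
    (fun p => p.1) ⟨q, by simp [hq]⟩
  simp only [Finset.mem_filter] at hp hmin
  refine ⟨p, ?_, hp.2⟩
  simp only [maximalCubes, Finset.mem_filter]
  refine ⟨hp.1, fun r hr hrp => Set.disjoint_left.2 fun x hxr hxp => ?_⟩
  have h1 := gridCube_subset_of_mem hl hrp.le hxr hxp
  have := hmin r ⟨hr, hrp.le.trans hp.2.1, hp.2.2.trans h1⟩
  omega

theorem pairwiseDisjoint_maximalCubes (hl : 0 < l) (s : Finset (Idx d)) :
    (maximalCubes a l s : Set (Idx d)).PairwiseDisjoint (gridCube a l) :=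
  fun _ hp _ hq hne => disjoint_of_mem_maximalCubes hl hp hq hne

theorem gridCube_subset_dilate (hl : 0 < l) (q : Idx d) : gridCube a l q ⊆ dilate a l q := by
  have := side_pos hl q.1
  exact cube_mono fun i => ⟨by linarith, by linarith⟩

theorem norm_sub_lt_of_mem_gridCube (hl : 0 < l) {q : Idx d} {x y : Fin d → ℝ}
    (hx : x ∈ gridCube a l q) (hy : y ∈ gridCube a l q) : ‖x - y‖ < l * (2 : ℝ) ^ (-q.1) := by
  rw [pi_norm_lt_iff (side_pos hl _)]
  intro i
  rw [Pi.sub_apply, Real.norm_eq_abs, abs_lt]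
  have h1 := hx i
  have h2 := hy i
  constructor <;> linarith [h1.1, h1.2, h2.1, h2.2]

/-- The dilate leaves a margin of two sides all around the cube. This is what puts pairs of points
of the cube in the Hölder regime of the kernel with respect to points off the dilate. -/
theorem lt_norm_sub_of_notMem_dilate {q : Idx d} {x y : Fin d → ℝ}
    (hx : x ∈ gridCube a l q) (hy : y ∉ dilate a l q) :
    2 * (l * (2 : ℝ) ^ (-q.1)) < ‖x - y‖ := by
  simp only [dilate, cube, Set.mem_ofPred_eq, not_forall, not_and_or, not_le, not_lt] at hy
  obtain ⟨i, hi⟩ := hy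
  have h1 := hx i
  refine lt_of_lt_of_le ?_ (norm_le_pi_norm (x - y) i)
  rw [Pi.sub_apply, Real.norm_eq_abs, lt_abs]
  rcases hi with hi | hi
  · left; linarith [h1.1, h1.2]
  · right; linarith [h1.1, h1.2]

theorem dilate_subset_dilate (hl : 0 < l) {p q : Idx d} (h : p.1 ≤ q.1)
    (hpq : gridCube a l q ⊆ gridCube a l p) : dilate a l q ⊆ dilate a l p := by
  have hs := side_pos hl q.1
  have h1 := cube_subset_cube hs hpq
  have h2 : l * (2 : ℝ) ^ (-q.1) ≤ l * (2 : ℝ) ^ (-p.1) :=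
    mul_le_mul_of_nonneg_left (zpow_le_zpow_right₀ (by norm_num) (by omega)) hl.le
  exact cube_mono fun i => ⟨by linarith [(h1 i).1], by linarith [(h1 i).2]⟩

/-- Offsets of the `5 ^ d` dyadic cubes that make up a dilated cube. -/
noncomputable def offsets (d : ℕ) : Finset (Fin d → ℤ) := Fintype.piFinset fun _ => Finset.Icc (-2) 2

theorem card_offsets : (offsets d).card = 5 ^ d := by
  simp [offsets, Fintype.card_piFinset]

theorem gridCube_add_subset_dilate (hl : 0 < l) {q : Idx d} {e : Fin d → ℤ} (he : e ∈ offsets d) :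
    gridCube a l (q.1, q.2 + e) ⊆ dilate a l q := by
  have hs := side_pos hl q.1
  refine cube_mono fun i => ?_
  have h := Finset.mem_Icc.1 (Fintype.mem_piFinset.1 he i)
  have h1 : (-2 : ℝ) ≤ e i := by exact_mod_cast h.1
  have h2 : (e i : ℝ) ≤ 2 := by exact_mod_cast h.2
  simp only [Pi.add_apply]
  push_cast
  constructor <;> nlinarith

theorem exists_offset_of_mem_dilate (hl : 0 < l) {q : Idx d} {x : Fin d → ℝ}
    (hx : x ∈ dilate a l q) : ∃ e ∈ offsets d, x ∈ gridCube a l (q.1, q.2 + e) := by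
  have hs := side_pos hl q.1
  refine ⟨gridIndex a l q.1 x - q.2, ?_, ?_⟩
  · refine Fintype.mem_piFinset.2 fun i => Finset.mem_Icc.2 ?_
    have h := hx i
    simp only at h
    rw [Pi.sub_apply]
    have h1 : -2 + q.2 i ≤ gridIndex a l q.1 x i := by
      rw [gridIndex, Int.le_floor, le_div_iff₀ hs]; push_cast; linarith [h.1]
    have h2 : gridIndex a l q.1 x i < 3 + q.2 i := by
      rw [gridIndex, Int.floor_lt, div_lt_iff₀ hs]; push_cast; linarith [h.2]
    constructor <;> omega
  · rw [mem_gridCube_iff hl]; simp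

theorem dilate_eq_biUnion (hl : 0 < l) (q : Idx d) :
    dilate a l q = ⋃ e ∈ offsets d, gridCube a l (q.1, q.2 + e) := by
  refine Set.Subset.antisymm (fun x hx => ?_) (Set.iUnion₂_subset fun e he =>
    gridCube_add_subset_dilate hl he)
  obtain ⟨e, he, h⟩ := exists_offset_of_mem_dilate hl hx
  exact Set.mem_biUnion he h

theorem gridCube_subset_dilate_of_mem (hl : 0 < l) {q : Idx d} {k : ℤ} (hk : q.1 ≤ k)
    {x : Fin d → ℝ} (hx : x ∈ dilate a l q) :
    gridCube a l (k, gridIndex a l k x) ⊆ dilate a l q := by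
  obtain ⟨e, he, h⟩ := exists_offset_of_mem_dilate hl hx
  exact (gridCube_subset_of_mem hl hk h (mem_gridCube_gridIndex hl k x)).trans
    (gridCube_add_subset_dilate hl he)

/-- The neighbour is at most two sides of `q` away, and `r` is at least as large as `q`, so the
margin of two sides of `r` reaches `q`. -/
theorem gridCube_subset_dilate_of_neighbor (hl : 0 < l) {q r : Idx d} {e : Fin d → ℤ}
    (he : e ∈ offsets d) (hr : r.1 ≤ q.1)
    (h : gridCube a l (q.1, q.2 + e) ⊆ gridCube a l r) : gridCube a l q ⊆ dilate a l r := by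
  have hs := side_pos hl q.1
  have h1 := cube_subset_cube hs h
  have h2 : l * (2 : ℝ) ^ (-q.1) ≤ l * (2 : ℝ) ^ (-r.1) :=
    mul_le_mul_of_nonneg_left (zpow_le_zpow_right₀ (by norm_num) (by omega)) hl.le
  refine cube_mono fun i => ?_
  have h := Finset.mem_Icc.1 (Fintype.mem_piFinset.1 he i)
  have h3 : (-2 : ℝ) ≤ e i := by exact_mod_cast h.1
  have h4 : (e i : ℝ) ≤ 2 := by exact_mod_cast h.2
  have h5 := h1 i
  simp only [Pi.add_apply] at h5
  push_cast at h5
  constructor <;> nlinarith [h5.1, h5.2]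

/-- Corners of the translated dyadic systems used to cover dilated cubes. -/
noncomputable def shift (n : ℤ) (u : Fin d → Bool) : Fin d → ℝ :=
  fun i => if u i then (2 : ℝ) ^ (-(n - 4)) / 3 else 0

/-- The one-third trick, coordinate by coordinate. Since 3 divides no power of two, the translation
by a third of the coarsest side is, modulo the side at any finer generation, again a third or two
thirds of that side. An interval cut by an endpoint of the original grid is therefore not cut by the
translated one. -/
theorem exists_shift_dilate_subset {n : ℤ} {q : Idx d} (hn : n ≤ q.1) :
    ∃ (u : Fin d → Bool) (m : Fin d → ℤ),
      dilate 0 1 q ⊆ gridCube (shift n u) 1 (q.1 - 4, m) := by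
  obtain ⟨r, hr⟩ := Int.le.dest hn
  have hs : (0 : ℝ) < 2 ^ (-q.1) := by positivity
  have hL : (2 : ℝ) ^ (-(q.1 - 4)) = 16 * 2 ^ (-q.1) := by
    rw [neg_sub, sub_eq_add_neg, zpow_add₀ (by norm_num)]; norm_num
  have hT : (2 : ℝ) ^ (-(n - 4)) = 2 ^ r * (16 * 2 ^ (-q.1)) := by
    rw [← hL, ← zpow_natCast, ← zpow_add₀ (by norm_num)]; congr 1; omega
  have key : ∀ i, ∃ (b : Bool) (m : ℤ),
      (if b then (2 : ℝ) ^ (-(n - 4)) / 3 else 0) + 2 ^ (-(q.1 - 4)) * m ≤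
        2 ^ (-q.1) * q.2 i - 2 * 2 ^ (-q.1) ∧
      2 ^ (-q.1) * q.2 i + 3 * 2 ^ (-q.1) ≤
        (if b then (2 : ℝ) ^ (-(n - 4)) / 3 else 0) + 2 ^ (-(q.1 - 4)) * m + 2 ^ (-(q.1 - 4)) := by
    intro i
    rw [hT, hL]
    set s : ℝ := 2 ^ (-q.1)
    set z : ℝ := ((q.2 i : ℝ) - 2) / 16 with hz
    have hz' : (q.2 i : ℝ) = 16 * z + 2 := by rw [hz]; ring
    have h1 := Int.floor_le z
    have h2 := Int.lt_floor_add_one z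
    rw [hz']
    -- In units of the large side, the interval starts at `z` and has length `5/16`, so it fits the
    -- original grid exactly when the fractional part is at most `11/16`. Otherwise it lies between
    -- `11/16 > 2/3` and `21/16 < 4/3`, away from translated endpoints at `1/3` or `2/3` modulo one;
    -- this is why the large cube is sixteen times larger.
    by_cases hf : z - ⌊z⌋ ≤ 11 / 16
    · refine ⟨false, ⌊z⌋, ?_, ?_⟩
      · simp only [Bool.false_eq_true, if_false]; nlinarith
      · simp only [Bool.false_eq_true, if_false]; nlinarith
    · push Not at hf
      have h3 : ∃ t : ℕ, 2 ^ r = 3 * t + 1 ∨ 2 ^ r = 3 * t + 2 := by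
        refine ⟨2 ^ r / 3, ?_⟩
        have : ¬ 3 ∣ 2 ^ r := fun h => by
          have := (Nat.prime_three.dvd_of_dvd_pow h); omega
        omega
      obtain ⟨t, ht⟩ := h3
      refine ⟨true, ⌊z⌋ - t, ?_⟩
      simp only [if_true]
      push_cast
      rcases ht with ht | ht
      · have ht' : (2 : ℝ) ^ r = 3 * t + 1 := by exact_mod_cast ht
        rw [ht']
        constructor <;> nlinarith
      · have ht' : (2 : ℝ) ^ r = 3 * t + 2 := by exact_mod_cast ht
        rw [ht']
        constructor <;> nlinarith
  choose u m h using key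
  refine ⟨u, m, cube_mono fun i => ?_⟩
  have h := h i
  simp only [shift, one_mul, Pi.zero_apply, zero_add]
  constructor <;> linarith [h.1, h.2]

end Geometry

/-! ### Cauchy–Schwarz in `ℝ≥0∞` -/

theorem lintegral_mul_sq_le {X : Type*} [MeasurableSpace X] {μ : Measure X} {f g : X → ℝ≥0∞}
    (hf : AEMeasurable f μ) (hg : AEMeasurable g μ) :
    (∫⁻ x, f x * g x ∂μ) ^ 2 ≤ (∫⁻ x, f x ^ 2 ∂μ) * ∫⁻ x, g x ^ 2 ∂μ := by
  have h := ENNReal.lintegral_mul_le_Lp_mul_Lq μ Real.HolderConjugate.two_two hf hg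
  have h2 : ∀ y : ℝ≥0∞, (y ^ (1 / 2 : ℝ)) ^ 2 = y := fun y => by
    rw [← ENNReal.rpow_natCast, ← ENNReal.rpow_mul]; norm_num
  calc (∫⁻ x, f x * g x ∂μ) ^ 2 ≤ _ := pow_le_pow_left' h 2
    _ = _ := by rw [mul_pow, h2, h2]; norm_cast

theorem sum_sq_le_of_sq_le_mul {ι : Type*} (s : Finset ι) {x y z : ι → ℝ≥0∞}
    (h : ∀ i ∈ s, z i ^ 2 ≤ x i * y i) :
    (∑ i ∈ s, z i) ^ 2 ≤ (∑ i ∈ s, x i) * ∑ i ∈ s, y i := by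
  have h2 : ∀ y : ℝ≥0∞, (y ^ (1 / 2 : ℝ)) ^ 2 = y := fun y => by
    rw [← ENNReal.rpow_natCast, ← ENNReal.rpow_mul]; norm_num
  have h3 : ∀ y : ℝ≥0∞, (y ^ (1 / 2 : ℝ)) ^ (2 : ℝ) = y := fun y => by
    rw [← ENNReal.rpow_mul]; norm_num
  have h1 : ∀ i ∈ s, z i ≤ x i ^ (1 / 2 : ℝ) * y i ^ (1 / 2 : ℝ) := by
    intro i hi
    rw [← ENNReal.pow_le_pow_left_iff two_ne_zero, mul_pow, h2, h2]
    exact h i hi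
  calc (∑ i ∈ s, z i) ^ 2 ≤ (∑ i ∈ s, x i ^ (1 / 2 : ℝ) * y i ^ (1 / 2 : ℝ)) ^ 2 :=
        pow_le_pow_left' (Finset.sum_le_sum h1) 2
    _ ≤ _ := pow_le_pow_left' (ENNReal.inner_le_Lp_mul_Lq s _ _ Real.HolderConjugate.two_two) 2
    _ = _ := by rw [mul_pow, h2, h2]; simp_rw [h3]

theorem add_sq_le_two_mul (x y : ℝ≥0∞) : (x + y) ^ 2 ≤ 2 * (x ^ 2 + y ^ 2) := by
  have := sum_sq_le_of_sq_le_mul (Finset.univ : Finset Bool) (x := fun _ => 1)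
    (y := fun b => if b then x ^ 2 else y ^ 2) (z := fun b => if b then x else y)
    (by intro i _; cases i <;> simp)
  simpa using this

theorem sum_two_zpow_le {ι : Type*} (t : Finset ι) (L : ι → ℤ) (hL : Set.InjOn L t) (M : ℤ)
    (hM : ∀ i ∈ t, L i ≤ M) : ∑ i ∈ t, (2 : ℝ≥0∞) ^ (L i) ≤ 2 * 2 ^ M := by
  classical
  have h1 : ∀ i ∈ t, (2 : ℝ≥0∞) ^ (L i) = 2 ^ M * (2⁻¹) ^ (M - L i).toNat := by
    intro i hi
    have : L i = M + -((M - L i).toNat : ℤ) := by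
      rw [Int.toNat_of_nonneg (by linarith [hM i hi])]; ring
    conv_lhs => rw [this]
    rw [ENNReal.zpow_add two_ne_zero ENNReal.ofNat_ne_top, ENNReal.zpow_neg, zpow_natCast,
      ENNReal.inv_pow]
  rw [Finset.sum_congr rfl h1, ← Finset.mul_sum, mul_comm]
  gcongr
  have hinj : Set.InjOn (fun i => (M - L i).toNat) t := by
    intro i hi j hj hij
    simp only at hij
    have := hM i hi; have := hM j hj
    exact hL hi hj (by omega)
  rw [← Finset.sum_image (f := fun n : ℕ => (2⁻¹ : ℝ≥0∞) ^ n) hinj]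
  calc _ ≤ ∑' n : ℕ, (2⁻¹ : ℝ≥0∞) ^ n := ENNReal.sum_le_tsum _
    _ = 2 := by rw [ENNReal.tsum_geometric]; simp

/-- Distinct powers of two sum to at most twice the largest, so cross terms cost only a constant.
This plays the part of sparseness for record cubes. -/
theorem sq_sum_two_zpow_le {ι : Type*} (t : Finset ι) (L : ι → ℤ) (hL : Set.InjOn L t) :
    (∑ i ∈ t, (2 : ℝ≥0∞) ^ (L i)) ^ 2 ≤ 4 * ∑ i ∈ t, ((2 : ℝ≥0∞) ^ (L i)) ^ 2 := by
  rcases t.eq_empty_or_nonempty with rfl | ht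
  · simp
  obtain ⟨j, hj, hmax⟩ := t.exists_max_image L ht
  calc _ ≤ (2 * (2 : ℝ≥0∞) ^ (L j)) ^ 2 := pow_le_pow_left' (sum_two_zpow_le t L hL _ hmax) 2
    _ = 4 * ((2 : ℝ≥0∞) ^ (L j)) ^ 2 := by rw [mul_pow]; norm_num
    _ ≤ _ := by
      gcongr
      exact Finset.single_le_sum (f := fun i => ((2 : ℝ≥0∞) ^ (L i)) ^ 2) (fun _ _ => zero_le) hj

/-! ### Record cubes -/

section Records

variable {d : ℕ} {a : Fin d → ℝ} {l : ℝ}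

/-- The cubes of a collection whose level exceeds that of all larger cubes containing them. -/
noncomputable def recordCubes (a : Fin d → ℝ) (l : ℝ) (s : Finset (Idx d)) (L : Idx d → ℤ) :
    Finset (Idx d) :=
  @Finset.filter _ (fun q => ∀ p ∈ s, p.1 < q.1 → gridCube a l q ⊆ gridCube a l p → L p < L q)
    (Classical.decPred _) s

theorem mem_recordCubes {s : Finset (Idx d)} {L : Idx d → ℤ} {q : Idx d} :
    q ∈ recordCubes a l s L ↔
      q ∈ s ∧ ∀ p ∈ s, p.1 < q.1 → gridCube a l q ⊆ gridCube a l p → L p < L q := by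
  simp [recordCubes]

theorem recordCubes_subset {s : Finset (Idx d)} {L : Idx d → ℤ} :
    recordCubes a l s L ⊆ s := fun _ hq => (mem_recordCubes.1 hq).1

theorem exists_recordCube {s : Finset (Idx d)} (L : Idx d → ℤ) {q : Idx d} (hq : q ∈ s) :
    ∃ r ∈ recordCubes a l s L, r.1 ≤ q.1 ∧ gridCube a l q ⊆ gridCube a l r ∧ L q ≤ L r := by
  classical
  obtain ⟨p, hp, hmin⟩ := (s.filter fun p => p.1 ≤ q.1 ∧ gridCube a l q ⊆ gridCube a l p ∧
    L q ≤ L p).exists_min_image (fun p => p.1) ⟨q, by simp [hq]⟩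
  simp only [Finset.mem_filter] at hp hmin
  refine ⟨p, mem_recordCubes.2 ⟨hp.1, fun t ht htp hsub => ?_⟩, hp.2⟩
  by_contra hlt
  push Not at hlt
  have := hmin t ⟨ht, htp.le.trans hp.2.1, hp.2.2.1.trans hsub, hp.2.2.2.trans hlt⟩
  omega

/-- Some record cube around `q` has at least the level of `q`, and levels increase along nested
records, so the smallest record cube around `q` has at least that level too. -/
theorem exists_minimal_recordCube (hl : 0 < l) {s : Finset (Idx d)} (L : Idx d → ℤ) {q : Idx d}
    (hq : q ∈ s) :
    ∃ r ∈ recordCubes a l s L, r.1 ≤ q.1 ∧ gridCube a l q ⊆ gridCube a l r ∧ L q ≤ L r ∧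
      ∀ t ∈ recordCubes a l s L, t.1 ≤ q.1 → gridCube a l q ⊆ gridCube a l t → t.1 ≤ r.1 := by
  classical
  obtain ⟨p, hp, hp1, hp2, hp3⟩ := exists_recordCube (a := a) (l := l) L hq
  obtain ⟨r, hr, hmax⟩ := ((recordCubes a l s L).filter fun p => p.1 ≤ q.1 ∧
    gridCube a l q ⊆ gridCube a l p).exists_max_image (fun p => p.1) ⟨p, by simp [hp, hp1, hp2]⟩
  simp only [Finset.mem_filter] at hr hmax
  refine ⟨r, hr.1, hr.2.1, hr.2.2, ?_, fun t ht h1 h2 => hmax t ⟨ht, h1, h2⟩⟩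
  have hpr := hmax p ⟨hp, hp1, hp2⟩
  obtain ⟨x, hx⟩ := gridCube_nonempty (a := a) hl q
  rcases hpr.eq_or_lt with h | h
  · rwa [← eq_of_mem_gridCube hl h (hp2 hx) (hr.2.2 hx)]
  · exact hp3.trans ((mem_recordCubes.1 hr.1).2 p (recordCubes_subset hp) h
      (gridCube_subset_of_mem hl hpr (hp2 hx) (hr.2.2 hx))).le

/-- Cubes through a common point are nested, and the level of a record exceeds the levels of all
larger members around it. -/
theorem injOn_level_recordCubes (hl : 0 < l) {s : Finset (Idx d)} (L : Idx d → ℤ)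
    (x : Fin d → ℝ) : Set.InjOn L {q | q ∈ recordCubes a l s L ∧ x ∈ gridCube a l q} := by
  rintro p ⟨hp, hxp⟩ q ⟨hq, hxq⟩ h
  rcases lt_trichotomy p.1 q.1 with h1 | h1 | h1
  · have := (mem_recordCubes.1 hq).2 p (recordCubes_subset hp) h1
      (gridCube_subset_of_mem hl h1.le hxp hxq)
    omega
  · exact eq_of_mem_gridCube hl h1 hxp hxq
  · have := (mem_recordCubes.1 hp).2 q (recordCubes_subset hq) h1
      (gridCube_subset_of_mem hl h1.le hxq hxp)
    omega

/-- Carleson embedding for record cubes. -/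
theorem sum_recordCubes_le (hl : 0 < l) {s : Finset (Idx d)} {L : Idx d → ℤ}
    {μ : Measure (Fin d → ℝ)} {φ : (Fin d → ℝ) → ℝ≥0∞} (hφ : Measurable φ)
    (hμ : ∀ q ∈ s, μ (gridCube a l q) ≠ ∞)
    (hL : ∀ q ∈ s, 2 ^ (L q) * μ (gridCube a l q) ≤ ∫⁻ x in gridCube a l q, φ x ∂μ) :
    ∑ q ∈ recordCubes a l s L, ((2 : ℝ≥0∞) ^ (L q)) ^ 2 * μ (gridCube a l q) ≤
      4 * ∫⁻ x, φ x ^ 2 ∂μ := by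
  classical
  set S := recordCubes a l s L with hS
  set X := ∑ q ∈ S, ((2 : ℝ≥0∞) ^ (L q)) ^ 2 * μ (gridCube a l q) with hX
  have h2 : ∀ n : ℤ, (2 : ℝ≥0∞) ^ n ≠ ∞ := fun n =>
    ENNReal.zpow_ne_top two_ne_zero ENNReal.ofNat_ne_top n
  -- The argument ends in `X ^ 2 ≤ 4 ‖φ‖² X`, and cancelling `X` needs its finiteness; a finite
  -- family provides it.
  have hXtop : X ≠ ∞ := (ENNReal.sum_lt_top.2 fun q hq => ENNReal.mul_lt_top
    (ENNReal.pow_lt_top (h2 _).lt_top) (hμ q (recordCubes_subset hq)).lt_top).ne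
  set G : (Fin d → ℝ) → ℝ≥0∞ := fun x => ∑ q ∈ S, (gridCube a l q).indicator
    (fun _ => (2 : ℝ≥0∞) ^ (L q)) x with hG
  have hGm : Measurable G := Finset.measurable_fun_sum _ fun q _ =>
    measurable_const.indicator (measurableSet_gridCube q)
  have h1 : X ≤ ∫⁻ x, φ x * G x ∂μ := by
    have : ∫⁻ x, φ x * G x ∂μ = ∑ q ∈ S, 2 ^ (L q) * ∫⁻ x in gridCube a l q, φ x ∂μ := by
      simp_rw [hG, Finset.mul_sum]
      have hm : ∀ q ∈ S, Measurable fun x => φ x * (gridCube a l q).indicator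
          (fun _ => (2 : ℝ≥0∞) ^ (L q)) x := fun q _ =>
        hφ.mul (measurable_const.indicator (measurableSet_gridCube q))
      rw [lintegral_finsetSum _ hm]
      refine Finset.sum_congr rfl fun q _ => ?_
      rw [← lintegral_const_mul _ hφ, ← lintegral_indicator (measurableSet_gridCube q)]
      congr 1; ext x
      by_cases hx : x ∈ gridCube a l q <;> simp [hx, mul_comm]
    rw [this]
    refine Finset.sum_le_sum fun q hq => ?_
    rw [sq, mul_assoc]
    gcongr
    exact hL q (recordCubes_subset hq)
  have h3 : ∫⁻ x, G x ^ 2 ∂μ ≤ 4 * X := by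
    -- At each point the exponents in `G` are distinct, so the square of the sum is comparable to
    -- the sum of the squares.
    have hpt : ∀ x, G x ^ 2 ≤ 4 * ∑ q ∈ S, (gridCube a l q).indicator
        (fun _ => ((2 : ℝ≥0∞) ^ (L q)) ^ 2) x := by
      intro x
      have := sq_sum_two_zpow_le (S.filter fun q => x ∈ gridCube a l q) L (by
        have := injOn_level_recordCubes hl (s := s) (a := a) L x
        intro p hp q hq
        simp only [Finset.coe_filter] at hp hq
        exact this hp hq)
      simpa only [hG, Finset.sum_filter, Set.indicator_apply] using this
    calc _ ≤ ∫⁻ x, (4 * ∑ q ∈ S, (gridCube a l q).indicator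
        (fun _ => ((2 : ℝ≥0∞) ^ (L q)) ^ 2) x) ∂μ := lintegral_mono hpt
      _ = 4 * X := by
        rw [lintegral_const_mul _ (Finset.measurable_fun_sum _ fun q _ =>
            measurable_const.indicator (measurableSet_gridCube q)),
          lintegral_finsetSum _ fun q _ => measurable_const.indicator (measurableSet_gridCube q)]
        congr 1
        exact Finset.sum_congr rfl fun q _ => lintegral_indicator_const (measurableSet_gridCube q) _
  have h4 : X ^ 2 ≤ (4 * ∫⁻ x, φ x ^ 2 ∂μ) * X := by
    calc X ^ 2 ≤ (∫⁻ x, φ x * G x ∂μ) ^ 2 := pow_le_pow_left' h1 2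
      _ ≤ (∫⁻ x, φ x ^ 2 ∂μ) * ∫⁻ x, G x ^ 2 ∂μ :=
        lintegral_mul_sq_le hφ.aemeasurable hGm.aemeasurable
      _ ≤ (∫⁻ x, φ x ^ 2 ∂μ) * (4 * X) := by gcongr
      _ = _ := by ring
  by_cases hX0 : X = 0
  · rw [hX0]; exact zero_le
  rw [sq] at h4
  exact (ENNReal.mul_le_mul_iff_left hX0 hXtop).1 h4

end Records

/-! ### The two-weight theorem for positive dyadic operators -/

theorem lintegral_biUnion_finset_le {X ι : Type*} [MeasurableSpace X] {μ : Measure X}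
    (s : Finset ι) (E : ι → Set X) (f : X → ℝ≥0∞) :
    ∫⁻ x in ⋃ i ∈ s, E i, f x ∂μ ≤ ∑ i ∈ s, ∫⁻ x in E i, f x ∂μ := by
  classical
  induction s using Finset.induction_on with
  | empty => simp
  | insert i s hi ih =>
    rw [Finset.set_biUnion_insert, Finset.sum_insert hi]
    exact (lintegral_union_le _ _ _).trans (add_le_add le_rfl ih)

section TwoWeight

variable {d : ℕ} {a : Fin d → ℝ} {l : ℝ}

/-- The maximal record cubes strictly inside a given cube. -/
noncomputable def recordChildren (a : Fin d → ℝ) (l : ℝ) (S : Finset (Idx d)) (r : Idx d) :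
    Finset (Idx d) :=
  maximalCubes a l (@Finset.filter _ (fun q => r.1 < q.1 ∧ gridCube a l q ⊆ gridCube a l r)
    (Classical.decPred _) S)

theorem mem_of_mem_recordChildren {S : Finset (Idx d)} {r q : Idx d}
    (hq : q ∈ recordChildren a l S r) :
    q ∈ S ∧ r.1 < q.1 ∧ gridCube a l q ⊆ gridCube a l r := by
  simpa using maximalCubes_subset _ hq

theorem exists_mem_recordChildren (hl : 0 < l) {S : Finset (Idx d)} {r q : Idx d} (hq : q ∈ S)
    (h1 : r.1 < q.1) (h2 : gridCube a l q ⊆ gridCube a l r) :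
    ∃ p ∈ recordChildren a l S r, gridCube a l q ⊆ gridCube a l p := by
  obtain ⟨p, hp, -, h⟩ := exists_mem_maximalCubes (a := a) hl
    (s := @Finset.filter _ (fun q => r.1 < q.1 ∧ gridCube a l q ⊆ gridCube a l r)
    (Classical.decPred _) S) (q := q) (by simp [hq, h1, h2])
  exact ⟨p, hp, h⟩

/-- The part of a cube not covered by the smaller record cubes. -/
def recordRemainder (a : Fin d → ℝ) (l : ℝ) (S : Finset (Idx d)) (r : Idx d) :
    Set (Fin d → ℝ) :=
  gridCube a l r \ ⋃ q ∈ recordChildren a l S r, gridCube a l q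

theorem measurableSet_recordRemainder (S : Finset (Idx d)) (r : Idx d) :
    MeasurableSet (recordRemainder a l S r) :=
  (measurableSet_gridCube r).diff
    (Finset.measurableSet_biUnion _ fun q _ => measurableSet_gridCube q)

/-- If two cubes of `S` are nested, the smaller lies inside a child of the larger, and the remainder
of the larger omits its children. -/
theorem pairwiseDisjoint_recordRemainder (hl : 0 < l) (S : Finset (Idx d)) :
    (S : Set (Idx d)).PairwiseDisjoint (recordRemainder a l S) := by
  have key : ∀ p ∈ S, ∀ q ∈ S, p.1 < q.1 →
      Disjoint (recordRemainder a l S p) (recordRemainder a l S q) := by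
    intro p _ q hq h
    refine Set.disjoint_left.2 fun x hxp hxq => ?_
    obtain ⟨t, ht, hqt⟩ := exists_mem_recordChildren hl hq h
      (gridCube_subset_of_mem hl h.le hxp.1 hxq.1)
    exact hxp.2 (Set.mem_biUnion ht (hqt hxq.1))
  intro p hp q hq hne
  rcases lt_trichotomy p.1 q.1 with h | h | h
  · exact key p hp q hq h
  · exact (disjoint_gridCube_of_ne hl h hne).mono Set.sdiff_subset Set.sdiff_subset
  · exact (key q hq p hp h).symm

theorem pairwiseDisjoint_recordChildren (hl : 0 < l) (S : Finset (Idx d)) :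
    (S : Set (Idx d)).PairwiseDisjoint (recordChildren a l S) := by
  have key : ∀ p ∈ S, ∀ q ∈ S, p.1 < q.1 →
      Disjoint (recordChildren a l S p) (recordChildren a l S q) := by
    intro p _ q hq h
    refine Finset.disjoint_left.2 fun t htp htq => ?_
    have h1 := mem_of_mem_recordChildren htp
    have h2 := mem_of_mem_recordChildren htq
    obtain ⟨x, hx⟩ := gridCube_nonempty (a := a) hl t
    have hqp := gridCube_subset_of_mem hl h.le (h1.2.2 hx) (h2.2.2 hx)
    have h3 : q ∈ @Finset.filter _ (fun q => p.1 < q.1 ∧ gridCube a l q ⊆ gridCube a l p)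
      (Classical.decPred _) S := by
        simp only [Finset.mem_filter]; exact ⟨hq, h, hqp⟩
    simp only [recordChildren, maximalCubes, Finset.mem_filter] at htp
    exact Set.disjoint_left.1 (htp.2 q ⟨hq, h, hqp⟩ h2.2.1) (h2.2.2 hx) hx
  intro p hp q hq hne
  rcases lt_trichotomy p.1 q.1 with h | h | h
  · exact key p hp q hq h
  · refine Finset.disjoint_left.2 fun t htp htq => ?_
    have h1 := mem_of_mem_recordChildren htp
    have h2 := mem_of_mem_recordChildren htq
    obtain ⟨x, hx⟩ := gridCube_nonempty (a := a) hl t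
    exact hne (eq_of_mem_gridCube hl h (h1.2.2 hx) (h2.2.2 hx))
  · exact (key q hq p hp h).symm

/-- A function averaged over the record children of a cube. -/
noncomputable def recordAverage (a : Fin d → ℝ) (l : ℝ) (S : Finset (Idx d))
    (ν : Measure (Fin d → ℝ)) (ψ : (Fin d → ℝ) → ℝ≥0∞) (r : Idx d) (x : Fin d → ℝ) : ℝ≥0∞ :=
  (recordRemainder a l S r).indicator ψ x + ∑ q ∈ recordChildren a l S r,
    (gridCube a l q).indicator (fun _ => (∫⁻ y in gridCube a l q, ψ y ∂ν) / ν (gridCube a l q)) x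

variable {ν : Measure (Fin d → ℝ)} {ψ : (Fin d → ℝ) → ℝ≥0∞} {S : Finset (Idx d)}

theorem measurable_recordAverage (hψ : Measurable ψ) (r : Idx d) :
    Measurable (recordAverage a l S ν ψ r) :=
  (hψ.indicator (measurableSet_recordRemainder S r)).add
    (Finset.measurable_fun_sum _ fun q _ => measurable_const.indicator (measurableSet_gridCube q))

/-- The remainder and the children are pairwise disjoint, so squaring produces no cross terms. -/
theorem lintegral_recordAverage_sq_le (hl : 0 < l)
    (hν0 : ∀ q ∈ S, ν (gridCube a l q) ≠ 0) (hν : ∀ q ∈ S, ν (gridCube a l q) ≠ ∞)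
    (hψ : Measurable ψ) (r : Idx d) :
    ∫⁻ x, recordAverage a l S ν ψ r x ^ 2 ∂ν ≤ ∫⁻ x in recordRemainder a l S r, ψ x ^ 2 ∂ν +
      ∑ q ∈ recordChildren a l S r,
        (∫⁻ y in gridCube a l q, ψ y ∂ν) ^ 2 / ν (gridCube a l q) := by
  classical
  set c : Idx d → ℝ≥0∞ := fun q => (∫⁻ y in gridCube a l q, ψ y ∂ν) / ν (gridCube a l q) with hc
  have hpt : ∀ x, recordAverage a l S ν ψ r x ^ 2 ≤
      (recordRemainder a l S r).indicator (fun y => ψ y ^ 2) x +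
      ∑ q ∈ recordChildren a l S r, (gridCube a l q).indicator (fun _ => c q ^ 2) x := by
    intro x
    rw [recordAverage]
    by_cases hx : ∃ q ∈ recordChildren a l S r, x ∈ gridCube a l q
    · obtain ⟨q, hq, hxq⟩ := hx
      have h1 : x ∉ recordRemainder a l S r := fun h => h.2 (Set.mem_biUnion hq hxq)
      have h2 : ∀ p ∈ recordChildren a l S r, p ≠ q → x ∉ gridCube a l p := fun p hp hne hxp =>
        Set.disjoint_left.1 (disjoint_of_mem_maximalCubes hl hp hq hne) hxp hxq
      rw [Set.indicator_of_notMem h1, Set.indicator_of_notMem h1,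
        Finset.sum_eq_single_of_mem q hq fun p hp hne => Set.indicator_of_notMem (h2 p hp hne) _,
        Finset.sum_eq_single_of_mem q hq fun p hp hne => Set.indicator_of_notMem (h2 p hp hne) _]
      simp [hxq, hc]
    · push Not at hx
      rw [Finset.sum_eq_zero fun p hp => Set.indicator_of_notMem (hx p hp) _]
      by_cases h : x ∈ recordRemainder a l S r <;> simp [h]
  refine (lintegral_mono hpt).trans ?_
  rw [lintegral_add_left ((hψ.pow_const 2).indicator (measurableSet_recordRemainder S r)),
    lintegral_indicator (measurableSet_recordRemainder S r),
    lintegral_finsetSum _ fun q _ => measurable_const.indicator (measurableSet_gridCube q)]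
  gcongr with q hq
  rw [lintegral_indicator_const (measurableSet_gridCube q), hc]
  have hqS := (mem_of_mem_recordChildren hq).1
  simp only [div_eq_mul_inv]
  rw [mul_pow, mul_assoc, sq (ν _)⁻¹, mul_assoc, ENNReal.inv_mul_cancel (hν0 q hqS) (hν q hqS),
    mul_one]

/-- Averaging over a child inside `q` preserves its integral, and children disjoint from `q` play no
role. Only a child strictly larger than `q` could spoil the replacement. -/
theorem lintegral_le_lintegral_recordAverage
    (hν0 : ∀ q ∈ S, ν (gridCube a l q) ≠ 0) (hν : ∀ q ∈ S, ν (gridCube a l q) ≠ ∞)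
    (hψ : Measurable ψ) {r q : Idx d} (hqr : gridCube a l q ⊆ gridCube a l r)
    (h : ∀ t ∈ recordChildren a l S r, Disjoint (gridCube a l q) (gridCube a l t) ∨
      gridCube a l t ⊆ gridCube a l q) :
    ∫⁻ x in gridCube a l q, ψ x ∂ν ≤ ∫⁻ x in gridCube a l q, recordAverage a l S ν ψ r x ∂ν := by
  have hm : ∀ t ∈ recordChildren a l S r, Measurable fun x => (gridCube a l t).indicator
      (fun _ => (∫⁻ y in gridCube a l t, ψ y ∂ν) / ν (gridCube a l t)) x := fun t _ =>
    measurable_const.indicator (measurableSet_gridCube t)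
  have hcover : gridCube a l q ⊆ (gridCube a l q ∩ recordRemainder a l S r) ∪
      ⋃ t ∈ recordChildren a l S r, gridCube a l q ∩ gridCube a l t := by
    intro x hx
    by_cases hxt : ∃ t ∈ recordChildren a l S r, x ∈ gridCube a l t
    · obtain ⟨t, ht, hxt⟩ := hxt
      exact Or.inr (Set.mem_biUnion ht ⟨hx, hxt⟩)
    · refine Or.inl ⟨hx, hqr hx, fun hU => hxt ?_⟩
      simpa using hU
  calc ∫⁻ x in gridCube a l q, ψ x ∂ν
      ≤ ∫⁻ x in (gridCube a l q ∩ recordRemainder a l S r) ∪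
      ⋃ t ∈ recordChildren a l S r, gridCube a l q ∩ gridCube a l t, ψ x ∂ν :=
        lintegral_mono_set hcover
    _ ≤ ∫⁻ x in gridCube a l q ∩ recordRemainder a l S r, ψ x ∂ν +
        ∫⁻ x in ⋃ t ∈ recordChildren a l S r, gridCube a l q ∩ gridCube a l t, ψ x ∂ν :=
        lintegral_union_le _ _ _
    _ ≤ ∫⁻ x in gridCube a l q ∩ recordRemainder a l S r, ψ x ∂ν +
        ∑ t ∈ recordChildren a l S r, ∫⁻ x in gridCube a l q ∩ gridCube a l t, ψ x ∂ν := by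
        gcongr
        exact lintegral_biUnion_finset_le _ _ _
    _ ≤ _ := by
        unfold recordAverage
        rw [lintegral_add_left (hψ.indicator (measurableSet_recordRemainder S r)),
          lintegral_indicator (measurableSet_recordRemainder S r),
          Measure.restrict_restrict (measurableSet_recordRemainder S r),
          lintegral_finsetSum _ hm, Set.inter_comm (recordRemainder a l S r)]
        refine add_le_add le_rfl (Finset.sum_le_sum fun t ht => ?_)
        rw [lintegral_indicator_const (measurableSet_gridCube t),
          Measure.restrict_apply (measurableSet_gridCube t)]
        have htS := (mem_of_mem_recordChildren ht).1
        rcases h t ht with h1 | h1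
        · rw [Set.disjoint_iff_inter_eq_empty.1 h1]; simp
        · rw [Set.inter_eq_right.2 h1, Set.inter_eq_left.2 h1,
            ENNReal.div_mul_cancel (hν0 t htS) (hν t htS)]

end TwoWeight

/-! ### Testing conditions imply the two-weight bound -/

section TwoWeightTheorem

variable {d : ℕ} {a : Fin d → ℝ} {l : ℝ} {ι : Type*}

theorem setLIntegral_sq_le {X : Type*} [MeasurableSpace X] {μ : Measure X} {f : X → ℝ≥0∞}
    (hf : Measurable f) (E : Set X) :
    (∫⁻ x in E, f x ∂μ) ^ 2 ≤ (∫⁻ x in E, f x ^ 2 ∂μ) * μ E := by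
  have := lintegral_mul_sq_le (μ := μ.restrict E) hf.aemeasurable
    (aemeasurable_const (b := (1 : ℝ≥0∞)))
  simpa using this

theorem setLIntegral_ne_top_of_sq {X : Type*} [MeasurableSpace X] {μ : Measure X} {f : X → ℝ≥0∞}
    (hf : Measurable f) (h : ∫⁻ x, f x ^ 2 ∂μ ≠ ∞) {E : Set X} (hE : μ E ≠ ∞) :
    ∫⁻ x in E, f x ∂μ ≠ ∞ := by
  intro htop
  have h1 := setLIntegral_sq_le (μ := μ) hf E
  rw [htop] at h1
  have h2 : (∫⁻ x in E, f x ^ 2 ∂μ) * μ E < ∞ := ENNReal.mul_lt_top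
    ((setLIntegral_le_lintegral _ _).trans_lt h.lt_top) hE.lt_top
  have : (∞ : ℝ≥0∞) ^ 2 = ∞ := by simp
  rw [this] at h1
  exact absurd h2 (not_lt.2 h1)

-- The half of the testing theorem where `φ` dominates. Each cube is filed under the smallest record
-- cube `r` of the `μ`-averages of `φ` that contains it, and its average of `φ` is then at most `2 *
-- 2 ^ L r`. What remains under `r` is the testing function of `r` paired with `ψ`, and there `ψ`
-- may be averaged over the record children. The averaged part is controlled through `hle` by the
-- Carleson sum of `φ`, and Cauchy–Schwarz over `r` finishes.
open scoped Classical in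
theorem dyadic_form_sq_le_of_dominated (hl : 0 < l) (I : Finset ι) (Q : ι → Idx d) (c : ι → ℝ≥0∞)
    {μ ν : Measure (Fin d → ℝ)} {φ ψ : (Fin d → ℝ) → ℝ≥0∞} (hφ : Measurable φ)
    (hψ : Measurable ψ)
    (hμ0 : ∀ i ∈ I, μ (gridCube a l (Q i)) ≠ 0) (hμ : ∀ i ∈ I, μ (gridCube a l (Q i)) ≠ ∞)
    (hν0 : ∀ i ∈ I, ν (gridCube a l (Q i)) ≠ 0) (hν : ∀ i ∈ I, ν (gridCube a l (Q i)) ≠ ∞)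
    {K : ℝ≥0∞}
    (htest : ∀ i ∈ I, ∫⁻ x, (∑ j ∈ I with gridCube a l (Q j) ⊆ gridCube a l (Q i),
      (gridCube a l (Q j)).indicator (fun _ => c j * μ (gridCube a l (Q j))) x) ^ 2 ∂ν ≤
        K * μ (gridCube a l (Q i)))
    (hφ2 : ∫⁻ x, φ x ^ 2 ∂μ ≠ ∞) (hφ0 : ∀ i ∈ I, ∫⁻ x in gridCube a l (Q i), φ x ∂μ ≠ 0)
    (hle : ∀ i ∈ I, (∫⁻ x in gridCube a l (Q i), ψ x ∂ν) ^ 2 / ν (gridCube a l (Q i)) ≤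
      (∫⁻ x in gridCube a l (Q i), φ x ∂μ) ^ 2 / μ (gridCube a l (Q i))) :
    (∑ i ∈ I, c i * (∫⁻ x in gridCube a l (Q i), φ x ∂μ) *
      ∫⁻ x in gridCube a l (Q i), ψ x ∂ν) ^ 2 ≤
      256 * K * (∫⁻ x, φ x ^ 2 ∂μ) * (∫⁻ x, φ x ^ 2 ∂μ + ∫⁻ x, ψ x ^ 2 ∂ν) := by
  set D : Idx d → Set (Fin d → ℝ) := gridCube a l with hD
  have hDm : ∀ q, MeasurableSet (D q) := measurableSet_gridCube
  set s : Finset (Idx d) := I.image Q with hs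
  have hs' : ∀ q ∈ s, ∃ i ∈ I, Q i = q := fun q hq => by simpa [hs] using hq
  have hQs : ∀ i ∈ I, Q i ∈ s := fun i hi => Finset.mem_image_of_mem Q hi
  have Hμ0 : ∀ q ∈ s, μ (D q) ≠ 0 := fun q hq => by obtain ⟨i, hi, rfl⟩ := hs' q hq; exact hμ0 i hi
  have Hμ : ∀ q ∈ s, μ (D q) ≠ ∞ := fun q hq => by obtain ⟨i, hi, rfl⟩ := hs' q hq; exact hμ i hi
  have Hν0 : ∀ q ∈ s, ν (D q) ≠ 0 := fun q hq => by obtain ⟨i, hi, rfl⟩ := hs' q hq; exact hν0 i hi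
  have Hν : ∀ q ∈ s, ν (D q) ≠ ∞ := fun q hq => by obtain ⟨i, hi, rfl⟩ := hs' q hq; exact hν i hi
  have h2top : ∀ n : ℤ, (2 : ℝ≥0∞) ^ n ≠ ∞ := fun n =>
    ENNReal.zpow_ne_top two_ne_zero ENNReal.ofNat_ne_top n
  -- levels
  have hlev : ∀ q : Idx d, ∃ n : ℤ, q ∈ s → (2 : ℝ≥0∞) ^ n * μ (D q) ≤ ∫⁻ x in D q, φ x ∂μ ∧
      ∫⁻ x in D q, φ x ∂μ ≤ 2 * 2 ^ n * μ (D q) := by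
    intro q
    by_cases hq : q ∈ s
    · obtain ⟨i, hi, rfl⟩ := hs' q hq
      obtain ⟨n, hn⟩ := ENNReal.exists_mem_Ico_zpow
        (x := (∫⁻ x in D (Q i), φ x ∂μ) / μ (D (Q i))) (y := 2)
        (ENNReal.div_ne_zero.2 ⟨hφ0 i hi, hμ i hi⟩)
        (ENNReal.div_ne_top (setLIntegral_ne_top_of_sq hφ hφ2 (hμ i hi)) (hμ0 i hi))
        ENNReal.one_lt_two ENNReal.ofNat_ne_top
      refine ⟨n, fun _ => ⟨?_, ?_⟩⟩
      · exact (ENNReal.le_div_iff_mul_le (Or.inl (hμ0 i hi)) (Or.inl (hμ i hi))).1 hn.1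
      · refine (ENNReal.div_le_iff_le_mul (Or.inl (hμ0 i hi)) (Or.inl (hμ i hi))).1
          (hn.2.le.trans ?_)
        rw [ENNReal.zpow_add two_ne_zero ENNReal.ofNat_ne_top, zpow_one, mul_comm]
    · exact ⟨0, fun h => absurd h hq⟩
  choose L hL using hlev
  set S := recordCubes a l s L with hS
  have hSs : ∀ q ∈ S, q ∈ s := fun q hq => recordCubes_subset hq
  set X := ∑ q ∈ S, ((2 : ℝ≥0∞) ^ (L q)) ^ 2 * μ (D q) with hX
  have hXle : X ≤ 4 * ∫⁻ x, φ x ^ 2 ∂μ := sum_recordCubes_le hl hφ Hμ fun q hq => (hL q hq).1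
  -- the minimal record cube containing a cube
  have hπ : ∀ i : ι, ∃ r : Idx d, i ∈ I → r ∈ S ∧ r.1 ≤ (Q i).1 ∧ D (Q i) ⊆ D r ∧ L (Q i) ≤ L r ∧
      ∀ t ∈ S, t.1 ≤ (Q i).1 → D (Q i) ⊆ D t → t.1 ≤ r.1 := by
    intro i
    by_cases hi : i ∈ I
    · obtain ⟨r, h1, h2, h3, h4, h5⟩ := exists_minimal_recordCube (a := a) hl L (hQs i hi)
      exact ⟨r, fun _ => ⟨h1, h2, h3, h4, h5⟩⟩
    · exact ⟨Q i, fun h => absurd h hi⟩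
  choose π hπ using hπ
  -- A bound for the squared `L²(ν)` norm of the averaged `ψ`. The children's terms have been traded
  -- for those of `φ` through `hle`, the 4 being the square of the gap between a level and its
  -- average. Remainders are disjoint and each record is a child of at most one record, so the sum
  -- over `r` stays bounded.
  set W : Idx d → ℝ≥0∞ := fun r => ∫⁻ x in recordRemainder a l S r, ψ x ^ 2 ∂ν +
      ∑ q ∈ recordChildren a l S r, 4 * (((2 : ℝ≥0∞) ^ (L q)) ^ 2 * μ (D q)) with hW
  set Z : Idx d → ℝ≥0∞ := fun r => ∑ i ∈ I with π i = r,
    c i * μ (D (Q i)) * ∫⁻ x in D (Q i), ψ x ∂ν with hZ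
  -- the estimate for one record cube
  have hone : ∀ r ∈ S, Z r ^ 2 ≤ K * μ (D r) * W r := by
    intro r hr
    obtain ⟨i₀, hi₀, hQr⟩ := hs' r (hSs r hr)
    set H : (Fin d → ℝ) → ℝ≥0∞ := fun x => ∑ i ∈ I with π i = r,
      (D (Q i)).indicator (fun _ => c i * μ (D (Q i))) x with hH
    have hHm : Measurable H := Finset.measurable_fun_sum _ fun q _ =>
      measurable_const.indicator (hDm _)
    have hR := measurable_recordAverage (a := a) (l := l) (S := S) (ν := ν) hψ r
    have h1 : Z r ≤ ∫⁻ x, H x * recordAverage a l S ν ψ r x ∂ν := by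
      have : ∫⁻ x, H x * recordAverage a l S ν ψ r x ∂ν = ∑ i ∈ I with π i = r,
          c i * μ (D (Q i)) * ∫⁻ x in D (Q i), recordAverage a l S ν ψ r x ∂ν := by
        simp_rw [hH, Finset.sum_mul]
        have hm : ∀ i ∈ I.filter (fun i => π i = r), Measurable fun x => (D (Q i)).indicator
            (fun _ => c i * μ (D (Q i))) x * recordAverage a l S ν ψ r x := fun i _ =>
          (measurable_const.indicator (hDm _)).mul hR
        rw [lintegral_finsetSum _ hm]
        refine Finset.sum_congr rfl fun i _ => ?_
        rw [← lintegral_const_mul _ hR, ← lintegral_indicator (hDm _)]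
        congr 1; ext x
        by_cases hx : x ∈ D (Q i) <;> simp [hx]
      rw [this]
      refine Finset.sum_le_sum fun i hi => ?_
      obtain ⟨hiI, rfl⟩ := Finset.mem_filter.1 hi
      obtain ⟨-, hp2, hp3, -, hp5⟩ := hπ i hiI
      refine mul_le_mul' le_rfl (lintegral_le_lintegral_recordAverage
        (fun q hq => Hν0 q (hSs q hq)) (fun q hq => Hν q (hSs q hq)) hψ hp3 fun t ht => ?_)
      obtain ⟨htS, ht1, -⟩ := mem_of_mem_recordChildren ht
      by_cases hd : Disjoint (gridCube a l (Q i)) (gridCube a l t)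
      · exact Or.inl hd
      obtain ⟨x, hx1, hx2⟩ := Set.not_disjoint_iff.1 hd
      rcases le_total (Q i).1 t.1 with h | h
      · exact Or.inr (gridCube_subset_of_mem hl h hx1 hx2)
      -- A child containing `Q i` would be a record cube around `Q i` smaller than `π i`, against
      -- minimality.
      · have := hp5 t htS h (gridCube_subset_of_mem hl h hx2 hx1)
        omega
    calc Z r ^ 2 ≤ (∫⁻ x, H x * recordAverage a l S ν ψ r x ∂ν) ^ 2 := pow_le_pow_left' h1 2
      _ ≤ (∫⁻ x, H x ^ 2 ∂ν) * ∫⁻ x, recordAverage a l S ν ψ r x ^ 2 ∂ν :=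
        lintegral_mul_sq_le hHm.aemeasurable hR.aemeasurable
      _ ≤ K * μ (D r) * W r := by
        gcongr
        · rw [← hQr]
          refine le_trans (lintegral_mono fun x => ?_) (htest i₀ hi₀)
          refine pow_le_pow_left' (Finset.sum_le_sum_of_subset fun i hi => ?_) 2
          obtain ⟨hiI, hir⟩ := Finset.mem_filter.1 hi
          refine Finset.mem_filter.2 ⟨hiI, ?_⟩
          rw [hQr, ← hir]
          exact (hπ i hiI).2.2.1
        · refine (lintegral_recordAverage_sq_le hl (fun q hq => Hν0 q (hSs q hq))
            (fun q hq => Hν q (hSs q hq)) hψ r).trans ?_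
          refine add_le_add le_rfl (Finset.sum_le_sum fun q hq => ?_)
          have hqs := hSs q (mem_of_mem_recordChildren hq).1
          obtain ⟨i, hi, rfl⟩ := hs' q hqs
          refine (hle i hi).trans ?_
          rw [ENNReal.div_le_iff_le_mul (Or.inl (hμ0 i hi)) (Or.inl (hμ i hi))]
          refine (pow_le_pow_left' (hL _ hqs).2 2).trans (le_of_eq ?_)
          simp only [hD]
          ring
  have hsumW : ∑ r ∈ S, W r ≤ ∫⁻ x, ψ x ^ 2 ∂ν + 4 * X := by
    rw [hW, Finset.sum_add_distrib]
    refine add_le_add ?_ ?_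
    · rw [← lintegral_biUnion_finset (pairwiseDisjoint_recordRemainder hl S)
        fun q _ => measurableSet_recordRemainder S q]
      exact setLIntegral_le_lintegral _ _
    · rw [← Finset.sum_biUnion (pairwiseDisjoint_recordChildren hl S), ← Finset.mul_sum]
      gcongr
      refine Finset.sum_le_sum_of_subset fun q hq => ?_
      obtain ⟨r, -, hq⟩ := Finset.mem_biUnion.1 hq
      exact (mem_of_mem_recordChildren hq).1
  have hY : ∑ i ∈ I, c i * (∫⁻ x in D (Q i), φ x ∂μ) * ∫⁻ x in D (Q i), ψ x ∂ν ≤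
      ∑ r ∈ S, 2 * 2 ^ (L r) * Z r := by
    rw [← Finset.sum_fiberwise_of_maps_to (s := I) (t := S) (g := π) fun i hi => (hπ i hi).1]
    refine Finset.sum_le_sum fun r _ => ?_
    rw [hZ, Finset.mul_sum]
    refine Finset.sum_le_sum fun i hi => ?_
    obtain ⟨hiI, rfl⟩ := Finset.mem_filter.1 hi
    have h1 : (2 : ℝ≥0∞) ^ (L (Q i)) ≤ 2 ^ (L (π i)) :=
      ENNReal.zpow_le_of_le one_le_two (hπ i hiI).2.2.2.1
    calc _ ≤ c i * (2 * 2 ^ (L (π i)) * μ (D (Q i))) * ∫⁻ x in D (Q i), ψ x ∂ν := by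
          gcongr
          exact (hL _ (hQs i hiI)).2.trans (by gcongr)
      _ = _ := by ring
  calc _ ≤ (∑ r ∈ S, 2 * 2 ^ (L r) * Z r) ^ 2 := pow_le_pow_left' hY 2
    _ ≤ (∑ r ∈ S, 4 * K * (((2 : ℝ≥0∞) ^ (L r)) ^ 2 * μ (D r))) * ∑ r ∈ S, W r := by
      -- Cauchy–Schwarz over record cubes: the first factor is the Carleson sum `X`, the second the
      -- sum of the `W r`.
      refine sum_sq_le_of_sq_le_mul S fun r hr => ?_
      calc _ = 4 * (2 ^ (L r)) ^ 2 * Z r ^ 2 := by ring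
        _ ≤ 4 * (2 ^ (L r)) ^ 2 * (K * μ (D r) * W r) := by gcongr; exact hone r hr
        _ = _ := by ring
    _ = 4 * K * X * ∑ r ∈ S, W r := by rw [← Finset.mul_sum]
    _ ≤ 4 * K * (4 * ∫⁻ x, φ x ^ 2 ∂μ) * (∫⁻ x, ψ x ^ 2 ∂ν + 4 * (4 * ∫⁻ x, φ x ^ 2 ∂μ)) := by
      gcongr
      exact hsumW.trans (by gcongr)
    _ ≤ 4 * K * (4 * ∫⁻ x, φ x ^ 2 ∂μ) *
        (16 * ∫⁻ x, ψ x ^ 2 ∂ν + 4 * (4 * ∫⁻ x, φ x ^ 2 ∂μ)) := by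
      gcongr
      exact le_mul_of_one_le_left' (by norm_num)
    _ = _ := by ring

open scoped Classical in
/-- The testing theorem for positive dyadic forms. -/
theorem dyadic_form_sq_le (hl : 0 < l) (I : Finset ι) (Q : ι → Idx d) (c : ι → ℝ≥0∞)
    {μ ν : Measure (Fin d → ℝ)} {φ ψ : (Fin d → ℝ) → ℝ≥0∞} (hφ : Measurable φ)
    (hψ : Measurable ψ)
    (hμ0 : ∀ i ∈ I, μ (gridCube a l (Q i)) ≠ 0) (hμ : ∀ i ∈ I, μ (gridCube a l (Q i)) ≠ ∞)
    (hν0 : ∀ i ∈ I, ν (gridCube a l (Q i)) ≠ 0) (hν : ∀ i ∈ I, ν (gridCube a l (Q i)) ≠ ∞)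
    {K₁ K₂ : ℝ≥0∞}
    (htest₁ : ∀ i ∈ I, ∫⁻ x, (∑ j ∈ I with gridCube a l (Q j) ⊆ gridCube a l (Q i),
      (gridCube a l (Q j)).indicator (fun _ => c j * μ (gridCube a l (Q j))) x) ^ 2 ∂ν ≤
        K₁ * μ (gridCube a l (Q i)))
    (htest₂ : ∀ i ∈ I, ∫⁻ x, (∑ j ∈ I with gridCube a l (Q j) ⊆ gridCube a l (Q i),
      (gridCube a l (Q j)).indicator (fun _ => c j * ν (gridCube a l (Q j))) x) ^ 2 ∂μ ≤
        K₂ * ν (gridCube a l (Q i)))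
    (hφ2 : ∫⁻ x, φ x ^ 2 ∂μ ≠ ∞) (hψ2 : ∫⁻ x, ψ x ^ 2 ∂ν ≠ ∞) :
    (∑ i ∈ I, c i * (∫⁻ x in gridCube a l (Q i), φ x ∂μ) *
      ∫⁻ x in gridCube a l (Q i), ψ x ∂ν) ^ 2 ≤
      1024 * (K₁ + K₂) * (∫⁻ x, φ x ^ 2 ∂μ) * ∫⁻ x, ψ x ^ 2 ∂ν := by
  -- reduce to equal norms
  have hnorm : ∀ {φ ψ : (Fin d → ℝ) → ℝ≥0∞}, Measurable φ → Measurable ψ →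
      ∫⁻ x, φ x ^ 2 ∂μ ≠ ∞ → ∫⁻ x, ψ x ^ 2 ∂ν = ∫⁻ x, φ x ^ 2 ∂μ →
      (∑ i ∈ I, c i * (∫⁻ x in gridCube a l (Q i), φ x ∂μ) *
      ∫⁻ x in gridCube a l (Q i), ψ x ∂ν) ^ 2 ≤
      1024 * (K₁ + K₂) * (∫⁻ x, φ x ^ 2 ∂μ) * ∫⁻ x, ψ x ^ 2 ∂ν := by
    intro φ ψ hφ hψ hφ2 heq
    -- Cubes on which an integral vanishes contribute nothing; on the others the averages have
    -- dyadic levels.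
    set I' := I.filter (fun i => ∫⁻ x in gridCube a l (Q i), φ x ∂μ ≠ 0 ∧
      ∫⁻ x in gridCube a l (Q i), ψ x ∂ν ≠ 0) with hI'
    -- The two halves exchange the roles of `(μ, φ)` and `(ν, ψ)`; each uses one of the two testing
    -- conditions.
    set I₁ := I'.filter (fun i =>
      (∫⁻ x in gridCube a l (Q i), ψ x ∂ν) ^ 2 / ν (gridCube a l (Q i)) ≤
      (∫⁻ x in gridCube a l (Q i), φ x ∂μ) ^ 2 / μ (gridCube a l (Q i))) with hI₁
    set I₂ := I'.filter (fun i => ¬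
      (∫⁻ x in gridCube a l (Q i), ψ x ∂ν) ^ 2 / ν (gridCube a l (Q i)) ≤
      (∫⁻ x in gridCube a l (Q i), φ x ∂μ) ^ 2 / μ (gridCube a l (Q i))) with hI₂
    have hsub₁ : I₁ ⊆ I := (Finset.filter_subset _ _).trans (Finset.filter_subset _ _)
    have hsub₂ : I₂ ⊆ I := (Finset.filter_subset _ _).trans (Finset.filter_subset _ _)
    have hsplit : ∑ i ∈ I, c i * (∫⁻ x in gridCube a l (Q i), φ x ∂μ) *
        ∫⁻ x in gridCube a l (Q i), ψ x ∂ν =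
        ∑ i ∈ I₁, c i * (∫⁻ x in gridCube a l (Q i), φ x ∂μ) *
          ∫⁻ x in gridCube a l (Q i), ψ x ∂ν +
        ∑ i ∈ I₂, c i * (∫⁻ x in gridCube a l (Q i), ψ x ∂ν) *
          ∫⁻ x in gridCube a l (Q i), φ x ∂μ := by
      have h0 : ∑ i ∈ I₂, c i * (∫⁻ x in gridCube a l (Q i), ψ x ∂ν) *
          ∫⁻ x in gridCube a l (Q i), φ x ∂μ =
          ∑ i ∈ I₂, c i * (∫⁻ x in gridCube a l (Q i), φ x ∂μ) *
          ∫⁻ x in gridCube a l (Q i), ψ x ∂ν :=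
        Finset.sum_congr rfl fun i _ => by ring
      rw [h0, hI₁, hI₂, Finset.sum_filter_add_sum_filter_not, hI']
      refine (Finset.sum_filter_of_ne fun i _ hne => ⟨fun h => hne ?_, fun h => hne ?_⟩).symm <;>
        rw [h] <;> simp
    -- All terms are nonnegative, so testing conditions pass to subfamilies.
    have hmono : ∀ {J : Finset ι}, J ⊆ I → ∀ (m : ι → ℝ≥0∞) (i : ι) (x : Fin d → ℝ),
        (∑ j ∈ J with gridCube a l (Q j) ⊆ gridCube a l (Q i),
          (gridCube a l (Q j)).indicator (fun _ => m j) x) ^ 2 ≤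
        (∑ j ∈ I with gridCube a l (Q j) ⊆ gridCube a l (Q i),
          (gridCube a l (Q j)).indicator (fun _ => m j) x) ^ 2 := by
      intro J hJ m i x
      exact pow_le_pow_left' (Finset.sum_le_sum_of_subset (Finset.filter_subset_filter _ hJ)) 2
    have h1 := dyadic_form_sq_le_of_dominated (a := a) hl I₁ Q c hφ hψ
      (fun i hi => hμ0 i (hsub₁ hi)) (fun i hi => hμ i (hsub₁ hi))
      (fun i hi => hν0 i (hsub₁ hi)) (fun i hi => hν i (hsub₁ hi)) (K := K₁)
      (fun i hi => (lintegral_mono (hmono hsub₁ _ i)).trans (htest₁ i (hsub₁ hi)))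
      hφ2 (fun i hi => (Finset.mem_filter.1 (Finset.mem_filter.1 hi).1).2.1)
      (fun i hi => (Finset.mem_filter.1 hi).2)
    have h2 := dyadic_form_sq_le_of_dominated (a := a) hl I₂ Q c hψ hφ
      (fun i hi => hν0 i (hsub₂ hi)) (fun i hi => hν i (hsub₂ hi))
      (fun i hi => hμ0 i (hsub₂ hi)) (fun i hi => hμ i (hsub₂ hi)) (K := K₂)
      (fun i hi => (lintegral_mono (hmono hsub₂ _ i)).trans (htest₂ i (hsub₂ hi)))
      (by rwa [heq]) (fun i hi => (Finset.mem_filter.1 (Finset.mem_filter.1 hi).1).2.2)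
      (fun i hi => (not_le.1 (Finset.mem_filter.1 hi).2).le)
    rw [hsplit]
    refine (add_sq_le_two_mul _ _).trans ?_
    rw [heq] at h1 h2 ⊢
    calc _ ≤ 2 * (256 * K₁ * (∫⁻ x, φ x ^ 2 ∂μ) * (∫⁻ x, φ x ^ 2 ∂μ + ∫⁻ x, φ x ^ 2 ∂μ) +
          256 * K₂ * (∫⁻ x, φ x ^ 2 ∂μ) * (∫⁻ x, φ x ^ 2 ∂μ + ∫⁻ x, φ x ^ 2 ∂μ)) := by gcongr
      _ = _ := by ring
  have hzero : ∀ {m : Measure (Fin d → ℝ)} {f : (Fin d → ℝ) → ℝ≥0∞}, Measurable f →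
      ∫⁻ x, f x ^ 2 ∂m = 0 → ∀ E, ∫⁻ x in E, f x ∂m = 0 := by
    intro m f hf h E
    have := setLIntegral_sq_le (μ := m) hf E
    have h0 : ∫⁻ x in E, f x ^ 2 ∂m = 0 :=
      le_antisymm ((setLIntegral_le_lintegral _ _).trans h.le) zero_le
    rw [h0, zero_mul] at this
    exact pow_eq_zero_iff two_ne_zero |>.1 (le_antisymm this zero_le)
  by_cases hψ0 : ∫⁻ x, ψ x ^ 2 ∂ν = 0
  · simp [hzero hψ hψ0]
  by_cases hφ0 : ∫⁻ x, φ x ^ 2 ∂μ = 0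
  · simp [hzero hφ hφ0]
  -- Multiplying `ψ` by `κ` equalises the norms. Both sides are homogeneous of degree two in `ψ`, so
  -- `κ ^ 2` cancels.
  set κ : ℝ≥0∞ := ((∫⁻ x, φ x ^ 2 ∂μ) / ∫⁻ x, ψ x ^ 2 ∂ν) ^ (1 / 2 : ℝ) with hκ
  have hκ2 : κ ^ 2 = (∫⁻ x, φ x ^ 2 ∂μ) / ∫⁻ x, ψ x ^ 2 ∂ν := by
    rw [hκ, ← ENNReal.rpow_natCast, ← ENNReal.rpow_mul]; norm_num
  have hκ0 : κ ^ 2 ≠ 0 := by rw [hκ2]; exact ENNReal.div_ne_zero.2 ⟨hφ0, hψ2⟩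
  have hκtop : κ ^ 2 ≠ ∞ := by rw [hκ2]; exact ENNReal.div_ne_top hφ2 hψ0
  have h1 : ∫⁻ x, (κ * ψ x) ^ 2 ∂ν = κ ^ 2 * ∫⁻ x, ψ x ^ 2 ∂ν := by
    simp_rw [mul_pow]; exact lintegral_const_mul _ (hψ.pow_const 2)
  have h2 := hnorm hφ (hψ.const_mul κ) hφ2
    (by rw [h1, hκ2, ENNReal.div_mul_cancel hψ0 hψ2])
  rw [h1] at h2
  have h3 : ∀ i ∈ I, c i * (∫⁻ x in gridCube a l (Q i), φ x ∂μ) *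
      ∫⁻ x in gridCube a l (Q i), κ * ψ x ∂ν = κ * (c i * (∫⁻ x in gridCube a l (Q i), φ x ∂μ) *
      ∫⁻ x in gridCube a l (Q i), ψ x ∂ν) := fun i _ => by
    rw [lintegral_const_mul _ hψ]; ring
  rw [Finset.sum_congr rfl h3, ← Finset.mul_sum, mul_pow] at h2
  refine (ENNReal.mul_le_mul_iff_right hκ0 hκtop).1 (h2.trans (le_of_eq ?_))
  ring

end TwoWeightTheorem

/-! ### The dyadic maximal inequality for a general measure -/

section Maximal

variable {d : ℕ} {a : Fin d → ℝ} {l : ℝ}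

/-- The dyadic maximal theorem on `L²(μ)`, for finite collections of cubes. -/
theorem lintegral_finset_maximal_sq_le (hl : 0 < l) (s : Finset (Idx d))
    {μ : Measure (Fin d → ℝ)} {φ : (Fin d → ℝ) → ℝ≥0∞} (hφ : Measurable φ)
    (hμ0 : ∀ q ∈ s, μ (gridCube a l q) ≠ 0) (hμ : ∀ q ∈ s, μ (gridCube a l q) ≠ ∞)
    (hφ2 : ∫⁻ x, φ x ^ 2 ∂μ ≠ ∞) (hφ0 : ∀ q ∈ s, ∫⁻ x in gridCube a l q, φ x ∂μ ≠ 0) :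
    ∫⁻ x, (⨆ q ∈ s, (gridCube a l q).indicator
      (fun _ => (∫⁻ y in gridCube a l q, φ y ∂μ) / μ (gridCube a l q)) x) ^ 2 ∂μ ≤
      16 * ∫⁻ x, φ x ^ 2 ∂μ := by
  classical
  have hlev : ∀ q : Idx d, ∃ n : ℤ, q ∈ s →
      (2 : ℝ≥0∞) ^ n * μ (gridCube a l q) ≤ ∫⁻ x in gridCube a l q, φ x ∂μ ∧
      (∫⁻ x in gridCube a l q, φ x ∂μ) / μ (gridCube a l q) ≤ 2 * 2 ^ n := by
    intro q
    by_cases hq : q ∈ s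
    · obtain ⟨n, hn⟩ := ENNReal.exists_mem_Ico_zpow
        (x := (∫⁻ x in gridCube a l q, φ x ∂μ) / μ (gridCube a l q)) (y := 2)
        (ENNReal.div_ne_zero.2 ⟨hφ0 q hq, hμ q hq⟩)
        (ENNReal.div_ne_top (setLIntegral_ne_top_of_sq hφ hφ2 (hμ q hq)) (hμ0 q hq))
        ENNReal.one_lt_two ENNReal.ofNat_ne_top
      refine ⟨n, fun _ => ⟨?_, ?_⟩⟩
      · exact (ENNReal.le_div_iff_mul_le (Or.inl (hμ0 q hq)) (Or.inl (hμ q hq))).1 hn.1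
      · refine hn.2.le.trans (le_of_eq ?_)
        rw [ENNReal.zpow_add two_ne_zero ENNReal.ofNat_ne_top, zpow_one, mul_comm]
    · exact ⟨0, fun h => absurd h hq⟩
  choose L hL using hlev
  set S := recordCubes a l s L with hS
  -- The finite supremum is attained at one cube, and a record cube around it has at least its
  -- level. A single term of the record sum is thus already large enough.
  have hpt : ∀ x, (⨆ q ∈ s, (gridCube a l q).indicator
      (fun _ => (∫⁻ y in gridCube a l q, φ y ∂μ) / μ (gridCube a l q)) x) ^ 2 ≤
      4 * ∑ q ∈ S, (gridCube a l q).indicator (fun _ => ((2 : ℝ≥0∞) ^ (L q)) ^ 2) x := by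
    intro x
    rcases s.eq_empty_or_nonempty with rfl | hs
    · simp
    rw [← Finset.sup_eq_iSup]
    obtain ⟨q, hq, hqe⟩ := Finset.exists_mem_eq_sup s hs (fun q => (gridCube a l q).indicator
      (fun _ => (∫⁻ y in gridCube a l q, φ y ∂μ) / μ (gridCube a l q)) x)
    rw [hqe]
    by_cases hx : x ∈ gridCube a l q
    · obtain ⟨r, hr, -, hqr, hLr⟩ := exists_recordCube (a := a) (l := l) L hq
      rw [Set.indicator_of_mem hx]
      calc _ ≤ (2 * (2 : ℝ≥0∞) ^ (L r)) ^ 2 := by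
            refine pow_le_pow_left' ((hL q hq).2.trans ?_) 2
            gcongr
            · exact one_le_two
        _ = 4 * (gridCube a l r).indicator (fun _ => ((2 : ℝ≥0∞) ^ (L r)) ^ 2) x := by
            rw [Set.indicator_of_mem (hqr hx), mul_pow]; norm_num
        _ ≤ _ := by
            gcongr
            exact Finset.single_le_sum (f := fun q => (gridCube a l q).indicator
              (fun _ => ((2 : ℝ≥0∞) ^ (L q)) ^ 2) x) (fun _ _ => zero_le) hr
    · rw [Set.indicator_of_notMem hx]; simp
  refine (lintegral_mono hpt).trans ?_
  rw [lintegral_const_mul _ (Finset.measurable_fun_sum _ fun q _ =>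
      measurable_const.indicator (measurableSet_gridCube q)),
    lintegral_finsetSum _ fun q _ => measurable_const.indicator (measurableSet_gridCube q)]
  have h1 := sum_recordCubes_le hl hφ hμ fun q hq => (hL q hq).1
  calc _ = 4 * ∑ q ∈ S, ((2 : ℝ≥0∞) ^ (L q)) ^ 2 * μ (gridCube a l q) := by
        congr 1
        exact Finset.sum_congr rfl fun q _ => lintegral_indicator_const (measurableSet_gridCube q) _
    _ ≤ 4 * (4 * ∫⁻ x, φ x ^ 2 ∂μ) := by gcongr
    _ = _ := by rw [← mul_assoc]; norm_num

end Maximal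

/-! ### Weights -/

section Weights

variable {d : ℕ} {w : (Fin d → ℝ) → ℝ}

theorem ofReal_inv_weight (hw : ∀ x, 0 < w x) (x : Fin d → ℝ) :
    ENNReal.ofReal (w x)⁻¹ = (ENNReal.ofReal (w x))⁻¹ := ENNReal.ofReal_inv_of_pos (hw x)

theorem setLIntegral_weightMeasure (hwm : Measurable w) {f : (Fin d → ℝ) → ℝ≥0∞}
    (hf : Measurable f) {E : Set (Fin d → ℝ)} (hE : MeasurableSet E) :
    ∫⁻ x in E, f x ∂weightMeasure w = ∫⁻ x in E, ENNReal.ofReal (w x) * f x :=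
  setLIntegral_withDensity_eq_setLIntegral_mul _ hwm.ennreal_ofReal hf hE

theorem lintegral_weightMeasure (hwm : Measurable w) {f : (Fin d → ℝ) → ℝ≥0∞}
    (hf : Measurable f) :
    ∫⁻ x, f x ∂weightMeasure w = ∫⁻ x, ENNReal.ofReal (w x) * f x :=
  lintegral_withDensity_eq_lintegral_mul _ hwm.ennreal_ofReal hf

theorem weightMeasure_apply {E : Set (Fin d → ℝ)} (hE : MeasurableSet E) :
    weightMeasure w E = ∫⁻ x in E, ENNReal.ofReal (w x) := withDensity_apply _ hE

theorem weightMeasure_cube_ne_zero (hwm : AEMeasurable w) (hw : ∀ᵐ x, 0 < w x) (a : Fin d → ℝ)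
    {l : ℝ} (hl : 0 < l) : weightMeasure w (cube a l) ≠ 0 := by
  rw [weightMeasure_apply (measurableSet_cube a l), Ne,
    lintegral_eq_zero_iff' hwm.ennreal_ofReal.restrict]
  intro h
  have h1 : ∀ᵐ x ∂(volume.restrict (cube a l)), False := by
    filter_upwards [h, ae_restrict_of_ae hw] with x hx hx'
    simp only [Pi.zero_apply, ENNReal.ofReal_eq_zero] at hx
    linarith
  rw [ae_iff] at h1
  simp only [not_false_eq_true, Set.ofPred_true, Measure.restrict_apply_univ] at h1
  exact volume_cube_ne_zero a hl h1

theorem weightMeasure_cube_ne_top (hw : LocallyIntegrable w volume) (a : Fin d → ℝ) (l : ℝ) :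
    weightMeasure w (cube a l) ≠ ∞ := by
  rw [weightMeasure_apply (measurableSet_cube a l)]
  have hK : IsCompact (Set.Icc a (fun i => a i + l)) := isCompact_Icc
  have h := (hw.integrableOn_isCompact hK).mono_set
    (show cube a l ⊆ _ from fun x hx => ⟨fun i => (hx i).1, fun i => (hx i).2.le⟩)
  exact (h.lintegral_lt_top).ne

theorem a2Const_inv : a2Const (fun x => (w x)⁻¹) = a2Const w := by
  simp only [a2Const, inv_inv]
  exact iSup_congr fun a => iSup_congr fun l => iSup_congr fun _ => by rw [mul_comm]

theorem mul_le_a2Const (w : (Fin d → ℝ) → ℝ) (a : Fin d → ℝ) {l : ℝ} (hl : 0 < l) :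
    weightMeasure w (cube a l) * weightMeasure (fun x => (w x)⁻¹) (cube a l) ≤
      a2Const w * volume (cube a l) ^ 2 := by
  rw [← ENNReal.div_le_iff_le_mul (Or.inl (pow_ne_zero _ (volume_cube_ne_zero a hl)))
    (Or.inl (ENNReal.pow_ne_top (volume_cube_ne_top a l)))]
  exact le_iSup_of_le a (le_iSup_of_le l (le_iSup_of_le hl le_rfl))

/-- Local integrability of `w⁻¹` is not assumed: it is forced by `[w]_{A_2} < ∞`, because `w` has
positive mass on every cube. -/
theorem weightMeasure_inv_cube_ne_top (h : IsA2Weight w) (a : Fin d → ℝ) {l : ℝ} (hl : 0 < l) :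
    weightMeasure (fun x => (w x)⁻¹) (cube a l) ≠ ∞ := by
  intro htop
  have h1 := mul_le_a2Const w a hl
  rw [htop, ENNReal.mul_top (weightMeasure_cube_ne_zero
    h.locallyIntegrable.aestronglyMeasurable.aemeasurable h.pos a hl)] at h1
  exact absurd (ENNReal.mul_lt_top h.a2Const_lt_top
    (ENNReal.pow_lt_top (volume_cube_ne_top a l).lt_top)) (not_lt.2 h1)

theorem isA2Weight_inv (h : IsA2Weight w) : IsA2Weight (fun x => (w x)⁻¹) where
  locallyIntegrable := by
    intro x
    refine ⟨cube (fun i => x i - 1) 2, ?_, ?_⟩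
    · have : Set.pi Set.univ (fun i => Set.Ioo (x i - 1) (x i + 1)) ∈ 𝓝 x :=
        set_pi_mem_nhds Set.finite_univ fun i _ => Ioo_mem_nhds (by linarith) (by linarith)
      refine Filter.mem_of_superset this fun y hy i => ?_
      have := hy i trivial
      exact ⟨this.1.le, by linarith [this.2]⟩
    · have h1 := weightMeasure_inv_cube_ne_top h (fun i => x i - 1) two_pos
      rw [weightMeasure_apply (measurableSet_cube _ _)] at h1
      refine ⟨h.locallyIntegrable.aestronglyMeasurable.aemeasurable.inv.aestronglyMeasurable.restrict,
        ?_⟩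
      rw [hasFiniteIntegral_iff_norm]
      refine lt_of_eq_of_lt (lintegral_congr_ae ?_) h1.lt_top
      filter_upwards [ae_restrict_of_ae h.pos] with y hy
      rw [Real.norm_of_nonneg (inv_nonneg.2 hy.le)]
  pos := by filter_upwards [h.pos] with x hx using inv_pos.2 hx
  a2Const_lt_top := by rw [a2Const_inv]; exact h.a2Const_lt_top

/-- The system generated by `r` agrees with the ambient one from the generation of `r` on. This is
needed because the `A_∞` characteristic uses, for each cube, the system generated by that cube. -/
theorem gridCube_eq_dyadicCube_of_subset {a : Fin d → ℝ} {l : ℝ} {r q : Idx d} (h : r.1 ≤ q.1) :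
    ∃ m, gridCube a l q = dyadicCube (fun i => a i + l * (2 : ℝ) ^ (-r.1) * r.2 i)
      (l * (2 : ℝ) ^ (-r.1)) (q.1 - r.1) m := by
  obtain ⟨n, hn⟩ := Int.le.dest h
  refine ⟨fun i => q.2 i - 2 ^ n * r.2 i, ?_⟩
  have hs : l * (2 : ℝ) ^ (-r.1) * 2 ^ (-(q.1 - r.1)) = l * 2 ^ (-q.1) := by
    rw [mul_assoc, ← zpow_add₀ (by norm_num)]; congr 2; ring
  have hs2 : (2 : ℝ) ^ (-r.1) = 2 ^ (-q.1) * 2 ^ n := by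
    rw [← zpow_natCast, ← zpow_add₀ (by norm_num)]; congr 1; omega
  unfold gridCube dyadicCube
  rw [hs]
  congr 1
  funext i
  push_cast
  rw [hs2]
  ring

theorem lintegral_dyadicMaximal_le (w : (Fin d → ℝ) → ℝ) (a : Fin d → ℝ) {l : ℝ} (hl : 0 < l)
    (hW0 : weightMeasure w (cube a l) ≠ 0) (hW : weightMeasure w (cube a l) ≠ ∞) :
    ∫⁻ x in cube a l, dyadicMaximal a l ((cube a l).indicator w) x ≤
      aInftyConst w * weightMeasure w (cube a l) := by
  rw [← ENNReal.div_le_iff_le_mul (Or.inl hW0) (Or.inl hW)]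
  exact le_iSup_of_le a (le_iSup_of_le l (le_iSup_of_le hl le_rfl))

/-- The `A_∞` characteristic controls the Carleson constant of sparse families. -/
theorem sum_weightMeasure_le {ι : Type*} {a : Fin d → ℝ} {l : ℝ} (hl : 0 < l)
    (hw : ∀ᵐ x, 0 < w x) {r : Idx d}
    (hW0 : weightMeasure w (gridCube a l r) ≠ 0) (hW : weightMeasure w (gridCube a l r) ≠ ∞)
    (J : Finset ι) (Q : ι → Idx d) (E : ι → Set (Fin d → ℝ)) (hE : ∀ i ∈ J, MeasurableSet (E i))
    (hEQ : ∀ i ∈ J, E i ⊆ gridCube a l (Q i)) (hdisj : (J : Set ι).PairwiseDisjoint E) {Λ : ℝ≥0∞}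
    (hΛ : ∀ i ∈ J, volume (gridCube a l (Q i)) ≤ Λ * volume (E i))
    (hQr : ∀ i ∈ J, r.1 ≤ (Q i).1 ∧ gridCube a l (Q i) ⊆ gridCube a l r) :
    ∑ i ∈ J, weightMeasure w (gridCube a l (Q i)) ≤
      Λ * (aInftyConst w * weightMeasure w (gridCube a l r)) := by
  set a' : Fin d → ℝ := fun i => a i + l * (2 : ℝ) ^ (-r.1) * r.2 i with ha'
  set l' : ℝ := l * (2 : ℝ) ^ (-r.1) with hl'
  have hR : gridCube a l r = cube a' l' := rfl
  set M := dyadicMaximal a' l' ((cube a' l').indicator w) with hM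
  -- The average of `w` over `Q i` competes in the maximal function at every point of `E i`, and `|Q
  -- i|` is at most `Λ |E i|`. The sets `E i` are disjoint, so these integrals add up to at most `∫
  -- M` over the top cube.
  have hone : ∀ i ∈ J, weightMeasure w (gridCube a l (Q i)) ≤ Λ * ∫⁻ x in E i, M x := by
    intro i hi
    obtain ⟨m, hm⟩ := gridCube_eq_dyadicCube_of_subset (a := a) (l := l) (hQr i hi).1
    have hv0 := volume_gridCube_ne_zero (a := a) hl (Q i)
    have hv := volume_gridCube_ne_top (a := a) (l := l) (Q i)
    have h1 : ∀ x ∈ E i, weightMeasure w (gridCube a l (Q i)) / volume (gridCube a l (Q i)) ≤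
        M x := by
      intro x hx
      have h2 : weightMeasure w (gridCube a l (Q i)) =
          ∫⁻ y in gridCube a l (Q i), ‖(cube a' l').indicator w y‖ₑ := by
        rw [weightMeasure_apply (measurableSet_gridCube _)]
        refine lintegral_congr_ae ?_
        filter_upwards [ae_restrict_of_ae hw, ae_restrict_mem (measurableSet_gridCube (Q i))]
          with y hy hyQ
        rw [Set.indicator_of_mem (show y ∈ cube a' l' from (hQr i hi).2 hyQ), Real.enorm_eq_ofReal hy.le]
      rw [h2, hm]
      refine le_iSup_of_le ((Q i).1 - r.1) (le_iSup_of_le m (le_iSup_of_le ?_ le_rfl))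
      rw [← hm]
      exact hEQ i hi hx
    calc weightMeasure w (gridCube a l (Q i))
        = weightMeasure w (gridCube a l (Q i)) / volume (gridCube a l (Q i)) *
          volume (gridCube a l (Q i)) := (ENNReal.div_mul_cancel hv0 hv).symm
      _ ≤ weightMeasure w (gridCube a l (Q i)) / volume (gridCube a l (Q i)) *
          (Λ * volume (E i)) := by gcongr; exact hΛ i hi
      _ = Λ * ∫⁻ x in E i, weightMeasure w (gridCube a l (Q i)) / volume (gridCube a l (Q i)) := by
          rw [setLIntegral_const]; ring
      _ ≤ _ := by
          gcongr 1
          exact setLIntegral_mono' (hE i hi) h1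
  refine (Finset.sum_le_sum hone).trans ?_
  rw [← Finset.mul_sum, ← lintegral_biUnion_finset hdisj hE]
  gcongr
  refine le_trans ?_ (lintegral_dyadicMaximal_le w a' (side_pos hl r.1) hW0 hW)
  exact lintegral_mono_set (Set.iUnion₂_subset fun i hi => (hEQ i hi).trans (hQr i hi).2)

end Weights

/-! ### Sparse forms on weighted spaces -/

section SparseForm

variable {d : ℕ} {w : (Fin d → ℝ) → ℝ}

/-- Compare sides in one coordinate. In dimension zero all cubes coincide and the generation is not
determined by the set. -/
theorem generation_le_of_subset {a : Fin d → ℝ} {l : ℝ} (hd : 0 < d) (hl : 0 < l) {p q : Idx d}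
    (h : gridCube a l q ⊆ gridCube a l p) : p.1 ≤ q.1 := by
  have h1 := cube_subset_cube (side_pos hl q.1) h ⟨0, hd⟩
  have h2 : l * (2 : ℝ) ^ (-q.1) ≤ l * (2 : ℝ) ^ (-p.1) := by linarith [h1.1, h1.2]
  have h3 := (zpow_le_zpow_iff_right₀ (one_lt_two (α := ℝ))).1 (le_of_mul_le_mul_left h2 hl)
  omega

-- Expand the square: two cubes containing `x` are nested, and the indicator of the larger is
-- bounded by one. The 2 accounts for the two orders of a pair.
open scoped Classical in
theorem sum_indicator_sq_le {ι : Type*} {a : Fin d → ℝ} {l : ℝ} (hl : 0 < l) (J : Finset ι)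
    (Q : ι → Idx d) (h : ι → ℝ≥0∞) (x : Fin d → ℝ) :
    (∑ j ∈ J, (gridCube a l (Q j)).indicator (fun _ => h j) x) ^ 2 ≤
      2 * ∑ j ∈ J, h j * ∑ k ∈ J with gridCube a l (Q k) ⊆ gridCube a l (Q j),
        (gridCube a l (Q k)).indicator (fun _ => h k) x := by
  set f : ι → ℝ≥0∞ := fun j => (gridCube a l (Q j)).indicator (fun _ => h j) x with hf
  have hfh : ∀ j, f j ≤ h j := fun j => Set.indicator_le_self' (fun _ _ => zero_le) x
  have h1 : ∀ j k, f j * f k ≤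
      (if gridCube a l (Q k) ⊆ gridCube a l (Q j) then h j * f k else 0) +
      (if gridCube a l (Q j) ⊆ gridCube a l (Q k) then h k * f j else 0) := by
    intro j k
    by_cases hj : x ∈ gridCube a l (Q j)
    · by_cases hk : x ∈ gridCube a l (Q k)
      · rcases le_total (Q j).1 (Q k).1 with hjk | hjk
        · rw [if_pos (gridCube_subset_of_mem hl hjk hj hk)]
          exact le_add_right (mul_le_mul' (hfh j) le_rfl)
        · rw [if_pos (gridCube_subset_of_mem hl hjk hk hj)]
          refine le_add_left ?_
          rw [mul_comm]
          exact mul_le_mul' (hfh k) le_rfl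
      · have : f k = 0 := Set.indicator_of_notMem hk _
        rw [this]; simp
    · have : f j = 0 := Set.indicator_of_notMem hj _
      rw [this]; simp
  calc (∑ j ∈ J, f j) ^ 2 = ∑ j ∈ J, ∑ k ∈ J, f j * f k := by rw [sq, Finset.sum_mul_sum]
    _ ≤ ∑ j ∈ J, ∑ k ∈ J, ((if gridCube a l (Q k) ⊆ gridCube a l (Q j) then h j * f k else 0) +
      (if gridCube a l (Q j) ⊆ gridCube a l (Q k) then h k * f j else 0)) :=
        Finset.sum_le_sum fun j _ => Finset.sum_le_sum fun k _ => h1 j k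
    _ = 2 * ∑ j ∈ J, ∑ k ∈ J,
        (if gridCube a l (Q k) ⊆ gridCube a l (Q j) then h j * f k else 0) := by
        simp_rw [Finset.sum_add_distrib]
        rw [two_mul]
        congr 1
        exact Finset.sum_comm
    _ = _ := by simp_rw [Finset.mul_sum, Finset.sum_filter, mul_ite, mul_zero]

/-- The testing estimate for sparse families. -/
theorem sparse_testing (hd : 0 < d) (hA : IsA2Weight w)
    {ι : Type*} {a : Fin d → ℝ} {l : ℝ} (hl : 0 < l) (J : Finset ι)
    (Q : ι → Idx d) (E : ι → Set (Fin d → ℝ)) (hE : ∀ i ∈ J, MeasurableSet (E i))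
    (hEQ : ∀ i ∈ J, E i ⊆ gridCube a l (Q i)) (hdisj : (J : Set ι).PairwiseDisjoint E) {Λ : ℝ≥0∞}
    (hΛ : ∀ i ∈ J, volume (gridCube a l (Q i)) ≤ Λ * volume (E i)) (r : Idx d)
    (hJr : ∀ i ∈ J, gridCube a l (Q i) ⊆ gridCube a l r) :
    ∫⁻ x, (∑ j ∈ J, (gridCube a l (Q j)).indicator (fun _ =>
      (volume (gridCube a l (Q j)))⁻¹ * weightMeasure w (gridCube a l (Q j))) x) ^ 2
        ∂weightMeasure (fun x => (w x)⁻¹) ≤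
      2 * Λ ^ 2 * a2Const w * aInftyConst w * weightMeasure w (gridCube a l r) := by
  classical
  set v : ι → ℝ≥0∞ := fun j => volume (gridCube a l (Q j)) with hv
  have hv0 : ∀ j, v j ≠ 0 := fun j => volume_gridCube_ne_zero hl (Q j)
  have hvt : ∀ j, v j ≠ ∞ := fun j => volume_gridCube_ne_top (Q j)
  set h : ι → ℝ≥0∞ := fun j => (v j)⁻¹ * weightMeasure w (gridCube a l (Q j)) with hh
  have hgen : ∀ {p q : Idx d}, gridCube a l q ⊆ gridCube a l p → p.1 ≤ q.1 :=
    fun hs => generation_le_of_subset hd hl hs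
  -- Packing: the disjoint sets `E k` of the cubes inside `Q j` all lie in `Q j`.
  have hpack : ∀ j ∈ J, ∑ k ∈ J with gridCube a l (Q k) ⊆ gridCube a l (Q j), v k ≤ Λ * v j := by
    intro j _
    calc _ ≤ ∑ k ∈ J with gridCube a l (Q k) ⊆ gridCube a l (Q j), Λ * volume (E k) :=
          Finset.sum_le_sum fun k hk => hΛ k (Finset.mem_filter.1 hk).1
      _ = Λ * volume (⋃ k ∈ J.filter (fun k => gridCube a l (Q k) ⊆ gridCube a l (Q j)), E k) := by
          rw [← Finset.mul_sum, measure_biUnion_finset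
            (hdisj.subset fun k hk => by simpa using (Finset.mem_filter.1 hk).1)
            (fun k hk => hE k (Finset.mem_filter.1 hk).1)]
      _ ≤ Λ * v j := by
          refine mul_le_mul' le_rfl (measure_mono (Set.iUnion₂_subset fun k hk => ?_))
          exact (hEQ k (Finset.mem_filter.1 hk).1).trans (Finset.mem_filter.1 hk).2
  have hm : ∀ (j : ι), Measurable fun x => (gridCube a l (Q j)).indicator (fun _ => h j) x :=
    fun j => measurable_const.indicator (measurableSet_gridCube _)
  calc _ ≤ ∫⁻ x, 2 * ∑ j ∈ J, h j * ∑ k ∈ J with gridCube a l (Q k) ⊆ gridCube a l (Q j),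
        (gridCube a l (Q k)).indicator (fun _ => h k) x ∂weightMeasure (fun x => (w x)⁻¹) :=
        lintegral_mono fun x => sum_indicator_sq_le hl J Q h x
    _ = 2 * ∑ j ∈ J, h j * ∑ k ∈ J with gridCube a l (Q k) ⊆ gridCube a l (Q j),
        h k * weightMeasure (fun x => (w x)⁻¹) (gridCube a l (Q k)) := by
        rw [lintegral_const_mul _ (Finset.measurable_fun_sum _ fun j _ =>
          (Finset.measurable_fun_sum _ fun k _ => hm k).const_mul _),
          lintegral_finsetSum _ fun j _ =>
            (Finset.measurable_fun_sum _ fun k _ => hm k).const_mul (h j)]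
        congr 1
        refine Finset.sum_congr rfl fun j _ => ?_
        rw [lintegral_const_mul _ (Finset.measurable_fun_sum _ fun k _ => hm k),
          lintegral_finsetSum _ fun k _ => hm k]
        congr 1
        exact Finset.sum_congr rfl fun k _ =>
          lintegral_indicator_const (measurableSet_gridCube _) _
    _ ≤ 2 * ∑ j ∈ J, h j * (a2Const w * (Λ * v j)) := by
        gcongr with j hj
        -- Here `h k` times the dual mass of `Q k` is `w(Q k) w⁻¹(Q k) / |Q k|`, at most `[w]_{A_2}
        -- |Q k|`.
        calc _ ≤ ∑ k ∈ J with gridCube a l (Q k) ⊆ gridCube a l (Q j), a2Const w * v k := by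
              refine Finset.sum_le_sum fun k _ => ?_
              rw [hh, mul_assoc]
              calc _ ≤ (v k)⁻¹ * (a2Const w * v k ^ 2) := by
                    exact mul_le_mul' le_rfl (mul_le_a2Const w _ (side_pos hl (Q k).1))
                _ = a2Const w * (v k * ((v k)⁻¹ * v k)) := by ring
                _ = _ := by rw [ENNReal.inv_mul_cancel (hv0 k) (hvt k), mul_one]
          _ ≤ _ := by
              rw [← Finset.mul_sum]
              gcongr
              exact hpack j hj
    _ = 2 * Λ * a2Const w * ∑ j ∈ J, weightMeasure w (gridCube a l (Q j)) := by
        rw [Finset.mul_sum, Finset.mul_sum]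
        refine Finset.sum_congr rfl fun j _ => ?_
        have : h j * v j = weightMeasure w (gridCube a l (Q j)) := by
          rw [hh, mul_comm, ← mul_assoc, ENNReal.mul_inv_cancel (hv0 j) (hvt j), one_mul]
        rw [← this]; ring
    _ ≤ 2 * Λ * a2Const w * (Λ * (aInftyConst w * weightMeasure w (gridCube a l r))) := by
        gcongr
        exact sum_weightMeasure_le hl hA.pos
          (weightMeasure_cube_ne_zero hA.locallyIntegrable.aestronglyMeasurable.aemeasurable
            hA.pos _ (side_pos hl _))
          (weightMeasure_cube_ne_top hA.locallyIntegrable _ _) J Q E hE hEQ hdisj hΛ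
          fun i hi => ⟨hgen (hJr i hi), hJr i hi⟩
    _ = _ := by ring

/-- The mixed `A_2`-`A_∞` bound for sparse forms. -/
theorem sparse_form_sq_le (hd : 0 < d) (hA : IsA2Weight w) (hwm : Measurable w)
    (hw : ∀ x, 0 < w x) {ι : Type*} {a : Fin d → ℝ} {l : ℝ} (hl : 0 < l) (I : Finset ι)
    (Q : ι → Idx d) (E : ι → Set (Fin d → ℝ)) (hE : ∀ i ∈ I, MeasurableSet (E i))
    (hEQ : ∀ i ∈ I, E i ⊆ gridCube a l (Q i)) (hdisj : (I : Set ι).PairwiseDisjoint E) {Λ : ℝ≥0∞}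
    (hΛ : ∀ i ∈ I, volume (gridCube a l (Q i)) ≤ Λ * volume (E i))
    {F G : (Fin d → ℝ) → ℝ≥0∞} (hF : Measurable F) (hG : Measurable G)
    (hF2 : ∫⁻ x, ENNReal.ofReal (w x) * F x ^ 2 ≠ ∞)
    (hG2 : ∫⁻ x, ENNReal.ofReal (w x)⁻¹ * G x ^ 2 ≠ ∞) :
    (∑ i ∈ I, (volume (gridCube a l (Q i)))⁻¹ * (∫⁻ x in gridCube a l (Q i), F x) *
      ∫⁻ x in gridCube a l (Q i), G x) ^ 2 ≤
      2048 * Λ ^ 2 * a2Const w * (aInftyConst w + aInftyConst fun x => (w x)⁻¹) *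
        (∫⁻ x, ENNReal.ofReal (w x) * F x ^ 2) * ∫⁻ x, ENNReal.ofReal (w x)⁻¹ * G x ^ 2 := by
  classical
  set ω : (Fin d → ℝ) → ℝ≥0∞ := fun x => ENNReal.ofReal (w x) with hω
  have hω0 : ∀ x, ω x ≠ 0 := fun x => by simpa [hω] using hw x
  have hωt : ∀ x, ω x ≠ ∞ := fun x => ENNReal.ofReal_ne_top
  have hωm : Measurable ω := hwm.ennreal_ofReal
  have hinv : ∀ x, ENNReal.ofReal (w x)⁻¹ = (ω x)⁻¹ := ofReal_inv_weight hw
  have hA' := isA2Weight_inv hA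
  have hwm' : Measurable fun x => (w x)⁻¹ := hwm.inv
  -- Change of density: `F dx = φ w⁻¹ dx` and `G dx = ψ w dx`, with squared norms preserved, so both
  -- testing conditions are instances of `sparse_testing`, for `w⁻¹` and for `w`.
  set φ : (Fin d → ℝ) → ℝ≥0∞ := fun x => ω x * F x with hφ
  set ψ : (Fin d → ℝ) → ℝ≥0∞ := fun x => (ω x)⁻¹ * G x with hψ
  have hφm : Measurable φ := hωm.mul hF
  have hψm : Measurable ψ := hωm.inv.mul hG
  have hφi : ∀ q, ∫⁻ x in gridCube a l q, φ x ∂weightMeasure (fun x => (w x)⁻¹) =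
      ∫⁻ x in gridCube a l q, F x := fun q => by
    rw [setLIntegral_weightMeasure hwm' hφm (measurableSet_gridCube q)]
    congr 1; ext x
    rw [hinv, hφ, ← mul_assoc, ENNReal.inv_mul_cancel (hω0 x) (hωt x), one_mul]
  have hψi : ∀ q, ∫⁻ x in gridCube a l q, ψ x ∂weightMeasure w =
      ∫⁻ x in gridCube a l q, G x := fun q => by
    rw [setLIntegral_weightMeasure hwm hψm (measurableSet_gridCube q)]
    congr 1; ext x
    rw [hψ, ← mul_assoc, ENNReal.mul_inv_cancel (hω0 x) (hωt x), one_mul]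
  have hφ2 : ∫⁻ x, φ x ^ 2 ∂weightMeasure (fun x => (w x)⁻¹) = ∫⁻ x, ω x * F x ^ 2 := by
    rw [lintegral_weightMeasure hwm' (hφm.pow_const 2)]
    congr 1; ext x
    rw [hinv, hφ]
    calc _ = ((ω x)⁻¹ * ω x) * (ω x * F x ^ 2) := by ring
      _ = _ := by rw [ENNReal.inv_mul_cancel (hω0 x) (hωt x), one_mul]
  have hψ2 : ∫⁻ x, ψ x ^ 2 ∂weightMeasure w = ∫⁻ x, ENNReal.ofReal (w x)⁻¹ * G x ^ 2 := by
    rw [lintegral_weightMeasure hwm (hψm.pow_const 2)]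
    congr 1; ext x
    rw [hinv, hψ]
    calc _ = (ω x * (ω x)⁻¹) * ((ω x)⁻¹ * G x ^ 2) := by ring
      _ = _ := by rw [ENNReal.mul_inv_cancel (hω0 x) (hωt x), one_mul]
  have h0 : ∀ {v : (Fin d → ℝ) → ℝ}, IsA2Weight v → ∀ q : Idx d,
      weightMeasure v (gridCube a l q) ≠ 0 := fun hv q =>
    weightMeasure_cube_ne_zero hv.locallyIntegrable.aestronglyMeasurable.aemeasurable
            hv.pos _ (side_pos hl _)
  have ht : ∀ {v : (Fin d → ℝ) → ℝ}, IsA2Weight v → ∀ q : Idx d,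
      weightMeasure v (gridCube a l q) ≠ ∞ := fun hv q =>
    weightMeasure_cube_ne_top hv.locallyIntegrable _ _
  have hsub : ∀ q : Idx d, (I.filter fun j => gridCube a l (Q j) ⊆ gridCube a l q) ⊆ I :=
    fun q => Finset.filter_subset _ _
  have htest : ∀ {v : (Fin d → ℝ) → ℝ}, IsA2Weight v → ∀ i ∈ I,
      ∫⁻ x, (∑ j ∈ I with gridCube a l (Q j) ⊆ gridCube a l (Q i),
      (gridCube a l (Q j)).indicator (fun _ => (volume (gridCube a l (Q j)))⁻¹ *
        weightMeasure v (gridCube a l (Q j))) x) ^ 2 ∂weightMeasure (fun x => (v x)⁻¹) ≤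
      2 * Λ ^ 2 * a2Const v * aInftyConst v * weightMeasure v (gridCube a l (Q i)) := by
    intro v hv i _
    exact sparse_testing hd hv hl _ Q E (fun j hj => hE j (hsub _ hj))
      (fun j hj => hEQ j (hsub _ hj)) (hdisj.subset fun j hj => hsub _ hj)
      (fun j hj => hΛ j (hsub _ hj)) (Q i) fun j hj => (Finset.mem_filter.1 hj).2
  have h1 := htest hA'
  simp only [inv_inv] at h1
  have key := dyadic_form_sq_le (a := a) hl I Q (fun i => (volume (gridCube a l (Q i)))⁻¹)
    (μ := weightMeasure fun x => (w x)⁻¹) (ν := weightMeasure w) hφm hψm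
    (fun i _ => h0 hA' _) (fun i _ => ht hA' _) (fun i _ => h0 hA _) (fun i _ => ht hA _)
    h1 (htest hA) (by rw [hφ2]; exact hF2) (by rw [hψ2]; exact hG2)
  simp_rw [hφi, hψi] at key
  rw [hφ2, hψ2] at key
  refine key.trans (le_of_eq ?_)
  rw [a2Const_inv]
  ring

end SparseForm

/-! ### Comparison of the `A_∞` and `A_2` characteristics -/

section Characteristics

variable {d : ℕ} {w : (Fin d → ℝ) → ℝ}

theorem weightMeasure_congr {v : (Fin d → ℝ) → ℝ} (h : w =ᵐ[volume] v) :
    weightMeasure w = weightMeasure v :=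
  withDensity_congr_ae (h.mono fun x hx => by simp only [hx])

theorem inv_ae_eq {v : (Fin d → ℝ) → ℝ} (h : w =ᵐ[volume] v) :
    (fun x => (w x)⁻¹) =ᵐ[volume] fun x => (v x)⁻¹ := h.mono fun x hx => by simp only [hx]

theorem a2Const_congr {v : (Fin d → ℝ) → ℝ} (h : w =ᵐ[volume] v) : a2Const w = a2Const v := by
  unfold a2Const
  rw [weightMeasure_congr h, weightMeasure_congr (inv_ae_eq h)]

theorem aInftyConst_congr {v : (Fin d → ℝ) → ℝ} (h : w =ᵐ[volume] v) :
    aInftyConst w = aInftyConst v := by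
  have h1 : ∀ (a : Fin d → ℝ) (l : ℝ), dyadicMaximal a l ((cube a l).indicator w) =
      dyadicMaximal a l ((cube a l).indicator v) := by
    intro a l
    funext x
    have h2 : ∀ E : Set (Fin d → ℝ), ∫⁻ y in E, ‖(cube a l).indicator w y‖ₑ =
        ∫⁻ y in E, ‖(cube a l).indicator v y‖ₑ := fun E => by
      refine lintegral_congr_ae (ae_restrict_of_ae ?_)
      filter_upwards [h] with y hy
      by_cases hyc : y ∈ cube a l <;> simp [hyc, hy]
    simp only [dyadicMaximal, h2]
  unfold aInftyConst
  rw [weightMeasure_congr h]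
  simp_rw [h1]

/-- A change on a null set affects none of the characteristics, and a weight that is measurable and
positive everywhere can be cancelled pointwise. -/
theorem exists_measurable_weight (hA : IsA2Weight w) :
    ∃ v : (Fin d → ℝ) → ℝ, Measurable v ∧ (∀ x, 0 < v x) ∧ w =ᵐ[volume] v ∧ IsA2Weight v := by
  have hm := hA.locallyIntegrable.aestronglyMeasurable.aemeasurable
  set u := hm.mk w with hu
  have hum : Measurable u := hm.measurable_mk
  refine ⟨fun x => if 0 < u x then u x else 1,
    Measurable.ite (measurableSet_lt measurable_const hum) hum measurable_const, fun x => ?_, ?_⟩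
  · by_cases h : 0 < u x <;> simp [h]
  have hwv : w =ᵐ[volume] fun x => if 0 < u x then u x else 1 := by
    filter_upwards [hm.ae_eq_mk, hA.pos] with x hx hp
    rw [← hu] at hx
    rw [← hx, if_pos hp]
  refine ⟨hwv, (locallyIntegrable_congr hwv).1 hA.locallyIntegrable, ?_, ?_⟩
  · filter_upwards [hwv, hA.pos] with x hx hp
    rwa [← hx]
  · rw [← a2Const_congr hwv]; exact hA.a2Const_lt_top

theorem gridCube_zero (a : Fin d → ℝ) (l : ℝ) : gridCube a l (0, 0) = cube a l := by
  simp [gridCube, dyadicCube]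

-- A cube of the system through `x` lies inside the given cube or contains it. In the second case
-- its average of the truncated weight is at most that of the given cube.
open scoped Classical in
theorem dyadicMaximal_le_iSup (hw : ∀ x, 0 < w x) (a : Fin d → ℝ) {l : ℝ} (hl : 0 < l)
    {x : Fin d → ℝ} (hx : x ∈ cube a l) :
    dyadicMaximal a l ((cube a l).indicator w) x ≤ ⨆ q : Idx d, ⨆ _ : gridCube a l q ⊆ cube a l,
      (gridCube a l q).indicator (fun _ => weightMeasure w (gridCube a l q) /
        volume (gridCube a l q)) x := by
  have hval : ∀ q : Idx d, ∫⁻ y in gridCube a l q, ‖(cube a l).indicator w y‖ₑ =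
      weightMeasure w (cube a l ∩ gridCube a l q) := by
    intro q
    rw [weightMeasure_apply ((measurableSet_cube a l).inter (measurableSet_gridCube q)),
      ← Measure.restrict_restrict (measurableSet_cube a l),
      ← lintegral_indicator (measurableSet_cube a l)]
    refine lintegral_congr fun y => ?_
    by_cases hy : y ∈ cube a l
    · simp [hy, Real.enorm_eq_ofReal (hw y).le]
    · simp [hy]
  refine iSup_le fun k => iSup_le fun m => iSup_le fun hxm => ?_
  change (∫⁻ y in gridCube a l (k, m), ‖(cube a l).indicator w y‖ₑ) /
    volume (gridCube a l (k, m)) ≤ _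
  rw [hval]
  have hx0 : x ∈ gridCube a l (0, 0) := by rwa [gridCube_zero]
  rcases le_total 0 k with hk | hk
  · have hsub := gridCube_subset_of_mem hl (p := (0, 0)) (q := (k, m)) hk hx0 hxm
    rw [gridCube_zero] at hsub
    refine le_iSup_of_le (k, m) (le_iSup_of_le hsub ?_)
    rw [Set.indicator_of_mem (show x ∈ gridCube a l (k, m) from hxm), Set.inter_eq_right.2 hsub]
  · have hsub := gridCube_subset_of_mem hl (p := (k, m)) (q := (0, 0)) hk hxm hx0
    refine le_iSup_of_le (0, 0) (le_iSup_of_le (gridCube_zero a l).le ?_)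
    rw [Set.indicator_of_mem hx0]
    refine ENNReal.div_le_div (measure_mono ?_) (measure_mono hsub)
    rw [gridCube_zero]
    exact Set.inter_subset_left

/-- With `σ = w⁻¹ dx`, the `A_2` condition bounds `w(q)/|q|` by `[w]_{A_2} |q|/σ(q)`, and `|q|/σ(q)`
is the `σ`-average of `w` over `q`. So the maximal function is at most `[w]_{A_2}` times the
`σ`-maximal function of `w 1_Q`, to which the `L²(σ)` maximal inequality applies. -/
theorem lintegral_finset_average_le (hA : IsA2Weight w) (hwm : Measurable w) (hw : ∀ x, 0 < w x)
    (a : Fin d → ℝ) {l : ℝ} (hl : 0 < l) (s : Finset (Idx d))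
    (hs : ∀ q ∈ s, gridCube a l q ⊆ cube a l) :
    ∫⁻ x in cube a l, ⨆ q ∈ s, (gridCube a l q).indicator
      (fun _ => weightMeasure w (gridCube a l q) / volume (gridCube a l q)) x ≤
      4 * a2Const w * weightMeasure w (cube a l) := by
  set ω : (Fin d → ℝ) → ℝ≥0∞ := fun x => ENNReal.ofReal (w x) with hω
  have hω0 : ∀ x, ω x ≠ 0 := fun x => by simpa [hω] using hw x
  have hωt : ∀ x, ω x ≠ ∞ := fun x => ENNReal.ofReal_ne_top
  have hωm : Measurable ω := hwm.ennreal_ofReal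
  have hinv : ∀ x, ENNReal.ofReal (w x)⁻¹ = (ω x)⁻¹ := ofReal_inv_weight hw
  have hwm' : Measurable fun x => (w x)⁻¹ := hwm.inv
  have hA' := isA2Weight_inv hA
  set σ := weightMeasure fun x => (w x)⁻¹ with hσ
  set φ : (Fin d → ℝ) → ℝ≥0∞ := (cube a l).indicator ω with hφ
  have hφm : Measurable φ := hωm.indicator (measurableSet_cube a l)
  have hσ0 : ∀ q : Idx d, σ (gridCube a l q) ≠ 0 := fun q =>
    weightMeasure_cube_ne_zero hwm'.aemeasurable hA'.pos _ (side_pos hl _)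
  have hσt : ∀ q : Idx d, σ (gridCube a l q) ≠ ∞ := fun q =>
    weightMeasure_cube_ne_top hA'.locallyIntegrable _ _
  have hφ2 : ∫⁻ x, φ x ^ 2 ∂σ = weightMeasure w (cube a l) := by
    rw [lintegral_weightMeasure hwm' (hφm.pow_const 2), weightMeasure_apply (measurableSet_cube a l),
      ← lintegral_indicator (measurableSet_cube a l)]
    refine lintegral_congr fun x => ?_
    by_cases hx : x ∈ cube a l
    · simp only [hφ, Set.indicator_of_mem hx, hinv]
      rw [sq, ← mul_assoc, ENNReal.inv_mul_cancel (hω0 x) (hωt x), one_mul]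
    · simp [hφ, hx]
  have hφi : ∀ q ∈ s, ∫⁻ x in gridCube a l q, φ x ∂σ = volume (gridCube a l q) := by
    intro q hq
    rw [setLIntegral_weightMeasure hwm' hφm (measurableSet_gridCube q), ← setLIntegral_one]
    refine setLIntegral_congr_fun (measurableSet_gridCube q) fun x hx => ?_
    simp only [hφ, Set.indicator_of_mem (hs q hq hx), hinv]
    exact ENNReal.inv_mul_cancel (hω0 x) (hωt x)
  have hWt := weightMeasure_cube_ne_top hA.locallyIntegrable a l
  have hmax := lintegral_finset_maximal_sq_le (a := a) hl s hφm (fun q _ => hσ0 q)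
    (fun q _ => hσt q) (by rw [hφ2]; exact hWt)
    (fun q hq => by rw [hφi q hq]; exact volume_gridCube_ne_zero hl q)
  set N : (Fin d → ℝ) → ℝ≥0∞ := fun x => ⨆ q ∈ s, (gridCube a l q).indicator
      (fun _ => (∫⁻ y in gridCube a l q, φ y ∂σ) / σ (gridCube a l q)) x with hN
  have hNm : Measurable N := by
    refine Measurable.biSup (s : Set (Idx d)) s.countable_toSet fun q _ => ?_
    exact measurable_const.indicator (measurableSet_gridCube q)
  have hpt : ∀ x, ⨆ q ∈ s, (gridCube a l q).indicator
      (fun _ => weightMeasure w (gridCube a l q) / volume (gridCube a l q)) x ≤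
      a2Const w * N x := by
    intro x
    refine iSup₂_le fun q hq => ?_
    by_cases hx : x ∈ gridCube a l q
    · rw [Set.indicator_of_mem hx]
      have h1 : (∫⁻ y in gridCube a l q, φ y ∂σ) / σ (gridCube a l q) ≤ N x := by
        refine le_iSup₂_of_le q hq ?_
        rw [Set.indicator_of_mem hx]
      refine le_trans ?_ (mul_le_mul' le_rfl h1)
      rw [hφi q hq, ENNReal.div_le_iff (volume_gridCube_ne_zero hl q) (volume_gridCube_ne_top q)]
      have h2 := mul_le_a2Const w (fun i => a i + l * (2 : ℝ) ^ (-q.1) * (q.2 i : ℝ))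
        (side_pos hl q.1)
      change weightMeasure w (gridCube a l q) * σ (gridCube a l q) ≤
        a2Const w * volume (gridCube a l q) ^ 2 at h2
      rw [← ENNReal.mul_le_mul_iff_left (hσ0 q) (hσt q)]
      refine h2.trans (le_of_eq ?_)
      rw [sq]
      calc _ = a2Const w * volume (gridCube a l q) * volume (gridCube a l q) * 1 := by ring
        _ = a2Const w * volume (gridCube a l q) * volume (gridCube a l q) *
          ((σ (gridCube a l q))⁻¹ * σ (gridCube a l q)) := by
            rw [ENNReal.inv_mul_cancel (hσ0 q) (hσt q)]
        _ = _ := by rw [div_eq_mul_inv]; ring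
    · rw [Set.indicator_of_notMem hx]; exact zero_le
  -- On the cube `dx = φ dσ`, so the integral is a pairing of `N` and `φ` in `L²(σ)`. The 4 is the
  -- square root of the maximal constant 16.
  have hNle : ∫⁻ x in cube a l, N x ≤ 4 * weightMeasure w (cube a l) := by
    have h1 : ∫⁻ x in cube a l, N x = ∫⁻ x, N x * φ x ∂σ := by
      rw [lintegral_weightMeasure hwm' (f := fun x => N x * φ x) (hNm.mul hφm),
        ← lintegral_indicator (measurableSet_cube a l)]
      refine lintegral_congr fun x => ?_
      by_cases hx : x ∈ cube a l
      · simp only [hφ, Set.indicator_of_mem hx, hinv]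
        calc N x = N x * 1 := (mul_one _).symm
          _ = N x * ((ω x)⁻¹ * ω x) := by rw [ENNReal.inv_mul_cancel (hω0 x) (hωt x)]
          _ = _ := by ring
      · simp [hφ, hx]
    rw [← ENNReal.pow_le_pow_left_iff two_ne_zero, h1]
    calc _ ≤ (∫⁻ x, N x ^ 2 ∂σ) * ∫⁻ x, φ x ^ 2 ∂σ :=
          lintegral_mul_sq_le hNm.aemeasurable hφm.aemeasurable
      _ ≤ (16 * ∫⁻ x, φ x ^ 2 ∂σ) * ∫⁻ x, φ x ^ 2 ∂σ := by gcongr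
      _ = _ := by rw [hφ2, mul_pow]; norm_num; ring
  calc _ ≤ ∫⁻ x in cube a l, a2Const w * N x := lintegral_mono hpt
    _ = a2Const w * ∫⁻ x in cube a l, N x := lintegral_const_mul _ hNm
    _ ≤ a2Const w * (4 * weightMeasure w (cube a l)) := by gcongr
    _ = _ := by ring

-- Finite families of subcubes form a directed system, so the finite estimate passes to the full
-- supremum by monotone convergence.
open scoped Classical in
theorem aInftyConst_le (hA : IsA2Weight w) : aInftyConst w ≤ 4 * a2Const w := by
  obtain ⟨v, hvm, hv, hwv, hAv⟩ := exists_measurable_weight hA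
  rw [aInftyConst_congr hwv, a2Const_congr hwv]
  refine iSup_le fun a => iSup_le fun l => iSup_le fun hl => ?_
  refine ENNReal.div_le_of_le_mul ?_
  have hpt : ∀ x ∈ cube a l, dyadicMaximal a l ((cube a l).indicator v) x ≤
      ⨆ s : Finset (Idx d), ⨆ q ∈ s.filter (fun q => gridCube a l q ⊆ cube a l),
      (gridCube a l q).indicator (fun _ => weightMeasure v (gridCube a l q) /
        volume (gridCube a l q)) x := by
    intro x hx
    refine (dyadicMaximal_le_iSup hv a hl hx).trans (iSup₂_le fun q hq => ?_)
    exact le_iSup_of_le {q} (le_iSup₂_of_le q (by simp [hq]) le_rfl)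
  refine (setLIntegral_mono' (measurableSet_cube a l) hpt).trans ?_
  rw [lintegral_iSup_directed]
  · exact iSup_le fun s => lintegral_finset_average_le hAv hvm hv a hl _ fun q hq =>
      (Finset.mem_filter.1 hq).2
  · intro s
    refine (Measurable.biSup (s.filter (fun q => gridCube a l q ⊆ cube a l) : Set (Idx d))
      (Finset.countable_toSet _) fun q _ => ?_).aemeasurable
    exact measurable_const.indicator (measurableSet_gridCube q)
  · intro s t
    refine ⟨s ∪ t, fun x => ?_, fun x => ?_⟩ <;>
      refine iSup₂_le fun q hq => le_iSup₂_of_le q ?_ le_rfl <;>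
      simp only [Finset.mem_filter, Finset.mem_union] at hq ⊢ <;> tauto

end Characteristics

/-! ### Step functions -/

section Step

variable {d : ℕ} {𝕜 : Type*} [RCLike 𝕜]

/-- Boundedly supported functions that are constant on the standard dyadic cubes of side `2^{-N}`. -/
def IsStep (N : ℤ) (f : (Fin d → ℝ) → 𝕜) : Prop :=
  (∃ R : ℝ, ∀ x, R < ‖x‖ → f x = 0) ∧ ∀ x y, gridIndex 0 1 N x = gridIndex 0 1 N y → f x = f y

variable {N : ℤ} {f g : (Fin d → ℝ) → 𝕜}

theorem IsStep.add (hf : IsStep N f) (hg : IsStep N g) : IsStep N (f + g) := by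
  obtain ⟨⟨R, hR⟩, h1⟩ := hf
  obtain ⟨⟨R', hR'⟩, h2⟩ := hg
  refine ⟨⟨max R R', fun x hx => ?_⟩, fun x y hxy => by simp [h1 x y hxy, h2 x y hxy]⟩
  simp [hR x ((le_max_left _ _).trans_lt hx), hR' x ((le_max_right _ _).trans_lt hx)]

theorem IsStep.sub (hf : IsStep N f) (hg : IsStep N g) : IsStep N (f - g) := by
  obtain ⟨⟨R, hR⟩, h1⟩ := hf
  obtain ⟨⟨R', hR'⟩, h2⟩ := hg
  refine ⟨⟨max R R', fun x hx => ?_⟩, fun x y hxy => by simp [h1 x y hxy, h2 x y hxy]⟩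
  simp [hR x ((le_max_left _ _).trans_lt hx), hR' x ((le_max_right _ _).trans_lt hx)]

theorem isStep_zero : IsStep N (0 : (Fin d → ℝ) → 𝕜) := ⟨⟨0, fun _ _ => rfl⟩, fun _ _ _ => rfl⟩

theorem IsStep.sum {ι : Type*} (s : Finset ι) {F : ι → (Fin d → ℝ) → 𝕜}
    (h : ∀ i ∈ s, IsStep N (F i)) : IsStep N (∑ i ∈ s, F i) :=
  Finset.sum_induction F (IsStep N) (fun _ _ => IsStep.add) isStep_zero h

theorem IsStep.mono {M : ℤ} (hf : IsStep N f) (h : N ≤ M) : IsStep M f :=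
  ⟨hf.1, fun x y hxy => hf.2 x y (gridIndex_eq_of_le h hxy)⟩

theorem IsStep.indicator (hf : IsStep N f) {E : Set (Fin d → ℝ)}
    (hE : ∀ x y, gridIndex 0 1 N x = gridIndex 0 1 N y → x ∈ E → y ∈ E) :
    IsStep N (E.indicator f) := by
  obtain ⟨⟨R, hR⟩, h1⟩ := hf
  refine ⟨⟨R, fun x hx => ?_⟩, fun x y hxy => ?_⟩
  · by_cases h : x ∈ E <;> simp [h, hR x hx]
  · by_cases h : x ∈ E
    · rw [Set.indicator_of_mem h, Set.indicator_of_mem (hE x y hxy h), h1 x y hxy]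
    · rw [Set.indicator_of_notMem h, Set.indicator_of_notMem fun hy => h (hE y x hxy.symm hy)]

theorem mem_gridCube_congr {q : Idx d} (hq : q.1 ≤ N) (x y : Fin d → ℝ)
    (h : gridIndex 0 1 N x = gridIndex 0 1 N y) (hx : x ∈ gridCube 0 1 q) :
    y ∈ gridCube 0 1 q := by
  rw [mem_gridCube_iff one_pos] at *
  rw [← hx]
  exact (gridIndex_eq_of_le hq h).symm

theorem mem_dilate_congr {q : Idx d} (hq : q.1 ≤ N) (x y : Fin d → ℝ)
    (h : gridIndex 0 1 N x = gridIndex 0 1 N y) (hx : x ∈ dilate 0 1 q) :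
    y ∈ dilate 0 1 q := by
  have h1 := gridCube_subset_dilate_of_mem one_pos hq hx
  rw [h] at h1
  exact h1 (mem_gridCube_gridIndex one_pos N y)

theorem isStep_const_indicator {q : Idx d} (hq : q.1 ≤ N) (c : 𝕜) :
    IsStep N ((gridCube 0 1 q).indicator fun _ => c) := by
  obtain ⟨R, hR⟩ := (isBounded_cube (fun i => (0 : Fin d → ℝ) i + 1 * (2 : ℝ) ^ (-q.1) * (q.2 i : ℝ))
    (1 * (2 : ℝ) ^ (-q.1))).exists_norm_le
  refine ⟨⟨R, fun x hx => Set.indicator_of_notMem (fun h => absurd (hR x h) (not_le.2 hx)) _⟩,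
    fun x y hxy => ?_⟩
  by_cases h : x ∈ gridCube 0 1 q
  · rw [Set.indicator_of_mem h, Set.indicator_of_mem (mem_gridCube_congr hq x y hxy h)]
  · rw [Set.indicator_of_notMem h,
      Set.indicator_of_notMem fun hy => h (mem_gridCube_congr hq y x hxy.symm hy)]

/-- Only finitely many cells of generation `N` meet a ball off which `f` vanishes. -/
theorem IsStep.exists_eq_sum (hf : IsStep N f) : ∃ (s : Finset (Fin d → ℤ)) (c : (Fin d → ℤ) → 𝕜),
    f = ∑ m ∈ s, (gridCube 0 1 (N, m)).indicator fun _ => c m := by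
  classical
  obtain ⟨⟨R, hR⟩, h1⟩ := hf
  have hfin := finite_setOf_gridCube_inter (d := d) (a := 0) one_pos
    (Metric.isBounded_closedBall (x := (0 : Fin d → ℝ)) (r := R)) N N
  have hpt : ∀ m : Fin d → ℤ, ∃ x, x ∈ gridCube 0 1 (N, m) := fun m => gridCube_nonempty one_pos _
  choose p hp using hpt
  refine ⟨hfin.toFinset.image Prod.snd, fun m => f (p m), ?_⟩
  funext x
  rw [Finset.sum_apply]
  have hx := mem_gridCube_gridIndex (a := 0) one_pos N x
  set m := gridIndex 0 1 N x
  have hne : ∀ m' : Fin d → ℤ, m' ≠ m → x ∉ gridCube 0 1 (N, m') := fun m' hm' hx' =>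
    hm' (congrArg Prod.snd (eq_of_mem_gridCube (p := (N, m')) (q := (N, m)) one_pos rfl hx' hx))
  have hval : f x = f (p m) := h1 _ _ ((mem_gridCube_iff one_pos).1 (hp m)).symm
  by_cases hm : m ∈ hfin.toFinset.image Prod.snd
  · rw [Finset.sum_eq_single_of_mem m hm fun m' _ hm' => Set.indicator_of_notMem (hne m' hm') _,
      Set.indicator_of_mem hx, hval]
  · rw [Finset.sum_eq_zero fun m' hm' => Set.indicator_of_notMem (hne m' fun h => hm (h ▸ hm')) _]
    refine hR x (lt_of_not_ge fun hle => hm ?_)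
    refine Finset.mem_image.2 ⟨(N, m), ?_, rfl⟩
    rw [Set.Finite.mem_toFinset]
    exact ⟨le_rfl, le_rfl, x, hx, by simpa using hle⟩

theorem IsStep.measurable (hf : IsStep N f) : Measurable f := by
  obtain ⟨s, c, rfl⟩ := hf.exists_eq_sum
  have h : ∀ m ∈ s, Measurable ((gridCube (0 : Fin d → ℝ) 1 (N, m)).indicator fun _ => c m) :=
    fun m _ => measurable_const.indicator (measurableSet_gridCube _)
  simpa only [← Finset.sum_apply] using Finset.measurable_sum s h

theorem IsStep.memLp (hf : IsStep N f) (p : ℝ≥0∞) : MemLp f p volume := by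
  obtain ⟨s, c, rfl⟩ := hf.exists_eq_sum
  have h : ∀ m ∈ s, MemLp ((gridCube (0 : Fin d → ℝ) 1 (N, m)).indicator fun _ => c m) p volume :=
    fun m _ => memLp_indicator_const p (measurableSet_gridCube _) _
      (Or.inr (volume_gridCube_ne_top _))
  exact memLp_finsetSum' s h

theorem IsStep.integrable (hf : IsStep N f) : Integrable f volume :=
  memLp_one_iff_integrable.1 (hf.memLp 1)

theorem IsStep.lintegral_ne_top (hf : IsStep N f) : ∫⁻ x, ‖f x‖ₑ ≠ ∞ := hf.integrable.2.ne

end Step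

/-! ### Calderón–Zygmund operators on step functions -/

section Operators

variable {d : ℕ} {𝕜 : Type*} [RCLike 𝕜] {α : ℝ}

/-- The properties of a normalised Calderón–Zygmund operator, acting on step functions. -/
structure IsStepCZ (T : ((Fin d → ℝ) → 𝕜) → (Fin d → ℝ) → 𝕜)
    (K : (Fin d → ℝ) → (Fin d → ℝ) → 𝕜) (α : ℝ) : Prop where
  measurable : ∀ f, Measurable (T f)
  add : ∀ (N : ℤ) f g, IsStep N f → IsStep N g → T (f + g) =ᵐ[volume] T f + T g
  bound : ∀ (N : ℤ) f, IsStep N f → ∫⁻ x, ‖T f x‖ₑ ^ 2 ≤ ∫⁻ x, ‖f x‖ₑ ^ 2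
  size : ∃ C, KernelSizeBound K C
  holder : KernelHolderBound K α 1
  rep : ∀ (N : ℤ) f, IsStep N f →
    ∀ᵐ x, ∀ U ∈ 𝓝 x, (∀ y ∈ U, f y = 0) → T f x = ∫ y, K x y * f y

variable {T : ((Fin d → ℝ) → 𝕜) → (Fin d → ℝ) → 𝕜} {K : (Fin d → ℝ) → (Fin d → ℝ) → 𝕜}

theorem IsStepCZ.sub (h : IsStepCZ T K α) {N : ℤ} {f g : (Fin d → ℝ) → 𝕜} (hf : IsStep N f)
    (hg : IsStep N g) : T (f - g) =ᵐ[volume] T f - T g := by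
  have := h.add N (f - g) g (hf.sub hg) hg
  rw [sub_add_cancel] at this
  filter_upwards [this] with x hx
  simp [hx]

theorem IsStepCZ.zero (h : IsStepCZ T K α) : T 0 =ᵐ[volume] 0 := by
  have := h.sub (isStep_zero (N := 0)) (isStep_zero (N := 0))
  simpa using this

theorem IsStepCZ.sum (h : IsStepCZ T K α) {N : ℤ} {ι : Type*} (s : Finset ι)
    {F : ι → (Fin d → ℝ) → 𝕜} (hF : ∀ i ∈ s, IsStep N (F i)) :
    T (∑ i ∈ s, F i) =ᵐ[volume] ∑ i ∈ s, T (F i) := by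
  classical
  induction s using Finset.induction_on with
  | empty => simpa using h.zero
  | insert i s hi ih =>
    rw [Finset.sum_insert hi, Finset.sum_insert hi]
    refine (h.add N _ _ (hF i (Finset.mem_insert_self _ _))
      (IsStep.sum s fun j hj => hF j (Finset.mem_insert_of_mem hj))).trans ?_
    exact (Filter.EventuallyEq.refl _ _).add (ih fun j hj => hF j (Finset.mem_insert_of_mem hj))

/-- Measurability of the kernel is not assumed; continuity in the second variable off the diagonal
supplies it. -/
theorem continuousOn_kernel {C : ℝ≥0} (hα : 0 < α) (hK : KernelHolderBound K α C)
    (x : Fin d → ℝ) : ContinuousOn (K x) {x}ᶜ := by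
  intro y hy
  refine ContinuousAt.continuousWithinAt ?_
  have hr : 0 < ‖y - x‖ := norm_pos_iff.2 (sub_ne_zero.2 hy)
  rw [ContinuousAt, tendsto_iff_norm_sub_tendsto_zero]
  have h1 : ∀ᶠ z in 𝓝 y, ‖K x z - K x y‖ ≤ C / ‖y - x‖ ^ d * (‖y - z‖ / ‖y - x‖) ^ α := by
    filter_upwards [Metric.ball_mem_nhds y (half_pos hr)] with z hz
    have h2 : 2 * ‖y - z‖ < ‖y - x‖ := by
      rw [Metric.mem_ball, dist_comm, dist_eq_norm] at hz; linarith
    rw [norm_sub_rev]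
    exact (le_add_of_nonneg_left (norm_nonneg _)).trans (hK y z x h2)
  refine squeeze_zero' (Filter.Eventually.of_forall fun z => norm_nonneg _) h1 ?_
  have h3 : Filter.Tendsto (fun z => C / ‖y - x‖ ^ d * (‖y - z‖ / ‖y - x‖) ^ α) (𝓝 y)
      (𝓝 (C / ‖y - x‖ ^ d * (‖y - y‖ / ‖y - x‖) ^ α)) := by
    refine Filter.Tendsto.const_mul _ (Filter.Tendsto.rpow_const ?_ (Or.inr hα.le))
    exact (((continuous_const.sub continuous_id).norm).div_const _).tendsto y
  simpa [Real.zero_rpow hα.ne'] using h3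

/-- The kernel is bounded at distance at least `r` from `x`. Only finiteness is extracted from the
size estimate, so its constant does not enter the final bound. -/
theorem IsStepCZ.integrable_kernel_mul (h : IsStepCZ T K α) (hα : 0 < α) {N : ℤ}
    {f : (Fin d → ℝ) → 𝕜} (hf : IsStep N f) {x : Fin d → ℝ} {r : ℝ} (hr : 0 < r)
    (hfx : ∀ y, ‖x - y‖ < r → f y = 0) : Integrable (fun y => K x y * f y) volume := by
  obtain ⟨C, hC⟩ := h.size
  set S : Set (Fin d → ℝ) := {y | r ≤ ‖x - y‖} with hS
  have hSm : MeasurableSet S := (isClosed_le continuous_const (by fun_prop)).measurableSet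
  have hSx : S ⊆ {x}ᶜ := by
    intro y hy hyx
    rw [Set.mem_singleton_iff] at hyx
    rw [hS, hyx] at hy
    simp only [Set.mem_ofPred_eq, sub_self, norm_zero] at hy
    linarith
  have h1 : IntegrableOn (fun y => K x y * f y) S volume := by
    refine Integrable.bdd_mul (c := C / r ^ d) hf.integrable.integrableOn
      (((continuousOn_kernel hα h.holder x).mono hSx).aestronglyMeasurable hSm) ?_
    filter_upwards [ae_restrict_mem hSm] with y hy
    refine (hC x y fun hxy => hSx hy hxy.symm).trans ?_
    have : r ≤ ‖x - y‖ := hy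
    gcongr
  refine h1.integrable_of_forall_notMem_eq_zero fun y hy => ?_
  rw [hfx y (lt_of_not_ge hy), mul_zero]

end Operators

/-! ### Tail and oscillation estimates for the kernel -/

section KernelTails

variable {d : ℕ} {𝕜 : Type*} [RCLike 𝕜] {α : ℝ}

/-- The sum of the geometric series of ratio `2 ^ (-α)`. -/
noncomputable def geomConst (α : ℝ) : ℝ≥0∞ := ∑' k : ℕ, ENNReal.ofReal ((2 : ℝ) ^ (-α)) ^ k

theorem geomConst_ne_top (hα : 0 < α) : geomConst α ≠ ∞ := by
  rw [geomConst, ENNReal.tsum_geometric]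
  refine ENNReal.inv_ne_top.2 (tsub_pos_iff_lt.2 ?_).ne'
  rw [ENNReal.ofReal_lt_one]
  exact Real.rpow_lt_one_of_one_lt_of_neg one_lt_two (by linarith)

theorem two_rpow_neg_pow (α : ℝ) (k : ℕ) : ((2 : ℝ) ^ (-α)) ^ k = ((2 : ℝ) ^ k)⁻¹ ^ α := by
  rw [← Real.rpow_natCast, ← Real.rpow_mul (by norm_num), Real.inv_rpow (by positivity),
    ← Real.rpow_natCast 2 k, ← Real.rpow_mul (by norm_num), ← Real.rpow_neg (by norm_num)]
  congr 1; ring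

/-- Decompose into shells `2^k s ≤ |x - c| < 2^(k+1) s`. On each the integrand is at most `2^(-αk)
(2^k s)^(-d)`, and the enclosing ball has volume `(4 · 2^k s)^d`. -/
theorem lintegral_kernel_tail_le (hα : 0 < α) (c : Fin d → ℝ) {s : ℝ} (hs : 0 < s) :
    ∫⁻ x in {x | s < ‖x - c‖}, ENNReal.ofReal ((s / ‖x - c‖) ^ α / ‖x - c‖ ^ d) ≤
      4 ^ d * geomConst α := by
  have hpt : ∀ x ∈ {x | s < ‖x - c‖}, ENNReal.ofReal ((s / ‖x - c‖) ^ α / ‖x - c‖ ^ d) ≤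
      ∑' k : ℕ, (Metric.ball c (2 ^ (k + 1) * s)).indicator
        (fun _ => ENNReal.ofReal (((2 : ℝ) ^ (-α)) ^ k / (2 ^ k * s) ^ d)) x := by
    intro x hx
    have hx' : s < ‖x - c‖ := hx
    obtain ⟨k, hk1, hk2⟩ := exists_nat_pow_near (x := ‖x - c‖ / s) (y := 2)
      ((one_le_div hs).2 hx'.le) one_lt_two
    rw [le_div_iff₀ hs] at hk1
    rw [div_lt_iff₀ hs] at hk2
    refine le_trans ?_ (ENNReal.le_tsum k)
    rw [Set.indicator_of_mem (by rw [Metric.mem_ball, dist_eq_norm]; exact hk2)]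
    refine ENNReal.ofReal_le_ofReal ?_
    have h0 : 0 < ‖x - c‖ := hs.trans hx'
    rw [two_rpow_neg_pow]
    gcongr
    rw [div_le_iff₀ h0]
    have h2 : (0 : ℝ) < 2 ^ k := by positivity
    calc s = (2 ^ k)⁻¹ * (2 ^ k * s) := by field_simp
      _ ≤ _ := by gcongr
  have hm : ∀ k : ℕ, Measurable ((Metric.ball c (2 ^ (k + 1) * s)).indicator
      (fun _ => ENNReal.ofReal (((2 : ℝ) ^ (-α)) ^ k / (2 ^ k * s) ^ d))) := fun k =>
    measurable_const.indicator Metric.isOpen_ball.measurableSet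
  refine (setLIntegral_mono' (measurableSet_lt measurable_const (by fun_prop)) hpt).trans ?_
  refine (setLIntegral_le_lintegral _ _).trans ?_
  rw [lintegral_tsum fun k => (hm k).aemeasurable, geomConst, ← ENNReal.tsum_mul_left]
  refine ENNReal.tsum_le_tsum fun k => ?_
  rw [lintegral_indicator_const Metric.isOpen_ball.measurableSet, Real.volume_pi_ball _ (by positivity),
    ← ENNReal.ofReal_mul (by positivity)]
  have h4 : (4 : ℝ≥0∞) ^ d * ENNReal.ofReal ((2 : ℝ) ^ (-α)) ^ k =
      ENNReal.ofReal (4 ^ d * ((2 : ℝ) ^ (-α)) ^ k) := by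
    rw [ENNReal.ofReal_mul (by positivity), ENNReal.ofReal_pow (by norm_num),
      ENNReal.ofReal_pow (by positivity)]
    norm_num
  rw [h4, Fintype.card_fin]
  refine ENNReal.ofReal_le_ofReal (le_of_eq ?_)
  have : (2 * (2 ^ (k + 1) * s)) = 4 * (2 ^ k * s) := by ring
  rw [this, mul_pow]
  field_simp
  rw [mul_pow, mul_pow]
  ring

variable {T : ((Fin d → ℝ) → 𝕜) → (Fin d → ℝ) → 𝕜} {K : (Fin d → ℝ) → (Fin d → ℝ) → 𝕜}

/-- The image of a mean-zero step function supported in a cube is integrable far from the cube. -/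
theorem IsStepCZ.lintegral_compl_dilate_le (h : IsStepCZ T K α) (hα : 0 < α) {N : ℤ}
    {b : (Fin d → ℝ) → 𝕜} (hb : IsStep N b) (q : Idx d) (hbq : ∀ x, x ∉ gridCube 0 1 q → b x = 0)
    (hb0 : ∫ x, b x = 0) :
    ∫⁻ x in (dilate 0 1 q)ᶜ, ‖T b x‖ₑ ≤ 4 ^ d * geomConst α * ∫⁻ x, ‖b x‖ₑ := by
  obtain ⟨c, hc⟩ := gridCube_nonempty (a := (0 : Fin d → ℝ)) one_pos q
  set s : ℝ := 1 * 2 ^ (-q.1) with hs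
  have hs0 : 0 < s := side_pos one_pos q.1
  have hfar : ∀ x ∉ dilate 0 1 q, ∀ y ∈ gridCube 0 1 q, 2 * s < ‖x - y‖ := fun x hx y hy => by
    rw [norm_sub_rev]; exact lt_norm_sub_of_notMem_dilate hy hx
  have hpt : ∀ᵐ x, x ∈ (dilate 0 1 q)ᶜ → ‖T b x‖ₑ ≤
      ENNReal.ofReal ((s / ‖x - c‖) ^ α / ‖x - c‖ ^ d) * ∫⁻ x, ‖b x‖ₑ := by
    filter_upwards [h.rep N b hb] with x hx hxq
    have hbx : ∀ y, ‖x - y‖ < s → b y = 0 := fun y hy => hbq y fun hyq => by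
      have := hfar x hxq y hyq; linarith
    rw [hx (Metric.ball x s) (Metric.ball_mem_nhds x hs0) fun y hy => hbx y (by
      rwa [Metric.mem_ball, dist_comm, dist_eq_norm] at hy)]
    have hi := h.integrable_kernel_mul hα hb hs0 hbx
    -- The mean of `b` vanishes, so the kernel may be replaced by its increment from `c`.
    have h1 : ∫ y, K x y * b y = ∫ y, (K x y - K x c) * b y := by
      simp_rw [sub_mul]
      rw [integral_sub hi (hb.integrable.const_mul _), integral_const_mul, hb0, mul_zero, sub_zero]
    rw [h1, ← lintegral_const_mul _ hb.measurable.enorm]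
    refine (enorm_integral_le_lintegral_enorm _).trans (lintegral_mono fun y => ?_)
    rw [enorm_mul]
    by_cases hy : y ∈ gridCube 0 1 q
    · gcongr
      rw [← ofReal_norm]
      refine ENNReal.ofReal_le_ofReal ?_
      have hcy := norm_sub_lt_of_mem_gridCube one_pos hc hy
      have hxc := hfar x hxq c hc
      have h2 := h.holder c y x (by rw [norm_sub_rev c x]; linarith)
      rw [norm_sub_rev (K x y)]
      refine (le_add_of_nonneg_left (norm_nonneg _)).trans (h2.trans ?_)
      rw [norm_sub_rev c x, NNReal.coe_one, one_div, mul_comm, ← div_eq_mul_inv]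
      gcongr
    · simp [hbq y hy]
  calc ∫⁻ x in (dilate 0 1 q)ᶜ, ‖T b x‖ₑ
      ≤ ∫⁻ x in (dilate 0 1 q)ᶜ, ENNReal.ofReal ((s / ‖x - c‖) ^ α / ‖x - c‖ ^ d) *
        ∫⁻ x, ‖b x‖ₑ := setLIntegral_mono_ae' (measurableSet_dilate q).compl hpt
    _ = (∫⁻ x in (dilate 0 1 q)ᶜ, ENNReal.ofReal ((s / ‖x - c‖) ^ α / ‖x - c‖ ^ d)) *
        ∫⁻ x, ‖b x‖ₑ := lintegral_mul_const' _ _ hb.lintegral_ne_top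
    _ ≤ _ := by
      gcongr
      refine (lintegral_mono_set fun x hx => ?_).trans (lintegral_kernel_tail_le hα c hs0)
      have := hfar x hx c hc
      exact (by linarith : s < ‖x - c‖)

/-- The ancestor of generation `k` of the cubes containing `x`. -/
noncomputable def cubeAt (k : ℤ) (x : Fin d → ℝ) : Idx d := (k, gridIndex 0 1 k x)

theorem mem_cubeAt (k : ℤ) (x : Fin d → ℝ) : x ∈ gridCube 0 1 (cubeAt k x) :=
  mem_gridCube_gridIndex one_pos k x

theorem cubeAt_eq {q : Idx d} {x : Fin d → ℝ} (h : x ∈ gridCube 0 1 q) : cubeAt q.1 x = q :=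
  Prod.ext rfl ((mem_gridCube_iff one_pos).1 h)

theorem cubeAt_subset {j k : ℤ} (h : j ≤ k) (x : Fin d → ℝ) :
    gridCube 0 1 (cubeAt k x) ⊆ gridCube 0 1 (cubeAt j x) :=
  gridCube_subset_of_mem one_pos h (mem_cubeAt j x) (mem_cubeAt k x)

/-- Oscillation on a cube of the image of a function living off its dilate. -/
theorem lintegral_kernel_oscillation_le {K : (Fin d → ℝ) → (Fin d → ℝ) → 𝕜}
    (hK : KernelHolderBound K α 1) (hα : 0 < α) {f : (Fin d → ℝ) → 𝕜} (hf : Measurable f)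
    {A : ℝ≥0∞} (k : ℤ) (c : Fin d → ℝ) (n : ℕ)
    (hA : ∀ i : ℕ, i < n → ∫⁻ y in dilate 0 1 (cubeAt (k - (i + 1)) c), ‖f y‖ₑ ≤
      A * volume (gridCube 0 1 (cubeAt (k - (i + 1)) c)))
    {x x' : Fin d → ℝ} (hx : x ∈ gridCube 0 1 (cubeAt k c)) (hx' : x' ∈ gridCube 0 1 (cubeAt k c)) :
    ∫⁻ y in dilate 0 1 (cubeAt (k - n) c) \ dilate 0 1 (cubeAt k c),
      ‖K x y - K x' y‖ₑ * ‖f y‖ₑ ≤ geomConst α * A := by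
  set P : ℕ → Idx d := fun i => cubeAt (k - i) c with hP
  have hP0 : P 0 = cubeAt k c := by simp [hP]
  rw [← hP0] at hx hx' ⊢
  change ∫⁻ y in dilate 0 1 (P n) \ dilate 0 1 (P 0), _ ≤ _
  -- Points of ring `i` are farther from `x` than two sides of `P i`, that is, one side of `P (i +
  -- 1)`. The kernel increment there is at most `2^(-α(i+1)) / |P (i+1)|`, and the volume cancels
  -- against `hA`.
  set ring : ℕ → Set (Fin d → ℝ) := fun i => dilate 0 1 (P (i + 1)) \ dilate 0 1 (P i) with hring
  have hcover : ∀ m : ℕ, dilate 0 1 (P m) \ dilate 0 1 (P 0) ⊆ ⋃ i ∈ Finset.range m, ring i := by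
    intro m
    induction m with
    | zero => simp
    | succ m ih =>
      intro y hy
      by_cases hym : y ∈ dilate 0 1 (P m)
      · obtain ⟨i, hi, hyi⟩ := Set.mem_iUnion₂.1 (ih ⟨hym, hy.2⟩)
        exact Set.mem_biUnion (by simp only [Finset.mem_range] at hi; simp; omega) hyi
      · exact Set.mem_biUnion (by simp) (show y ∈ ring m from ⟨hy.1, hym⟩)
  have hside : ∀ i : ℕ, 1 * (2 : ℝ) ^ (-(P i).1) = 2 ^ i * 2 ^ (-k) := by
    intro i
    rw [one_mul, ← zpow_natCast, ← zpow_add₀ (by norm_num)]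
    simp only [hP, cubeAt]
    congr 1; ring
  set s : ℝ := 2 ^ (-k) with hs
  have hs0 : 0 < s := by positivity
  have hxx : ‖x - x'‖ ≤ s := by
    have := (norm_sub_lt_of_mem_gridCube one_pos hx hx').le
    rwa [hside 0, pow_zero, one_mul] at this
  have hPsub : ∀ i, gridCube 0 1 (P 0) ⊆ gridCube 0 1 (P i) := fun i => by
    simp only [hP]
    exact cubeAt_subset (by simp) c
  have hone : ∀ i ∈ Finset.range n, ∫⁻ y in ring i, ‖K x y - K x' y‖ₑ * ‖f y‖ₑ ≤
      ENNReal.ofReal ((2 : ℝ) ^ (-α)) ^ (i + 1) * A := by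
    intro i hi
    set S : ℝ := 2 ^ (i + 1) * s with hS
    have hS0 : 0 < S := by positivity
    have hker : ∀ y ∈ ring i, ‖K x y - K x' y‖ₑ * ‖f y‖ₑ ≤
        ENNReal.ofReal (((2 : ℝ) ^ (-α)) ^ (i + 1) / S ^ d) * ‖f y‖ₑ := by
      intro y hy
      gcongr
      have hfar := lt_norm_sub_of_notMem_dilate (hPsub i hx) hy.2
      rw [hside i] at hfar
      have hfar' : S < ‖x - y‖ := by rw [hS, pow_succ]; linarith
      have h2 : (1 : ℝ) ≤ 2 ^ i := one_le_pow₀ (by norm_num)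
      have h3 : 2 * ‖x - x'‖ < ‖x - y‖ := by nlinarith
      have h4 := hK x x' y h3
      rw [← ofReal_norm]
      refine ENNReal.ofReal_le_ofReal ((le_add_of_nonneg_right (norm_nonneg _)).trans
        (h4.trans ?_))
      rw [NNReal.coe_one, one_div, mul_comm, ← div_eq_mul_inv, two_rpow_neg_pow]
      gcongr
      rw [div_le_iff₀ (hS0.trans hfar')]
      calc ‖x - x'‖ ≤ s := hxx
        _ = (2 ^ (i + 1))⁻¹ * S := by rw [hS]; field_simp
        _ ≤ _ := by gcongr
    calc _ ≤ ∫⁻ y in ring i, ENNReal.ofReal (((2 : ℝ) ^ (-α)) ^ (i + 1) / S ^ d) * ‖f y‖ₑ :=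
          setLIntegral_mono' ((measurableSet_dilate _).diff (measurableSet_dilate _)) hker
      _ = ENNReal.ofReal (((2 : ℝ) ^ (-α)) ^ (i + 1) / S ^ d) * ∫⁻ y in ring i, ‖f y‖ₑ :=
          lintegral_const_mul _ hf.enorm
      _ ≤ ENNReal.ofReal (((2 : ℝ) ^ (-α)) ^ (i + 1) / S ^ d) *
          (A * volume (gridCube 0 1 (P (i + 1)))) := by
          gcongr
          refine (lintegral_mono_set Set.sdiff_subset).trans ?_
          have := hA i (Finset.mem_range.1 hi)
          simp only [hP]
          push_cast
          exact this
      _ = ENNReal.ofReal (((2 : ℝ) ^ (-α)) ^ (i + 1) / S ^ d) * ENNReal.ofReal (S ^ d) * A := by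
          rw [volume_gridCube, hside (i + 1), ← ENNReal.ofReal_pow hS0.le]; ring
      _ = _ := by
          rw [← ENNReal.ofReal_mul (by positivity), div_mul_cancel₀ _ (by positivity),
            ENNReal.ofReal_pow (by positivity)]
  calc _ ≤ ∫⁻ y in ⋃ i ∈ Finset.range n, ring i, ‖K x y - K x' y‖ₑ * ‖f y‖ₑ :=
        lintegral_mono_set (hcover n)
    _ ≤ ∑ i ∈ Finset.range n, ∫⁻ y in ring i, ‖K x y - K x' y‖ₑ * ‖f y‖ₑ :=
        lintegral_biUnion_finset_le _ _ _
    _ ≤ ∑ i ∈ Finset.range n, ENNReal.ofReal ((2 : ℝ) ^ (-α)) ^ (i + 1) * A :=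
        Finset.sum_le_sum hone
    _ = (∑ i ∈ Finset.range n, ENNReal.ofReal ((2 : ℝ) ^ (-α)) ^ (i + 1)) * A := by
        rw [Finset.sum_mul]
    _ ≤ _ := by
        gcongr
        have h1 := Finset.sum_range_succ' (fun i => ENNReal.ofReal ((2 : ℝ) ^ (-α)) ^ i) n
        calc _ ≤ ∑ i ∈ Finset.range (n + 1), ENNReal.ofReal ((2 : ℝ) ^ (-α)) ^ i := by
              rw [h1]; exact le_self_add
          _ ≤ _ := ENNReal.sum_le_tsum _

end KernelTails

/-! ### The Calderón–Zygmund decomposition and the weak-type estimate -/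

section WeakType

variable {d : ℕ} {𝕜 : Type*} [RCLike 𝕜] {α : ℝ}

theorem volume_cubeAt_sub_one {q : Idx d} (p : Idx d) (h : p.1 = q.1 - 1) :
    volume (gridCube (0 : Fin d → ℝ) 1 p) = 2 ^ d * volume (gridCube (0 : Fin d → ℝ) 1 q) := by
  rw [volume_gridCube, volume_gridCube, h]
  have : (1 : ℝ) * 2 ^ (-(q.1 - 1)) = 2 * (1 * 2 ^ (-q.1)) := by
    rw [neg_sub, sub_eq_add_neg, zpow_add₀ (by norm_num)]; ring
  rw [this, ENNReal.ofReal_mul (by norm_num), mul_pow]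
  norm_num

theorem IsStep.setLIntegral_gridCube {N : ℤ} {f : (Fin d → ℝ) → 𝕜} (hf : IsStep N f)
    {q : Idx d} (hq : q.1 = N) {x : Fin d → ℝ} (hx : x ∈ gridCube 0 1 q) :
    ∫⁻ y in gridCube 0 1 q, ‖f y‖ₑ = ‖f x‖ₑ * volume (gridCube (0 : Fin d → ℝ) 1 q) := by
  rw [← setLIntegral_const]
  refine setLIntegral_congr_fun (measurableSet_gridCube q) fun y hy => ?_
  rw [mem_gridCube_iff one_pos] at hx hy
  rw [hf.2 y x (by rw [← hq, hy, hx])]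

/-- In positive dimension the volumes grow without bound as the generation decreases, so averages
over very large cubes fall below the height and maximal stopping cubes exist. -/
theorem exists_generation_le (hd : 0 < d) {I t : ℝ≥0∞} (hI : I ≠ ∞) (ht : t ≠ 0) :
    ∃ J : ℤ, ∀ q : Idx d, q.1 ≤ J → I ≤ t * volume (gridCube (0 : Fin d → ℝ) 1 q) := by
  obtain ⟨n, hn⟩ := ENNReal.exists_nat_gt (ENNReal.div_ne_top hI ht)
  refine ⟨-n, fun q hq => ?_⟩
  have h1 : (n : ℝ≥0∞) ≤ volume (gridCube (0 : Fin d → ℝ) 1 q) := by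
    rw [volume_gridCube, one_mul]
    have h2 : (n : ℝ) ≤ 2 ^ (-q.1) := by
      calc (n : ℝ) ≤ 2 ^ n := by exact_mod_cast Nat.lt_two_pow_self.le
        _ = (2 : ℝ) ^ (n : ℤ) := (zpow_natCast _ _).symm
        _ ≤ _ := zpow_le_zpow_right₀ (by norm_num) (by omega)
    have h3 : (1 : ℝ) ≤ 2 ^ (-q.1) := one_le_zpow₀ (by norm_num) (by omega)
    calc (n : ℝ≥0∞) = ENNReal.ofReal n := by simp
      _ ≤ ENNReal.ofReal (2 ^ (-q.1)) := ENNReal.ofReal_le_ofReal h2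
      _ ≤ _ := le_self_pow (by rw [← ENNReal.ofReal_one]; exact ENNReal.ofReal_le_ofReal h3) hd.ne'
  by_cases htt : t = ∞
  · rw [htt, ENNReal.top_mul (volume_gridCube_ne_zero one_pos q)]; exact le_top
  rw [mul_comm, ← ENNReal.div_le_iff ht htt]
  exact hn.le.trans h1

/-- The stopping cubes of the Calderón–Zygmund decomposition at height `t`. -/
theorem IsStep.exists_stopping_cubes (hd : 0 < d) {N : ℤ} {f : (Fin d → ℝ) → 𝕜} (hf : IsStep N f)
    {t : ℝ≥0∞} (ht : t ≠ 0) : ∃ S : Finset (Idx d), (∀ q ∈ S, q.1 ≤ N) ∧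
      (S : Set (Idx d)).PairwiseDisjoint (gridCube 0 1) ∧
      (∀ q ∈ S, t * volume (gridCube (0 : Fin d → ℝ) 1 q) ≤ ∫⁻ y in gridCube 0 1 q, ‖f y‖ₑ) ∧
      (∀ q ∈ S, ∫⁻ y in gridCube 0 1 q, ‖f y‖ₑ ≤
        2 ^ d * t * volume (gridCube (0 : Fin d → ℝ) 1 q)) ∧
      (∀ x, x ∉ ⋃ q ∈ S, gridCube 0 1 q → ‖f x‖ₑ ≤ t) ∧
      ∀ q : Idx d, q.1 ≤ N → t * volume (gridCube (0 : Fin d → ℝ) 1 q) <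
        ∫⁻ y in gridCube 0 1 q, ‖f y‖ₑ → ∃ r ∈ S, r.1 ≤ q.1 ∧
          gridCube (0 : Fin d → ℝ) 1 q ⊆ gridCube 0 1 r := by
  classical
  obtain ⟨⟨R, hR⟩, h1⟩ := id hf
  obtain ⟨J, hJ⟩ := exists_generation_le hd hf.lintegral_ne_top ht
  have hJ' : ∀ q : Idx d, q.1 ≤ J → ∫⁻ y in gridCube 0 1 q, ‖f y‖ₑ ≤
      t * volume (gridCube (0 : Fin d → ℝ) 1 q) := fun q hq =>
    (setLIntegral_le_lintegral _ _).trans (hJ q hq)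
  have hfin := finite_setOf_gridCube_inter (d := d) (a := 0) one_pos
    (Metric.isBounded_closedBall (x := (0 : Fin d → ℝ)) (r := R)) J N
  set s := hfin.toFinset.filter fun q => t * volume (gridCube (0 : Fin d → ℝ) 1 q) <
    ∫⁻ y in gridCube 0 1 q, ‖f y‖ₑ with hs
  have hmem : ∀ q, q ∈ s ↔ (J ≤ q.1 ∧ q.1 ≤ N ∧
      (gridCube 0 1 q ∩ Metric.closedBall 0 R).Nonempty) ∧
      t * volume (gridCube (0 : Fin d → ℝ) 1 q) < ∫⁻ y in gridCube 0 1 q, ‖f y‖ₑ := fun q => by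
    simp [hs]
  have hmeet : ∀ q : Idx d, t * volume (gridCube (0 : Fin d → ℝ) 1 q) <
      ∫⁻ y in gridCube 0 1 q, ‖f y‖ₑ → (gridCube 0 1 q ∩ Metric.closedBall 0 R).Nonempty := by
    intro q hq
    by_contra hne
    rw [Set.not_nonempty_iff_eq_empty] at hne
    have : ∫⁻ y in gridCube 0 1 q, ‖f y‖ₑ = 0 := by
      rw [setLIntegral_congr_fun (g := 0) (measurableSet_gridCube q)]
      · simp
      · intro y hy
        have : f y = 0 := hR y (lt_of_not_ge fun hle => by
          have : y ∈ gridCube 0 1 q ∩ Metric.closedBall 0 R := ⟨hy, by simpa using hle⟩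
          rw [hne] at this; exact this)
        simp [this]
    rw [this] at hq
    exact not_lt_zero hq
  have hin : ∀ q : Idx d, q.1 ≤ N → t * volume (gridCube (0 : Fin d → ℝ) 1 q) <
      ∫⁻ y in gridCube 0 1 q, ‖f y‖ₑ → q ∈ s := fun q hqN hq =>
    (hmem q).2 ⟨⟨le_of_not_ge fun hle => absurd hq (not_lt.2 (hJ' q hle)), hqN, hmeet q hq⟩, hq⟩
  refine ⟨maximalCubes 0 1 s, fun q hq => ((hmem q).1 (maximalCubes_subset s hq)).1.2.1,
    pairwiseDisjoint_maximalCubes one_pos s,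
    fun q hq => ((hmem q).1 (maximalCubes_subset s hq)).2.le, fun q hq => ?_, fun x hx => ?_,
    fun q hqN hq => ?_⟩
  · obtain ⟨x, hx⟩ := gridCube_nonempty (a := (0 : Fin d → ℝ)) one_pos q
    have hqx : cubeAt q.1 x = q := cubeAt_eq hx
    -- The parent of a maximal cube was not selected, and its volume is `2 ^ d` times larger.
    set p := cubeAt (q.1 - 1) x with hp
    have hqp : gridCube (0 : Fin d → ℝ) 1 q ⊆ gridCube 0 1 p := by
      have := cubeAt_subset (show q.1 - 1 ≤ q.1 by omega) x
      rwa [hqx] at this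
    have hqs := (hmem q).1 (maximalCubes_subset s hq)
    have hps : p ∉ s := fun hps => by
      simp only [maximalCubes, Finset.mem_filter] at hq
      have : p.1 < q.1 := by simp [hp, cubeAt]
      exact Set.disjoint_left.1 (hq.2 p hps this) (hqp hx) hx
    have hple : ∫⁻ y in gridCube 0 1 p, ‖f y‖ₑ ≤ t * volume (gridCube (0 : Fin d → ℝ) 1 p) := by
      by_contra hlt
      exact hps (hin p (by have := hqs.1.2.1; simp only [hp, cubeAt]; omega) (not_le.1 hlt))
    calc _ ≤ ∫⁻ y in gridCube 0 1 p, ‖f y‖ₑ := lintegral_mono_set hqp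
      _ ≤ _ := hple
      _ = _ := by rw [volume_cubeAt_sub_one (q := q) p rfl]; ring
  · by_contra hlt
    rw [not_le] at hlt
    have hxN := mem_cubeAt N x
    -- At generation `N` the average of `‖f‖` over the cell of `x` is its value at `x`, so no
    -- differentiation theorem is needed.
    have := hin (cubeAt N x) le_rfl (by
      rw [hf.setLIntegral_gridCube rfl hxN]
      exact ENNReal.mul_lt_mul_left (volume_gridCube_ne_zero one_pos _)
        (volume_gridCube_ne_top _) hlt)
    obtain ⟨p, hp, -, hsub⟩ := exists_mem_maximalCubes (a := (0 : Fin d → ℝ)) one_pos this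
    exact hx (Set.mem_biUnion hp (hsub hxN))
  · exact exists_mem_maximalCubes one_pos (hin q hqN hq)

/-- The weak-type constant. -/
noncomputable def weakConst (d : ℕ) (α : ℝ) : ℝ≥0∞ :=
  4 * 2 ^ d + 5 ^ d + 4 * (4 ^ d * geomConst α)

theorem weakConst_ne_top (hα : 0 < α) : weakConst d α ≠ ∞ := by
  have := geomConst_ne_top hα
  unfold weakConst
  finiteness

variable {T : ((Fin d → ℝ) → 𝕜) → (Fin d → ℝ) → 𝕜} {K : (Fin d → ℝ) → (Fin d → ℝ) → 𝕜}

/-- The weak-type `(1, 1)` estimate. -/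
theorem IsStepCZ.weak_type (hd : 0 < d) (hα : 0 < α) (h : IsStepCZ T K α) {N : ℤ}
    {f : (Fin d → ℝ) → 𝕜} (hf : IsStep N f) {t : ℝ≥0∞} (ht0 : t ≠ 0) (ht : t ≠ ∞) :
    t * volume {x | t < ‖T f x‖ₑ} ≤ weakConst d α * ∫⁻ x, ‖f x‖ₑ := by
  classical
  obtain ⟨S, hSN, hSd, hS1, hS2, hS3, -⟩ := hf.exists_stopping_cubes hd ht0
  set D : Idx d → Set (Fin d → ℝ) := gridCube 0 1 with hD
  have hDm : ∀ q, MeasurableSet (D q) := measurableSet_gridCube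
  have hDt : ∀ q, volume (D q) ≠ ∞ := volume_gridCube_ne_top
  set c : Idx d → 𝕜 := fun q => ⨍ y in D q, f y with hc
  have hcle : ∀ q, ‖c q‖ₑ * volume (D q) ≤ ∫⁻ y in D q, ‖f y‖ₑ := by
    intro q
    have h1 := measure_smul_setAverage (μ := volume) f (hDt q)
    have h2 : ‖c q‖ₑ * volume (D q) = ‖∫ y in D q, f y‖ₑ := by
      rw [← h1, enorm_smul, Real.enorm_eq_ofReal measureReal_nonneg, ofReal_measureReal (hDt q),
        mul_comm]
    rw [h2]
    exact enorm_integral_le_lintegral_enorm _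
  -- The mean-zero bad pieces. Since stopping cubes have generation at most `N`, both the pieces and
  -- the good part remain step functions of scale `N`.
  set b : Idx d → (Fin d → ℝ) → 𝕜 := fun q => (D q).indicator f - (D q).indicator fun _ => c q
    with hb
  have hbs : ∀ q ∈ S, IsStep N (b q) := fun q hq =>
    (hf.indicator fun x y hxy => mem_gridCube_congr (hSN q hq) x y hxy).sub
      (isStep_const_indicator (hSN q hq) _)
  set g : (Fin d → ℝ) → 𝕜 := f - ∑ q ∈ S, b q with hg
  have hBs : IsStep N (∑ q ∈ S, b q) := IsStep.sum S hbs
  have hgs : IsStep N g := hf.sub hBs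
  set U : Set (Fin d → ℝ) := ⋃ q ∈ S, D q with hU
  have hUm : MeasurableSet U := Finset.measurableSet_biUnion _ fun q _ => hDm q
  have hg_in : ∀ q ∈ S, ∀ x ∈ D q, g x = c q := by
    intro q hq x hx
    rw [hg, Pi.sub_apply, Finset.sum_apply, Finset.sum_eq_single_of_mem q hq]
    · simp [hb, hx]
    · intro p hp hpq
      have : x ∉ D p := fun hxp => Set.disjoint_left.1 (hSd hp hq hpq) hxp hx
      simp [hb, this]
  have hg_out : ∀ x, x ∉ U → g x = f x := by
    intro x hx
    rw [hg, Pi.sub_apply, Finset.sum_apply, Finset.sum_eq_zero, sub_zero]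
    intro q hq
    have : x ∉ D q := fun hxq => hx (Set.mem_biUnion hq hxq)
    simp [hb, this]
  have hg1 : ∫⁻ x, ‖g x‖ₑ ≤ ∫⁻ x, ‖f x‖ₑ := by
    rw [← lintegral_add_compl _ hUm, ← lintegral_add_compl (fun x => ‖f x‖ₑ) hUm]
    refine add_le_add ?_ (setLIntegral_mono' hUm.compl fun x hx => by rw [hg_out x hx])
    rw [hU, lintegral_biUnion_finset hSd fun q _ => hDm q,
      lintegral_biUnion_finset hSd fun q _ => hDm q]
    refine Finset.sum_le_sum fun q hq => ?_
    rw [setLIntegral_congr_fun (g := fun _ => ‖c q‖ₑ) (hDm q) fun x hx => by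
      simp only [hg_in q hq x hx], setLIntegral_const]
    exact hcle q
  have hginf : ∀ x, ‖g x‖ₑ ≤ 2 ^ d * t := by
    intro x
    by_cases hx : x ∈ U
    · obtain ⟨q, hq, hxq⟩ := Set.mem_iUnion₂.1 hx
      rw [hg_in q hq x hxq, ← ENNReal.mul_le_mul_iff_left (volume_gridCube_ne_zero one_pos q)
        (hDt q)]
      exact (hcle q).trans (hS2 q hq)
    · rw [hg_out x hx]
      exact (hS3 x hx).trans (le_mul_of_one_le_left' (one_le_pow₀ one_le_two))
  set I := ∫⁻ x, ‖f x‖ₑ with hI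
  have hTg : ∫⁻ x, ‖T g x‖ₑ ^ 2 ≤ 2 ^ d * t * I := by
    refine (h.bound N g hgs).trans ?_
    calc ∫⁻ x, ‖g x‖ₑ ^ 2 ≤ ∫⁻ x, 2 ^ d * t * ‖g x‖ₑ := by
          refine lintegral_mono fun x => ?_
          rw [sq]
          exact mul_le_mul' (hginf x) le_rfl
      _ = 2 ^ d * t * ∫⁻ x, ‖g x‖ₑ := lintegral_const_mul _ hgs.measurable.enorm
      _ ≤ _ := by gcongr
  set V : Set (Fin d → ℝ) := ⋃ q ∈ S, dilate 0 1 q with hV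
  have hVm : MeasurableSet V := Finset.measurableSet_biUnion _ fun q _ => measurableSet_dilate q
  have hsumI : ∑ q ∈ S, ∫⁻ y in D q, ‖f y‖ₑ ≤ I := by
    rw [← lintegral_biUnion_finset hSd fun q _ => hDm q]
    exact setLIntegral_le_lintegral _ _
  have hVI : t * volume V ≤ 5 ^ d * I := by
    calc t * volume V ≤ t * ∑ q ∈ S, volume (dilate 0 1 q) := by
          gcongr; exact measure_biUnion_finset_le _ _
      _ = 5 ^ d * ∑ q ∈ S, t * volume (D q) := by
          simp_rw [volume_dilate, Finset.mul_sum]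
          exact Finset.sum_congr rfl fun q _ => by ring
      _ ≤ 5 ^ d * ∑ q ∈ S, ∫⁻ y in D q, ‖f y‖ₑ := by
          gcongr with q hq; exact hS1 q hq
      _ ≤ _ := by gcongr
  have hbI : ∀ q ∈ S, ∫⁻ x, ‖b q x‖ₑ ≤ 2 * ∫⁻ y in D q, ‖f y‖ₑ := by
    intro q _
    calc ∫⁻ x, ‖b q x‖ₑ ≤ ∫⁻ x, ((D q).indicator (fun x => ‖f x‖ₑ) x +
          (D q).indicator (fun _ => ‖c q‖ₑ) x) := by
          refine lintegral_mono fun x => ?_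
          by_cases hx : x ∈ D q
          · simp only [hb, Pi.sub_apply, Set.indicator_of_mem hx]; exact enorm_sub_le
          · simp [hb, hx]
      _ = (∫⁻ y in D q, ‖f y‖ₑ) + ‖c q‖ₑ * volume (D q) := by
          rw [lintegral_add_left (hf.measurable.enorm.indicator (hDm q)),
            lintegral_indicator (hDm q), lintegral_indicator_const (hDm q)]
      _ ≤ _ := by rw [two_mul]; gcongr; exact hcle q
  have hb0 : ∀ q, ∫ x, b q x = 0 := by
    intro q
    have : b q = (D q).indicator fun x => f x - c q := by
      funext x; by_cases hx : x ∈ D q <;> simp [hb, hx]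
    rw [this, integral_indicator (hDm q)]
    have : IsFiniteMeasure (volume.restrict (D q)) := ⟨by
      rw [Measure.restrict_apply_univ]; exact (hDt q).lt_top⟩
    exact integral_sub_average _ f
  have hTb : ∫⁻ x in Vᶜ, ‖∑ q ∈ S, T (b q) x‖ₑ ≤ 4 ^ d * geomConst α * (2 * I) := by
    calc ∫⁻ x in Vᶜ, ‖∑ q ∈ S, T (b q) x‖ₑ ≤ ∫⁻ x in Vᶜ, ∑ q ∈ S, ‖T (b q) x‖ₑ :=
          lintegral_mono fun x => enorm_sum_le _ _
      _ = ∑ q ∈ S, ∫⁻ x in Vᶜ, ‖T (b q) x‖ₑ :=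
          lintegral_finsetSum _ fun q _ => (h.measurable _).enorm
      _ ≤ ∑ q ∈ S, 4 ^ d * geomConst α * (2 * ∫⁻ y in D q, ‖f y‖ₑ) := by
          refine Finset.sum_le_sum fun q hq => ?_
          refine (lintegral_mono_set (Set.compl_subset_compl.2 ?_)).trans
            ((h.lintegral_compl_dilate_le hα (hbs q hq) q ?_ (hb0 q)).trans
              (mul_le_mul' le_rfl (hbI q hq)))
          · exact Set.subset_biUnion_of_mem (u := fun q => dilate 0 1 q) hq
          · intro x hx
            have hx' : x ∉ D q := hx
            simp [hb, hx']
      _ = 4 ^ d * geomConst α * (2 * ∑ q ∈ S, ∫⁻ y in D q, ‖f y‖ₑ) := by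
          simp_rw [Finset.mul_sum]
      _ ≤ _ := by gcongr
  have hdecomp : ∀ᵐ x, T f x = T g x + ∑ q ∈ S, T (b q) x := by
    have h1 := h.add N g (∑ q ∈ S, b q) hgs hBs
    rw [hg, sub_add_cancel, ← hg] at h1
    filter_upwards [h1, h.sum S hbs] with x hx1 hx2
    rw [hx1, Pi.add_apply, hx2, Finset.sum_apply]
  -- Where `|Tf| > t`, off the dilated cubes, the good or the bad part is at least `t / 2`. The sets
  -- are written in the form Chebyshev's inequality takes, squared for the good part.
  have hcover : ({x | t < ‖T f x‖ₑ} : Set (Fin d → ℝ)) ≤ᵐ[volume]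
      ({x | t ^ 2 ≤ 4 * ‖T g x‖ₑ ^ 2} ∪ V ∪
        {x | t ≤ 2 * Vᶜ.indicator (fun x => ‖∑ q ∈ S, T (b q) x‖ₑ) x} : Set (Fin d → ℝ)) := by
    filter_upwards [hdecomp] with x hx hxt
    by_contra hne
    obtain ⟨h12, h3⟩ := not_or.1 hne
    obtain ⟨h1, h2⟩ := not_or.1 h12
    have h1' : 2 * ‖T g x‖ₑ < t := by
      have : ¬ t ^ 2 ≤ 4 * ‖T g x‖ₑ ^ 2 := h1
      rw [not_le] at this
      refine lt_of_not_ge fun hle => absurd this (not_lt.2 ?_)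
      calc t ^ 2 ≤ (2 * ‖T g x‖ₑ) ^ 2 := pow_le_pow_left' hle 2
        _ = _ := by rw [mul_pow]; norm_num
    have h3' : 2 * ‖∑ q ∈ S, T (b q) x‖ₑ < t := by
      have : ¬ t ≤ 2 * Vᶜ.indicator (fun x => ‖∑ q ∈ S, T (b q) x‖ₑ) x := h3
      rwa [not_le, Set.indicator_of_mem (show x ∈ Vᶜ from h2)] at this
    have hxt' : t < ‖T f x‖ₑ := hxt
    have h4 : 2 * t < 2 * t := by
      calc 2 * t < 2 * ‖T f x‖ₑ := by
            exact ENNReal.mul_lt_mul_right two_ne_zero ENNReal.ofNat_ne_top hxt'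
        _ ≤ 2 * (‖T g x‖ₑ + ‖∑ q ∈ S, T (b q) x‖ₑ) := by
            rw [hx]; gcongr; exact enorm_add_le _ _
        _ = 2 * ‖T g x‖ₑ + 2 * ‖∑ q ∈ S, T (b q) x‖ₑ := mul_add _ _ _
        _ < t + t := ENNReal.add_lt_add h1' h3'
        _ = 2 * t := (two_mul t).symm
    exact lt_irrefl _ h4
  have hA : t * volume {x | t ^ 2 ≤ 4 * ‖T g x‖ₑ ^ 2} ≤ 4 * 2 ^ d * I := by
    have h1 := mul_meas_ge_le_lintegral (μ := volume)
      ((((h.measurable g).enorm).pow_const 2).const_mul 4) (t ^ 2)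
    rw [lintegral_const_mul _ ((h.measurable g).enorm.pow_const 2)] at h1
    rw [← ENNReal.mul_le_mul_iff_right ht0 ht]
    calc _ = t ^ 2 * volume {x | t ^ 2 ≤ 4 * ‖T g x‖ₑ ^ 2} := by ring
      _ ≤ 4 * (2 ^ d * t * I) := h1.trans (by gcongr)
      _ = _ := by ring
  have hB : t * volume {x | t ≤ 2 * Vᶜ.indicator (fun x => ‖∑ q ∈ S, T (b q) x‖ₑ) x} ≤
      4 * (4 ^ d * geomConst α) * I := by
    have hm : Measurable fun x => ‖∑ q ∈ S, T (b q) x‖ₑ :=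
      (Finset.measurable_fun_sum S fun q _ => h.measurable _).enorm
    have h1 := mul_meas_ge_le_lintegral (μ := volume) ((hm.indicator hVm.compl).const_mul 2) t
    rw [lintegral_const_mul _ (hm.indicator hVm.compl), lintegral_indicator hVm.compl] at h1
    calc _ ≤ 2 * (4 ^ d * geomConst α * (2 * I)) := h1.trans (by gcongr)
      _ = _ := by ring
  calc t * volume {x | t < ‖T f x‖ₑ}
      ≤ t * volume ({x | t ^ 2 ≤ 4 * ‖T g x‖ₑ ^ 2} ∪ V ∪
        {x | t ≤ 2 * Vᶜ.indicator (fun x => ‖∑ q ∈ S, T (b q) x‖ₑ) x}) := by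
        gcongr 1; exact measure_mono_ae hcover
    _ ≤ t * (volume {x | t ^ 2 ≤ 4 * ‖T g x‖ₑ ^ 2} + volume V +
        volume {x | t ≤ 2 * Vᶜ.indicator (fun x => ‖∑ q ∈ S, T (b q) x‖ₑ) x}) := by
        gcongr
        exact (measure_union_le _ _).trans (add_le_add (measure_union_le _ _) le_rfl)
    _ ≤ 4 * 2 ^ d * I + 5 ^ d * I + 4 * (4 ^ d * geomConst α) * I := by
        rw [mul_add, mul_add]
        exact add_le_add (add_le_add hA hVI) hB
    _ = _ := by rw [weakConst]; ring

end WeakType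

/-! ### One step of the sparse domination -/

section OneStep

variable {d : ℕ} {𝕜 : Type*} [RCLike 𝕜] {α : ℝ}
variable {T : ((Fin d → ℝ) → 𝕜) → (Fin d → ℝ) → 𝕜} {K : (Fin d → ℝ) → (Fin d → ℝ) → 𝕜}

/-- The restriction of a function to a dilated cube. -/
noncomputable def localize (q : Idx d) (f : (Fin d → ℝ) → 𝕜) : (Fin d → ℝ) → 𝕜 :=
  (dilate 0 1 q).indicator f

theorem IsStep.localize {N : ℤ} {f : (Fin d → ℝ) → 𝕜} (hf : IsStep N f) {q : Idx d}
    (hq : q.1 ≤ N) : IsStep N (localize q f) :=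
  hf.indicator fun x y hxy => mem_dilate_congr hq x y hxy

theorem lintegral_localize (q : Idx d) (f : (Fin d → ℝ) → 𝕜) :
    ∫⁻ x, ‖localize q f x‖ₑ = ∫⁻ x in dilate 0 1 q, ‖f x‖ₑ := by
  rw [← lintegral_indicator (measurableSet_dilate q)]
  refine lintegral_congr fun x => ?_
  by_cases hx : x ∈ dilate 0 1 q <;> simp [_root_.localize, hx]

/-- The cost of replacing the localisation to a cube by the localisation to a smaller cube. -/
noncomputable def transferConst (d : ℕ) (α : ℝ) (A : ℝ≥0∞) : ℝ≥0∞ :=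
  A + 2 ^ (d + 2) * weakConst d α * A + geomConst α * A

/-- The difference of the two localisations lives off `5P`, so its image on `P` is given by the
kernel and oscillates little, by `hA` on the cubes between `P` and `Q`. One point of `P` where both
images are bounded then controls it on all of `P`; such a point exists by `hE` for the parent of `P`
and by the weak-type estimate for `f 1_{5P}`. -/
theorem IsStepCZ.ae_le_localize (hd : 0 < d) (hα : 0 < α) (h : IsStepCZ T K α) {N : ℤ}
    {f : (Fin d → ℝ) → 𝕜} (hf : IsStep N f) {Q P : Idx d} (hPN : P.1 ≤ N) (hQP1 : Q.1 < P.1)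
    (hPQ : gridCube (0 : Fin d → ℝ) 1 P ⊆ gridCube 0 1 Q) {a A : ℝ≥0∞} (ha0 : a ≠ 0) (ha : a ≠ ∞)
    (hA0 : A ≠ 0) (hAt : A ≠ ∞)
    (hE : ∀ p : Idx d, p.1 = P.1 - 1 → gridCube (0 : Fin d → ℝ) 1 P ⊆ gridCube 0 1 p →
      2 ^ (d + 1) * volume (gridCube 0 1 p ∩ {x | A * a < ‖T (localize Q f) x‖ₑ}) ≤
        volume (gridCube (0 : Fin d → ℝ) 1 p))
    (hA : ∀ p : Idx d, Q.1 ≤ p.1 → p.1 < P.1 → gridCube (0 : Fin d → ℝ) 1 P ⊆ gridCube 0 1 p →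
      ∫⁻ y in dilate 0 1 p, ‖f y‖ₑ ≤ A * a * volume (gridCube (0 : Fin d → ℝ) 1 p)) :
    ∀ᵐ x, x ∈ gridCube 0 1 P →
      ‖T (localize Q f) x‖ₑ ≤ ‖T (localize P f) x‖ₑ + transferConst d α A * a := by
  set F := localize Q f with hF
  set FP := localize P f with hFP
  have hFs : IsStep N F := hf.localize (hQP1.le.trans hPN)
  have hFPs : IsStep N FP := hf.localize hPN
  have hdil : dilate (0 : Fin d → ℝ) 1 P ⊆ dilate 0 1 Q := dilate_subset_dilate one_pos hQP1.le hPQ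
  set G := F - FP with hG
  have hGs : IsStep N G := hFs.sub hFPs
  have hGval : G = (dilate 0 1 Q \ dilate 0 1 P).indicator f := by
    funext x
    by_cases h1 : x ∈ dilate 0 1 P
    · simp [hG, hF, hFP, localize, h1, hdil h1]
    · by_cases h2 : x ∈ dilate 0 1 Q <;> simp [hG, hF, hFP, localize, h1, h2]
  set s : ℝ := 1 * 2 ^ (-P.1) with hs
  have hs0 : 0 < s := side_pos one_pos P.1
  have hGfar : ∀ x ∈ gridCube 0 1 P, ∀ y, ‖x - y‖ < s → G y = 0 := by
    intro x hx y hy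
    rw [hGval]
    refine Set.indicator_of_notMem (fun hy' => ?_) _
    have := lt_norm_sub_of_notMem_dilate hx hy'.2
    rw [← hs] at this
    linarith
  have hae : ∀ᵐ x, x ∈ gridCube 0 1 P → T G x = T F x - T FP x ∧ T G x = ∫ y, K x y * G y := by
    filter_upwards [h.sub hFs hFPs, h.rep N G hGs] with x h1 h2 hx
    refine ⟨h1, h2 _ (Metric.ball_mem_nhds x hs0) fun y hy => hGfar x hx y ?_⟩
    rwa [Metric.mem_ball, dist_comm, dist_eq_norm] at hy
  -- oscillation
  obtain ⟨c, hc⟩ := gridCube_nonempty (a := (0 : Fin d → ℝ)) one_pos P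
  have hosc : ∀ x ∈ gridCube 0 1 P, ∀ x' ∈ gridCube 0 1 P,
      ‖(∫ y, K x y * G y) - ∫ y, K x' y * G y‖ₑ ≤ geomConst α * (A * a) := by
    intro x hx x' hx'
    rw [← integral_sub (h.integrable_kernel_mul hα hGs hs0 (hGfar x hx))
      (h.integrable_kernel_mul hα hGs hs0 (hGfar x' hx'))]
    refine (enorm_integral_le_lintegral_enorm _).trans ?_
    obtain ⟨n, hn⟩ := Int.le.dest hQP1.le
    have hcP : cubeAt P.1 c = P := cubeAt_eq hc
    have hcQ : cubeAt (P.1 - n) c = Q := by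
      rw [← hn, add_sub_cancel_right]; exact cubeAt_eq (hPQ hc)
    have h1 := lintegral_kernel_oscillation_le (K := K) h.holder hα hf.measurable (A := A * a)
      P.1 c n (fun i hi => hA _ (by simp only [cubeAt]; omega) (by simp only [cubeAt]; omega) (by
        have := cubeAt_subset (show P.1 - (i + 1) ≤ P.1 by omega) c
        rwa [hcP] at this)) (x := x) (x' := x') (by rwa [hcP]) (by rwa [hcP])
    rw [hcP, hcQ] at h1
    refine le_trans (le_of_eq ?_) h1
    rw [← lintegral_indicator ((measurableSet_dilate Q).diff (measurableSet_dilate P))]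
    refine lintegral_congr fun y => ?_
    rw [hGval]
    by_cases hy : y ∈ dilate 0 1 Q \ dilate 0 1 P
    · rw [Set.indicator_of_mem hy, Set.indicator_of_mem hy, ← sub_mul, enorm_mul]
    · rw [Set.indicator_of_notMem hy, Set.indicator_of_notMem hy]; simp
  -- a good point
  set A' := 2 ^ (d + 2) * weakConst d α * A with hA'
  have hW0 : weakConst d α ≠ 0 := by
    unfold weakConst
    have : (5 : ℝ≥0∞) ^ d ≠ 0 := pow_ne_zero _ (by norm_num)
    simp [this]
  have hA'0 : A' * a ≠ 0 := by
    have : (2 : ℝ≥0∞) ^ (d + 2) ≠ 0 := pow_ne_zero _ (by norm_num)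
    simp [hA', hW0, hA0, ha0, this]
  have hA't : A' * a ≠ ∞ := by
    have := weakConst_ne_top (d := d) hα
    rw [hA']; finiteness
  set v := volume (gridCube (0 : Fin d → ℝ) 1 P) with hv
  have hv0 : v ≠ 0 := volume_gridCube_ne_zero one_pos P
  have hvt : v ≠ ∞ := volume_gridCube_ne_top P
  set p := cubeAt (P.1 - 1) c with hp
  have hPp : gridCube (0 : Fin d → ℝ) 1 P ⊆ gridCube 0 1 p := by
    have := cubeAt_subset (show P.1 - 1 ≤ P.1 by omega) c
    rwa [cubeAt_eq hc] at this
  have hvp : volume (gridCube (0 : Fin d → ℝ) 1 p) = 2 ^ d * v := volume_cubeAt_sub_one p rfl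
  -- The bad proportion in the parent is at most `2^(-(d+1))`, and the parent is `2^d` times larger:
  -- at most half of `P` is bad.
  have hbad1 : 4 * volume (gridCube 0 1 P ∩ {x | A * a < ‖T F x‖ₑ}) ≤ 2 * v := by
    have h1 := hE p rfl hPp
    rw [hvp] at h1
    have h2 : (2 : ℝ≥0∞) ^ d ≠ 0 := pow_ne_zero _ (by norm_num)
    have h3 : (2 : ℝ≥0∞) ^ d ≠ ∞ := ENNReal.pow_ne_top (by norm_num)
    rw [← ENNReal.mul_le_mul_iff_right h2 h3]
    calc _ = 2 * (2 ^ (d + 1) * volume (gridCube 0 1 P ∩ {x | A * a < ‖T F x‖ₑ})) := by ring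
      _ ≤ 2 * (2 ^ (d + 1) * volume (gridCube 0 1 p ∩ {x | A * a < ‖T F x‖ₑ})) := by gcongr
      _ ≤ 2 * (2 ^ d * v) := by gcongr
      _ = _ := by ring
  -- The factor `2 ^ (d + 2)` in `A'` pays for the parent's volume and for the quarter.
  have hbad2 : 4 * volume {x | A' * a < ‖T FP x‖ₑ} ≤ v := by
    have h1 := h.weak_type hd hα hFPs hA'0 hA't
    rw [hFP, lintegral_localize] at h1
    have h2 : ∫⁻ y in dilate 0 1 P, ‖f y‖ₑ ≤ A * a * (2 ^ d * v) := by
      rw [← hvp]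
      exact (lintegral_mono_set (dilate_subset_dilate one_pos (by simp [hp, cubeAt]) hPp)).trans
        (hA p (by simp only [hp, cubeAt]; omega) (by simp [hp, cubeAt]) hPp)
    rw [← ENNReal.mul_le_mul_iff_right hA'0 hA't]
    calc _ = 4 * (A' * a * volume {x | A' * a < ‖T FP x‖ₑ}) := by ring
      _ ≤ 4 * (weakConst d α * (A * a * (2 ^ d * v))) :=
          mul_le_mul' le_rfl (h1.trans (mul_le_mul' le_rfl h2))
      _ = _ := by rw [hA']; ring
  have hgood : ∃ x' ∈ gridCube 0 1 P, ‖T F x'‖ₑ ≤ A * a ∧ ‖T FP x'‖ₑ ≤ A' * a ∧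
      T G x' = T F x' - T FP x' ∧ T G x' = ∫ y, K x' y * G y := by
    by_contra hcon
    push Not at hcon
    have hsub : (gridCube 0 1 P : Set (Fin d → ℝ)) ≤ᵐ[volume]
        ((gridCube 0 1 P ∩ {x | A * a < ‖T F x‖ₑ}) ∪ {x | A' * a < ‖T FP x‖ₑ} :
          Set (Fin d → ℝ)) := by
      filter_upwards [hae] with x hx hxP
      by_cases h1 : ‖T F x‖ₑ ≤ A * a
      · by_cases h2 : ‖T FP x‖ₑ ≤ A' * a
        · exact absurd (hx hxP).2 (hcon x hxP h1 h2 (hx hxP).1)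
        · exact Or.inr (not_le.1 h2)
      · exact Or.inl ⟨hxP, not_le.1 h1⟩
    -- Without a good point, sets of total measure at most three quarters of `|P|` would cover `P`.
    have h1 : 4 * v ≤ 3 * v := by
      calc 4 * v ≤ 4 * (volume (gridCube 0 1 P ∩ {x | A * a < ‖T F x‖ₑ}) +
            volume {x | A' * a < ‖T FP x‖ₑ}) := by
            gcongr
            exact (measure_mono_ae hsub).trans (measure_union_le _ _)
        _ ≤ 2 * v + v := by rw [mul_add]; exact add_le_add hbad1 hbad2
        _ = 3 * v := by ring
    rw [ENNReal.mul_le_mul_iff_left hv0 hvt] at h1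
    norm_num at h1
  obtain ⟨x', hx'P, hx'1, hx'2, hx'3, hx'4⟩ := hgood
  filter_upwards [hae] with x hx hxP
  obtain ⟨h1, h2⟩ := hx hxP
  have h3 : T F x = T FP x + (((∫ y, K x y * G y) - ∫ y, K x' y * G y) + (T F x' - T FP x')) := by
    rw [← h2, ← hx'4, hx'3, h1]; ring
  rw [h3]
  refine (enorm_add_le _ _).trans (add_le_add le_rfl ((enorm_add_le _ _).trans ?_))
  calc _ ≤ geomConst α * (A * a) + (A * a + A' * a) :=
        add_le_add (hosc x hxP x' hx'P) (enorm_sub_le.trans (add_le_add hx'1 hx'2))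
    _ = _ := by rw [transferConst, ← hA']; ring

/-- The localised bilinear form on a cube. -/
noncomputable def localForm (T : ((Fin d → ℝ) → 𝕜) → (Fin d → ℝ) → 𝕜)
    (f g : (Fin d → ℝ) → 𝕜) (q : Idx d) : ℝ≥0∞ :=
  ∫⁻ x in gridCube 0 1 q, ‖T (localize q f) x‖ₑ * ‖g x‖ₑ

theorem IsStep.enorm_mul_volume_le {N : ℤ} {f : (Fin d → ℝ) → 𝕜} (hf : IsStep N f) {q : Idx d}
    (hq : q.1 = N) {x : Fin d → ℝ} (hx : x ∈ dilate 0 1 q) :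
    ‖f x‖ₑ * volume (gridCube (0 : Fin d → ℝ) 1 q) ≤ ∫⁻ y in dilate 0 1 q, ‖f y‖ₑ := by
  have h1 := gridCube_subset_dilate_of_mem one_pos hq.le hx
  have h2 := hf.setLIntegral_gridCube (q := cubeAt N x) rfl (mem_cubeAt N x)
  have h3 : volume (gridCube (0 : Fin d → ℝ) 1 (cubeAt N x)) = volume (gridCube (0 : Fin d → ℝ) 1 q) := by
    rw [volume_gridCube, volume_gridCube, hq]; rfl
  rw [← h3, ← h2]
  exact lintegral_mono_set h1

/-- The `L²` estimate at the smallest scale. -/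
theorem IsStepCZ.lintegral_localize_le (h : IsStepCZ T K α) {N : ℤ}
    {f : (Fin d → ℝ) → 𝕜} (hf : IsStep N f) {q : Idx d} (hq : q.1 = N) {b : ℝ≥0∞}
    (hb : ∫⁻ y in dilate 0 1 q, ‖f y‖ₑ ≤ b * volume (gridCube (0 : Fin d → ℝ) 1 q)) :
    ∫⁻ x in gridCube 0 1 q, ‖T (localize q f) x‖ₑ ≤
      5 ^ d * b * volume (gridCube (0 : Fin d → ℝ) 1 q) := by
  set v := volume (gridCube (0 : Fin d → ℝ) 1 q) with hv
  have hv0 : v ≠ 0 := volume_gridCube_ne_zero one_pos q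
  have hvt : v ≠ ∞ := volume_gridCube_ne_top q
  have hpt : ∀ x, ‖localize q f x‖ₑ ^ 2 ≤ (dilate 0 1 q).indicator (fun _ => b ^ 2) x := by
    intro x
    by_cases hx : x ∈ dilate 0 1 q
    · rw [localize, Set.indicator_of_mem hx, Set.indicator_of_mem hx]
      refine pow_le_pow_left' ?_ 2
      rw [← ENNReal.mul_le_mul_iff_left hv0 hvt]
      exact (hf.enorm_mul_volume_le hq hx).trans hb
    · simp [localize, hx]
  rw [← ENNReal.pow_le_pow_left_iff two_ne_zero]
  calc _ ≤ (∫⁻ x in gridCube 0 1 q, ‖T (localize q f) x‖ₑ ^ 2) * v :=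
        setLIntegral_sq_le (h.measurable _).enorm _
    _ ≤ (∫⁻ x, ‖localize q f x‖ₑ ^ 2) * v := by
        refine mul_le_mul' ?_ le_rfl
        exact (setLIntegral_le_lintegral _ _).trans (h.bound N _ (hf.localize hq.le))
    _ ≤ (b ^ 2 * (5 ^ d * v)) * v := by
        gcongr
        refine (lintegral_mono hpt).trans (le_of_eq ?_)
        rw [lintegral_indicator_const (measurableSet_dilate q), volume_dilate]
    -- The extra `5 ^ d` only completes a perfect square.
    _ ≤ (b ^ 2 * (5 ^ d * 5 ^ d * v)) * v := by
        gcongr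
        exact le_mul_of_one_le_left' (one_le_pow₀ (by norm_num))
    _ = _ := by ring

end OneStep

/-! ### Stopping cubes and the recursive estimate -/

section OneStepMain

variable {d : ℕ} {𝕜 : Type*} [RCLike 𝕜] {α : ℝ}
variable {T : ((Fin d → ℝ) → 𝕜) → (Fin d → ℝ) → 𝕜} {K : (Fin d → ℝ) → (Fin d → ℝ) → 𝕜}

/-- The stopping threshold. -/
noncomputable def stopConst (d : ℕ) (α : ℝ) : ℝ≥0∞ := 2 ^ (d + 3) * weakConst d α + 4 * 25 ^ d

theorem stopConst_ne_top (hα : 0 < α) : stopConst d α ≠ ∞ := by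
  have := weakConst_ne_top (d := d) hα
  unfold stopConst; finiteness

theorem one_le_stopConst : 1 ≤ stopConst d α := by
  refine le_add_left ?_
  calc (1 : ℝ≥0∞) ≤ 25 ^ d := one_le_pow₀ (by norm_num)
    _ ≤ _ := le_mul_of_one_le_left' (by norm_num)

/-- The constant of the sparse domination. -/
noncomputable def stepConst (d : ℕ) (α : ℝ) : ℝ≥0∞ :=
  transferConst d α (stopConst d α) + 5 ^ d * (2 ^ d * stopConst d α)

theorem stepConst_ne_top (hα : 0 < α) : stepConst d α ≠ ∞ := by
  have h1 := weakConst_ne_top (d := d) hα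
  have h2 := stopConst_ne_top (d := d) hα
  have h3 := geomConst_ne_top hα
  unfold stepConst transferConst; finiteness

/-- The degenerate case, in which the stopping threshold would be zero and the weak-type estimate
unavailable. -/
theorem IsStepCZ.localForm_eq_zero (h : IsStepCZ T K α) {N : ℤ} {f : (Fin d → ℝ) → 𝕜}
    (hf : IsStep N f) {Q : Idx d} (hQ : Q.1 ≤ N) (h0 : ∫⁻ y in dilate 0 1 Q, ‖f y‖ₑ = 0)
    (g : (Fin d → ℝ) → 𝕜) : localForm T f g Q = 0 := by
  have hF := hf.localize hQ
  have h1 : ∫⁻ x, ‖localize Q f x‖ₑ ^ 2 = 0 := by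
    rw [← lintegral_localize, lintegral_eq_zero_iff hF.measurable.enorm] at h0
    rw [lintegral_eq_zero_iff (hF.measurable.enorm.pow_const 2)]
    filter_upwards [h0] with x hx
    simp only [Pi.zero_apply] at hx ⊢
    rw [hx]; simp
  have h2 : ∫⁻ x, ‖T (localize Q f) x‖ₑ ^ 2 = 0 := le_antisymm ((h.bound N _ hF).trans h1.le) zero_le
  rw [lintegral_eq_zero_iff ((h.measurable _).enorm.pow_const 2)] at h2
  rw [localForm]
  refine lintegral_eq_zero_of_ae_eq_zero (ae_restrict_of_ae ?_)
  filter_upwards [h2] with x hx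
  simp only [Pi.zero_apply, pow_eq_zero_iff two_ne_zero] at hx
  simp [hx]

/-- The total measure of a disjoint family of stopping cubes. -/
theorem IsStepCZ.sum_volume_stopping_le (hd : 0 < d) (hα : 0 < α) (h : IsStepCZ T K α) {N : ℤ}
    {f : (Fin d → ℝ) → 𝕜} (hf : IsStep N f) {Q : Idx d} (hQN : Q.1 ≤ N) {a : ℝ≥0∞} (ha0 : a ≠ 0)
    (ha : a ≠ ∞) (haQ : ∫⁻ y in dilate 0 1 Q, ‖f y‖ₑ = a * volume (gridCube (0 : Fin d → ℝ) 1 Q))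
    (S : Finset (Idx d)) (hS : ∀ p ∈ S, Q.1 < p.1 ∧ p.1 ≤ N ∧
      gridCube (0 : Fin d → ℝ) 1 p ⊆ gridCube 0 1 Q)
    (hSd : (S : Set (Idx d)).PairwiseDisjoint (gridCube 0 1))
    (hlarge : ∀ p ∈ S, volume (gridCube (0 : Fin d → ℝ) 1 p) ≤ 2 ^ (d + 1) *
      volume (gridCube 0 1 p ∩ {x | stopConst d α * a < ‖T (localize Q f) x‖ₑ}) ∨
      stopConst d α * a * volume (gridCube (0 : Fin d → ℝ) 1 p) < ∫⁻ y in dilate 0 1 p, ‖f y‖ₑ) :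
    2 * ∑ p ∈ S, volume (gridCube (0 : Fin d → ℝ) 1 p) ≤ volume (gridCube (0 : Fin d → ℝ) 1 Q) := by
  classical
  set A := stopConst d α with hA
  have hA0 : A ≠ 0 := (zero_lt_one.trans_le one_le_stopConst).ne'
  have hAt : A ≠ ∞ := stopConst_ne_top hα
  have hAa0 : A * a ≠ 0 := mul_ne_zero hA0 ha0
  have hAat : A * a ≠ ∞ := ENNReal.mul_ne_top hAt ha
  set D : Idx d → Set (Fin d → ℝ) := gridCube 0 1 with hD
  have hDm : ∀ q, MeasurableSet (D q) := measurableSet_gridCube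
  set E : Set (Fin d → ℝ) := {x | A * a < ‖T (localize Q f) x‖ₑ} with hE
  have hEm : MeasurableSet E := measurableSet_lt measurable_const (h.measurable _).enorm
  have hFs : IsStep N (localize Q f) := hf.localize hQN
  set S₁ := S.filter fun p => volume (D p) ≤ 2 ^ (d + 1) * volume (D p ∩ E) with hS₁
  set S₂ := S.filter fun p => ¬ volume (D p) ≤ 2 ^ (d + 1) * volume (D p ∩ E) with hS₂
  -- Cubes with a large exceptional proportion: the weak-type bound for the exceptional set, with
  -- the first summand of `stopConst`, leaves them a quarter of `|Q|`.
  have h1 : A * a * (4 * ∑ p ∈ S₁, volume (D p)) ≤ A * a * volume (D Q) := by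
    have hW := h.weak_type hd hα hFs hAa0 hAat
    rw [lintegral_localize, haQ] at hW
    calc A * a * (4 * ∑ p ∈ S₁, volume (D p))
        ≤ A * a * (4 * ∑ p ∈ S₁, 2 ^ (d + 1) * volume (D p ∩ E)) := by
          gcongr with p hp
          exact (Finset.mem_filter.1 hp).2
      _ = 2 ^ (d + 3) * (A * a * ∑ p ∈ S₁, volume (D p ∩ E)) := by
          rw [← Finset.mul_sum]; ring
      _ ≤ 2 ^ (d + 3) * (A * a * volume E) := by
          gcongr
          rw [← measure_biUnion_finset]
          · exact measure_mono (Set.iUnion₂_subset fun p _ => Set.inter_subset_right)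
          · intro p hp q hq hpq
            exact (hSd (Finset.mem_filter.1 hp).1 (Finset.mem_filter.1 hq).1 hpq).mono
              Set.inter_subset_left Set.inter_subset_left
          · exact fun p _ => (hDm p).inter hEm
      _ ≤ 2 ^ (d + 3) * (weakConst d α * (a * volume (D Q))) := by gcongr
      _ = (2 ^ (d + 3) * weakConst d α) * a * volume (D Q) := by ring
      _ ≤ _ := by gcongr; exact le_self_add
  -- Cubes with a large average: they lie in the dilates of the Calderón–Zygmund cubes of `f 1_{5Q}`
  -- at height `A a / 5^d`. One factor `5^d` comes from this height and one from dilating, which is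
  -- the `25^d` in `stopConst`.
  have h2 : A * a * (4 * ∑ p ∈ S₂, volume (D p)) ≤ A * a * volume (D Q) := by
    set t : ℝ≥0∞ := A * a / 5 ^ d with ht
    have h5 : (5 : ℝ≥0∞) ^ d ≠ 0 := pow_ne_zero _ (by norm_num)
    have h5t : (5 : ℝ≥0∞) ^ d ≠ ∞ := ENNReal.pow_ne_top (by norm_num)
    have ht5 : 5 ^ d * t = A * a := ENNReal.mul_div_cancel h5 h5t
    have ht0 : t ≠ 0 := ENNReal.div_ne_zero.2 ⟨hAa0, h5t⟩
    obtain ⟨R, hRN, hRd, hR1, -, -, hR2⟩ := hFs.exists_stopping_cubes hd ht0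
    have hcov : ∀ p ∈ S₂, ∃ r ∈ R, D p ⊆ dilate 0 1 r := by
      intro p hp
      obtain ⟨hpS, hp1⟩ := Finset.mem_filter.1 hp
      have hp2 := (hlarge p hpS).resolve_left hp1
      obtain ⟨hQp, hpN, hpQ⟩ := hS p hpS
      have hdil := dilate_subset_dilate one_pos hQp.le hpQ
      have hvol : ∀ e : Fin d → ℤ, volume (D (p.1, p.2 + e)) = volume (D p) := fun e => by
        simp only [hD, volume_gridCube]
      -- Pigeonhole among the `5 ^ d` cubes that make up the dilate.
      obtain ⟨e, he, hlt⟩ : ∃ e ∈ offsets d, t * volume (D (p.1, p.2 + e)) <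
          ∫⁻ y in D (p.1, p.2 + e), ‖f y‖ₑ := by
        by_contra hcon
        push Not at hcon
        refine absurd hp2 (not_lt.2 ?_)
        rw [dilate_eq_biUnion one_pos]
        refine (lintegral_biUnion_finset_le _ _ _).trans ((Finset.sum_le_sum hcon).trans ?_)
        simp_rw [hvol]
        rw [Finset.sum_const, card_offsets, nsmul_eq_mul, ← mul_assoc]
        push_cast
        rw [ht5]
      have hsub : D (p.1, p.2 + e) ⊆ dilate 0 1 Q :=
        (gridCube_add_subset_dilate one_pos he).trans hdil
      have heq : ∫⁻ y in D (p.1, p.2 + e), ‖f y‖ₑ =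
          ∫⁻ y in D (p.1, p.2 + e), ‖localize Q f y‖ₑ :=
        setLIntegral_congr_fun (hDm _) fun y hy => by
          rw [localize, Set.indicator_of_mem (hsub hy)]
      rw [heq] at hlt
      obtain ⟨r, hr, hr1, hr2⟩ := hR2 (p.1, p.2 + e) hpN hlt
      exact ⟨r, hr, gridCube_subset_dilate_of_neighbor one_pos he hr1 hr2⟩
    calc A * a * (4 * ∑ p ∈ S₂, volume (D p))
        = A * a * (4 * volume (⋃ p ∈ S₂, D p)) := by
          rw [measure_biUnion_finset (hSd.subset fun p hp => (Finset.mem_filter.1 hp).1)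
            fun p _ => hDm p]
      _ ≤ A * a * (4 * volume (⋃ r ∈ R, dilate (0 : Fin d → ℝ) 1 r)) := by
          refine mul_le_mul' le_rfl (mul_le_mul' le_rfl
            (measure_mono (Set.iUnion₂_subset fun p hp => ?_)))
          obtain ⟨r, hr, hsub⟩ := hcov p hp
          exact hsub.trans (Set.subset_biUnion_of_mem (u := fun r => dilate (0 : Fin d → ℝ) 1 r) hr)
      _ ≤ A * a * (4 * ∑ r ∈ R, volume (dilate (0 : Fin d → ℝ) 1 r)) := by
          gcongr; exact measure_biUnion_finset_le _ _
      _ = 4 * 25 ^ d * ∑ r ∈ R, t * volume (D r) := by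
          rw [← ht5, ← Finset.mul_sum]
          simp_rw [volume_dilate]
          rw [← Finset.mul_sum, show (25 : ℝ≥0∞) = 5 * 5 by norm_num, mul_pow]
          ring
      _ ≤ 4 * 25 ^ d * ∑ r ∈ R, ∫⁻ y in D r, ‖localize Q f y‖ₑ := by
          gcongr with r hr; exact hR1 r hr
      _ ≤ 4 * 25 ^ d * (a * volume (D Q)) := by
          gcongr
          rw [← lintegral_biUnion_finset hRd fun q _ => hDm q, ← haQ, ← lintegral_localize]
          exact setLIntegral_le_lintegral _ _
      _ = (4 * 25 ^ d) * a * volume (D Q) := by ring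
      _ ≤ _ := by gcongr; exact le_add_self
  rw [ENNReal.mul_le_mul_iff_right hAa0 hAat] at h1 h2
  have hsum : ∑ p ∈ S, volume (D p) = ∑ p ∈ S₁, volume (D p) + ∑ p ∈ S₂, volume (D p) :=
    (Finset.sum_filter_add_sum_filter_not S _ _).symm
  rw [hsum, ← ENNReal.mul_le_mul_iff_right (two_ne_zero) (ENNReal.ofNat_ne_top (n := 2))]
  calc _ = 4 * ∑ p ∈ S₁, volume (D p) + 4 * ∑ p ∈ S₂, volume (D p) := by ring
    _ ≤ volume (D Q) + volume (D Q) := add_le_add h1 h2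
    _ = _ := (two_mul _).symm

/-- One step of the sparse domination. -/
theorem IsStepCZ.exists_localForm_le (hd : 0 < d) (hα : 0 < α) (h : IsStepCZ T K α) {N : ℤ}
    {f g : (Fin d → ℝ) → 𝕜} (hf : IsStep N f) (hg : IsStep N g) {Q : Idx d} (hQN : Q.1 ≤ N) :
    ∃ S : Finset (Idx d), (∀ p ∈ S, Q.1 < p.1 ∧ p.1 ≤ N ∧
      gridCube (0 : Fin d → ℝ) 1 p ⊆ gridCube 0 1 Q) ∧
      (S : Set (Idx d)).PairwiseDisjoint (gridCube 0 1) ∧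
      2 * ∑ p ∈ S, volume (gridCube (0 : Fin d → ℝ) 1 p) ≤
        volume (gridCube (0 : Fin d → ℝ) 1 Q) ∧
      localForm T f g Q ≤ stepConst d α * ((∫⁻ y in dilate 0 1 Q, ‖f y‖ₑ) /
        volume (gridCube (0 : Fin d → ℝ) 1 Q)) * (∫⁻ y in gridCube 0 1 Q, ‖g y‖ₑ) +
        ∑ p ∈ S, localForm T f g p := by
  classical
  by_cases h0 : ∫⁻ y in dilate 0 1 Q, ‖f y‖ₑ = 0
  · exact ⟨∅, by simp, by simp, by simp, by rw [h.localForm_eq_zero hf hQN h0]; exact zero_le⟩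
  set D : Idx d → Set (Fin d → ℝ) := gridCube 0 1 with hD
  have hDm : ∀ q, MeasurableSet (D q) := measurableSet_gridCube
  have hv0 : ∀ q, volume (D q) ≠ 0 := volume_gridCube_ne_zero one_pos
  have hvt : ∀ q, volume (D q) ≠ ∞ := volume_gridCube_ne_top
  set a : ℝ≥0∞ := (∫⁻ y in dilate 0 1 Q, ‖f y‖ₑ) / volume (D Q) with ha
  have haQ : ∫⁻ y in dilate 0 1 Q, ‖f y‖ₑ = a * volume (D Q) :=
    (ENNReal.div_mul_cancel (hv0 Q) (hvt Q)).symm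
  have ha0 : a ≠ 0 := ENNReal.div_ne_zero.2 ⟨h0, hvt Q⟩
  have hat : a ≠ ∞ := ENNReal.div_ne_top
    ((setLIntegral_le_lintegral _ _).trans_lt hf.lintegral_ne_top.lt_top).ne (hv0 Q)
  set A := stopConst d α with hA
  have hA1 : 1 ≤ A := one_le_stopConst
  have hA0 : A ≠ 0 := (zero_lt_one.trans_le hA1).ne'
  have hAt : A ≠ ∞ := stopConst_ne_top hα
  set E : Set (Fin d → ℝ) := {x | A * a < ‖T (localize Q f) x‖ₑ} with hE
  have hFs : IsStep N (localize Q f) := hf.localize hQN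
  -- The stopping rule: its failure on the intermediate cubes is exactly what
  -- `IsStepCZ.ae_le_localize` asks for.
  set stopped : Idx d → Prop := fun p => volume (D p) ≤ 2 ^ (d + 1) * volume (D p ∩ E) ∨
    A * a * volume (D p) < ∫⁻ y in dilate 0 1 p, ‖f y‖ₑ with hstopped
  have hfin := finite_setOf_gridCube_inter (d := d) (a := 0) one_pos
    (S := D Q) (isBounded_cube _ _) (Q.1 + 1) N
  set s := hfin.toFinset.filter fun p => D p ⊆ D Q ∧ stopped p with hs
  have hmem : ∀ p, p ∈ s ↔ (Q.1 < p.1 ∧ p.1 ≤ N ∧ D p ⊆ D Q) ∧ stopped p := by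
    intro p
    simp only [hs, Finset.mem_filter, Set.Finite.mem_toFinset, Set.mem_ofPred_eq]
    constructor
    · rintro ⟨⟨h1, h2, -⟩, h3, h4⟩; exact ⟨⟨by omega, h2, h3⟩, h4⟩
    · rintro ⟨⟨h1, h2, h3⟩, h4⟩
      obtain ⟨x, hx⟩ := gridCube_nonempty (a := (0 : Fin d → ℝ)) one_pos p
      exact ⟨⟨by omega, h2, x, hx, h3 hx⟩, h3, h4⟩
  set S := maximalCubes 0 1 s with hS
  have hSs : ∀ p ∈ S, p ∈ s := fun p hp => maximalCubes_subset s hp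
  have hSQ : ∀ p ∈ S, Q.1 < p.1 ∧ p.1 ≤ N ∧ D p ⊆ D Q := fun p hp => ((hmem p).1 (hSs p hp)).1
  have hSd : (S : Set (Idx d)).PairwiseDisjoint D := pairwiseDisjoint_maximalCubes one_pos s
  refine ⟨S, hSQ, hSd, h.sum_volume_stopping_le hd hα hf hQN ha0 hat haQ S hSQ hSd
    fun p hp => ((hmem p).1 (hSs p hp)).2, ?_⟩
  -- the cube `Q` itself is not stopped
  have hQeq : ∀ p : Idx d, p.1 = Q.1 → ∀ P, D P ⊆ D Q → D P ⊆ D p → p = Q := by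
    intro p hp P hPQ hPp
    obtain ⟨x, hx⟩ := gridCube_nonempty (a := (0 : Fin d → ℝ)) one_pos P
    exact eq_of_mem_gridCube one_pos hp (hPp hx) (hPQ hx)
  have hQE : 2 ^ (d + 1) * volume (D Q ∩ E) ≤ volume (D Q) := by
    have hW := h.weak_type hd hα hFs (mul_ne_zero hA0 ha0) (ENNReal.mul_ne_top hAt hat)
    rw [lintegral_localize, haQ] at hW
    rw [← ENNReal.mul_le_mul_iff_right (mul_ne_zero hA0 ha0) (ENNReal.mul_ne_top hAt hat)]
    calc _ = 2 ^ (d + 1) * (A * a * volume (D Q ∩ E)) := by ring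
      _ ≤ 2 ^ (d + 1) * (A * a * volume E) := by gcongr; exact Set.inter_subset_right
      _ ≤ 2 ^ (d + 1) * (weakConst d α * (a * volume (D Q))) := by gcongr
      _ = (2 ^ (d + 1) * weakConst d α) * a * volume (D Q) := by ring
      _ ≤ A * a * volume (D Q) := by
          gcongr
          rw [hA, stopConst]
          refine le_add_right ?_
          gcongr
          · exact one_le_two
          · omega
  have hQA : ∫⁻ y in dilate 0 1 Q, ‖f y‖ₑ ≤ A * a * volume (D Q) := by
    rw [haQ]; gcongr; exact le_mul_of_one_le_left' hA1
  -- transfer to a cube with unstopped ancestors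
  have htransfer : ∀ P : Idx d, P.1 ≤ N → D P ⊆ D Q → Q.1 ≤ P.1 →
      (∀ p : Idx d, Q.1 < p.1 → p.1 < P.1 → D P ⊆ D p → ¬ stopped p) →
      (∀ᵐ x, x ∈ D P → ‖T (localize Q f) x‖ₑ ≤
        ‖T (localize P f) x‖ₑ + transferConst d α A * a) ∧
      ∫⁻ y in dilate 0 1 P, ‖f y‖ₑ ≤ 2 ^ d * A * a * volume (D P) := by
    intro P hPN hPQ hQP hanc
    rcases hQP.eq_or_lt with heq | hlt
    · obtain rfl : P = Q := hQeq P heq.symm P hPQ subset_rfl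
      refine ⟨Filter.Eventually.of_forall fun x _ => le_self_add, hQA.trans ?_⟩
      gcongr
      exact le_mul_of_one_le_left' (one_le_pow₀ one_le_two)
    have hanc' : ∀ p : Idx d, Q.1 ≤ p.1 → p.1 < P.1 → D P ⊆ D p →
        2 ^ (d + 1) * volume (D p ∩ E) ≤ volume (D p) ∧
        ∫⁻ y in dilate 0 1 p, ‖f y‖ₑ ≤ A * a * volume (D p) := by
      intro p h1 h2 h3
      rcases h1.eq_or_lt with h4 | h4
      · obtain rfl := hQeq p h4.symm P hPQ h3
        exact ⟨hQE, hQA⟩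
      · have := hanc p h4 h2 h3
        simp only [hstopped, not_or, not_le, not_lt] at this
        exact ⟨this.1.le, this.2⟩
    refine ⟨h.ae_le_localize hd hα hf hPN hlt hPQ ha0 hat hA0 hAt
      (fun p hp hsub => (hanc' p (by omega) (by omega) hsub).1)
      (fun p hp1 hp2 hsub => (hanc' p hp1 hp2 hsub).2), ?_⟩
    obtain ⟨c, hc⟩ := gridCube_nonempty (a := (0 : Fin d → ℝ)) one_pos P
    -- `P` itself may be stopped, so its average is controlled through its parent, at the price of
    -- `2 ^ d`.
    set p := cubeAt (P.1 - 1) c with hp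
    have hPp : D P ⊆ D p := by
      have := cubeAt_subset (show P.1 - 1 ≤ P.1 by omega) c
      rwa [cubeAt_eq hc] at this
    calc _ ≤ ∫⁻ y in dilate 0 1 p, ‖f y‖ₑ :=
          lintegral_mono_set (dilate_subset_dilate one_pos (by simp [hp, cubeAt]) hPp)
      _ ≤ A * a * volume (D p) :=
          (hanc' p (by simp only [hp, cubeAt]; omega) (by simp [hp, cubeAt]) hPp).2
      _ = _ := by rw [volume_cubeAt_sub_one (q := P) p rfl]; ring
  -- the terminal cubes
  have hfinR := finite_setOf_gridCube_inter (d := d) (a := 0) one_pos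
    (S := D Q) (isBounded_cube _ _) N N
  set R := hfinR.toFinset.filter fun r => ∀ p ∈ S, Disjoint (D p) (D r) with hR
  have hmemR : ∀ r ∈ R, r.1 = N ∧ D r ⊆ D Q ∧ ∀ p ∈ S, Disjoint (D p) (D r) := by
    intro r hr
    simp only [hR, Finset.mem_filter, Set.Finite.mem_toFinset, Set.mem_ofPred_eq] at hr
    obtain ⟨⟨h1, h2, x, hxr, hxQ⟩, h3⟩ := hr
    exact ⟨by omega, gridCube_subset_of_mem one_pos (by omega) hxQ hxr, h3⟩
  have hRd : (R : Set (Idx d)).PairwiseDisjoint D := fun p hp q hq hne =>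
    disjoint_gridCube_of_ne one_pos ((hmemR p hp).1.trans (hmemR q hq).1.symm) hne
  -- A cell of generation `N` meeting a stopped cube lies inside it, so the cell of a point outside
  -- all stopped cubes is terminal.
  have hcover : D Q ⊆ (⋃ p ∈ S, D p) ∪ ⋃ r ∈ R, D r := by
    intro x hx
    by_cases hxS : ∃ p ∈ S, x ∈ D p
    · obtain ⟨p, hp, hxp⟩ := hxS
      exact Or.inl (Set.mem_biUnion hp hxp)
    · refine Or.inr (Set.mem_biUnion (x := cubeAt N x) ?_ (mem_cubeAt N x))
      simp only [hR, Finset.coe_filter, Set.Finite.mem_toFinset, Set.mem_ofPred_eq]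
      refine ⟨⟨le_rfl, le_rfl, x, mem_cubeAt N x, hx⟩, fun p hp => Set.disjoint_left.2
        fun y hyp hy => hxS ⟨p, hp, ?_⟩⟩
      exact gridCube_subset_of_mem one_pos (hSQ p hp).2.1 hyp hy (mem_cubeAt N x)
  have hgm : Measurable fun x => ‖g x‖ₑ := hg.measurable.enorm
  have hTm : ∀ u, Measurable fun x => ‖T u x‖ₑ := fun u => (h.measurable u).enorm
  have hSterm : ∀ p ∈ S, ∫⁻ x in D p, ‖T (localize Q f) x‖ₑ * ‖g x‖ₑ ≤
      localForm T f g p + stepConst d α * a * ∫⁻ x in D p, ‖g x‖ₑ := by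
    intro p hp
    obtain ⟨h1, h2, h3⟩ := hSQ p hp
    have h4 := (htransfer p h2 h3 h1.le fun r hr1 hr2 hr3 hr => by
      have hps := hp
      simp only [hS, maximalCubes, Finset.mem_filter] at hps
      obtain ⟨x, hx⟩ := gridCube_nonempty (a := (0 : Fin d → ℝ)) one_pos p
      have hrs : r ∈ s := (hmem r).2 ⟨⟨hr1, by omega,
        gridCube_subset_of_mem one_pos hr1.le (h3 hx) (hr3 hx)⟩, hr⟩
      exact Set.disjoint_left.1 (hps.2 r hrs hr2) (hr3 hx) hx).1
    calc _ ≤ ∫⁻ x in D p, (‖T (localize p f) x‖ₑ * ‖g x‖ₑ + transferConst d α A * a * ‖g x‖ₑ) := by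
          refine setLIntegral_mono_ae' (hDm p) ?_
          filter_upwards [h4] with x hx hxp
          rw [← add_mul]
          exact mul_le_mul' (hx hxp) le_rfl
      _ = localForm T f g p + transferConst d α A * a * ∫⁻ x in D p, ‖g x‖ₑ := by
          have hm : Measurable fun x => ‖T (localize p f) x‖ₑ * ‖g x‖ₑ := (hTm _).mul hgm
          rw [lintegral_add_left hm, lintegral_const_mul _ hgm]; rfl
      _ ≤ _ := by
          gcongr
          exact le_self_add
  have hRterm : ∀ r ∈ R, ∫⁻ x in D r, ‖T (localize Q f) x‖ₑ * ‖g x‖ₑ ≤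
      stepConst d α * a * ∫⁻ x in D r, ‖g x‖ₑ := by
    intro r hr
    obtain ⟨h1, h2, h3⟩ := hmemR r hr
    obtain ⟨z, hz⟩ := gridCube_nonempty (a := (0 : Fin d → ℝ)) one_pos r
    obtain ⟨h4, h5⟩ := htransfer r h1.le h2 (by omega) fun p hp1 hp2 hp3 hp => by
      have hps : p ∈ s := (hmem p).2 ⟨⟨hp1, by omega,
        gridCube_subset_of_mem one_pos hp1.le (h2 hz) (hp3 hz)⟩, hp⟩
      obtain ⟨q, hq, -, hpq⟩ := exists_mem_maximalCubes (a := (0 : Fin d → ℝ)) one_pos hps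
      exact Set.disjoint_left.1 (h3 q hq) (hpq (hp3 hz)) hz
    have h6 := h.lintegral_localize_le hf h1 h5
    -- At the finest scale `g` is constant and leaves the integral, so an `L¹` bound for the
    -- localised image on `r` suffices.
    have hgc : ∀ x ∈ D r, ‖g x‖ₑ = ‖g z‖ₑ := fun x hx => by
      rw [mem_gridCube_iff one_pos, h1] at hx hz
      rw [hg.2 x z (by rw [hx, hz])]
    have h7 : ∫⁻ x in D r, ‖g x‖ₑ = ‖g z‖ₑ * volume (D r) := hg.setLIntegral_gridCube h1 hz
    calc _ ≤ ∫⁻ x in D r, (‖T (localize r f) x‖ₑ + transferConst d α A * a) * ‖g z‖ₑ := by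
          refine setLIntegral_mono_ae' (hDm r) ?_
          filter_upwards [h4] with x hx hxp
          rw [hgc x hxp]
          exact mul_le_mul' (hx hxp) le_rfl
      _ = ((∫⁻ x in D r, ‖T (localize r f) x‖ₑ) + transferConst d α A * a * volume (D r)) *
          ‖g z‖ₑ := by
          have hm : Measurable fun x => ‖T (localize r f) x‖ₑ + transferConst d α A * a :=
            (hTm _).add measurable_const
          rw [lintegral_mul_const _ hm, lintegral_add_left (hTm _), setLIntegral_const]
      _ ≤ (5 ^ d * (2 ^ d * A * a) * volume (D r) + transferConst d α A * a * volume (D r)) *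
          ‖g z‖ₑ := by gcongr
      _ = _ := by rw [h7, stepConst]; ring
  calc localForm T f g Q
      ≤ ∫⁻ x in (⋃ p ∈ S, D p) ∪ ⋃ r ∈ R, D r, ‖T (localize Q f) x‖ₑ * ‖g x‖ₑ :=
        lintegral_mono_set hcover
    _ ≤ (∑ p ∈ S, ∫⁻ x in D p, ‖T (localize Q f) x‖ₑ * ‖g x‖ₑ) +
        ∑ r ∈ R, ∫⁻ x in D r, ‖T (localize Q f) x‖ₑ * ‖g x‖ₑ :=
        (lintegral_union_le _ _ _).trans (add_le_add (lintegral_biUnion_finset_le _ _ _)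
          (lintegral_biUnion_finset_le _ _ _))
    _ ≤ ∑ p ∈ S, (localForm T f g p + stepConst d α * a * ∫⁻ x in D p, ‖g x‖ₑ) +
        ∑ r ∈ R, stepConst d α * a * ∫⁻ x in D r, ‖g x‖ₑ :=
        add_le_add (Finset.sum_le_sum hSterm) (Finset.sum_le_sum hRterm)
    _ = stepConst d α * a * ((∑ p ∈ S, ∫⁻ x in D p, ‖g x‖ₑ) + ∑ r ∈ R, ∫⁻ x in D r, ‖g x‖ₑ) +
        ∑ p ∈ S, localForm T f g p := by
        rw [Finset.sum_add_distrib, ← Finset.mul_sum, ← Finset.mul_sum]; ring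
    _ ≤ stepConst d α * a * (∫⁻ x in D Q, ‖g x‖ₑ) + ∑ p ∈ S, localForm T f g p := by
        refine add_le_add (mul_le_mul' le_rfl ?_) le_rfl
        rw [← lintegral_biUnion_finset hSd fun q _ => hDm q,
          ← lintegral_biUnion_finset hRd fun q _ => hDm q,
          ← lintegral_union (Finset.measurableSet_biUnion _ fun q _ => hDm q)]
        · refine lintegral_mono_set (Set.union_subset ?_ ?_)
          · exact Set.iUnion₂_subset fun p hp => (hSQ p hp).2.2
          · exact Set.iUnion₂_subset fun r hr => (hmemR r hr).2.1
        · simp only [Set.disjoint_iUnion_left, Set.disjoint_iUnion_right]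
          exact fun r hr p hp => (hmemR r hr).2.2 p hp

end OneStepMain

/-! ### Iteration to a sparse family -/

section Sparse

variable {d : ℕ} {𝕜 : Type*} [RCLike 𝕜] {α : ℝ}
variable {T : ((Fin d → ℝ) → 𝕜) → (Fin d → ℝ) → 𝕜} {K : (Fin d → ℝ) → (Fin d → ℝ) → 𝕜}

/-- Sparse domination of the localised form. -/
theorem IsStepCZ.exists_sparse_le (hd : 0 < d) (hα : 0 < α) (h : IsStepCZ T K α) {N : ℤ}
    {f g : (Fin d → ℝ) → 𝕜} (hf : IsStep N f) (hg : IsStep N g) {Q : Idx d} (hQN : Q.1 ≤ N) :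
    ∃ (ι : Type) (_ : Fintype ι) (P : ι → Idx d) (E : ι → Set (Fin d → ℝ)),
      (∀ i, Q.1 ≤ (P i).1 ∧ gridCube (0 : Fin d → ℝ) 1 (P i) ⊆ gridCube 0 1 Q) ∧
      (∀ i, MeasurableSet (E i) ∧ E i ⊆ gridCube 0 1 (P i) ∧
        volume (gridCube (0 : Fin d → ℝ) 1 (P i)) ≤ 2 * volume (E i)) ∧
      Pairwise (fun i j => Disjoint (E i) (E j)) ∧
      localForm T f g Q ≤ stepConst d α * ∑ i, (∫⁻ y in dilate 0 1 (P i), ‖f y‖ₑ) /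
        volume (gridCube (0 : Fin d → ℝ) 1 (P i)) * ∫⁻ y in gridCube 0 1 (P i), ‖g y‖ₑ := by
  classical
  -- The induction is on the number of generations left down to the finest scale `N`; stopped cubes
  -- have strictly fewer.
  induction hn : (N - Q.1).toNat using Nat.strong_induction_on generalizing Q with
  | _ n ih =>
  obtain ⟨S, hS, hSd, hvol, hform⟩ := h.exists_localForm_le hd hα hf hg hQN
  have hrec : ∀ p : S, _ := fun p => ih (N - p.1.1).toNat
    (by have := hS p p.2; omega) (Q := p.1) (hS p p.2).2.1 rfl
  choose ι inst P E hP hE hdisj hle using hrec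
  set U : Set (Fin d → ℝ) := ⋃ p ∈ S, gridCube 0 1 p with hU
  have hUm : MeasurableSet U := S.measurableSet_biUnion fun p _ => measurableSet_gridCube p
  have hUQ : U ⊆ gridCube 0 1 Q := Set.iUnion₂_subset fun p hp => (hS p hp).2.2
  have hEp : ∀ p (i : ι p), E p i ⊆ gridCube 0 1 p.1 := fun p i => (hE p i).2.1.trans (hP p i).2
  have hEU : ∀ p (i : ι p), E p i ⊆ U := fun p i =>
    (hEp p i).trans (Set.subset_biUnion_of_mem (u := fun p => gridCube (0 : Fin d → ℝ) 1 p) p.2)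
  have hQU : volume (gridCube (0 : Fin d → ℝ) 1 Q) ≤ 2 * volume (gridCube 0 1 Q \ U) := by
    have h1 : volume (gridCube 0 1 Q \ U) + volume U = volume (gridCube (0 : Fin d → ℝ) 1 Q) := by
      rw [← measure_union Set.disjoint_sdiff_left hUm, Set.sdiff_union_of_subset hUQ]
    have h2 : 2 * volume U ≤ volume (gridCube (0 : Fin d → ℝ) 1 Q) := by
      rwa [hU, measure_biUnion_finset hSd fun p _ => measurableSet_gridCube p]
    refine (ENNReal.add_le_add_iff_right (volume_gridCube_ne_top (a := 0) (l := 1) Q)).1 ?_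
    calc _ = 2 * volume (gridCube 0 1 Q \ U) + 2 * volume U := by
          rw [← mul_add, h1, two_mul]
      _ ≤ _ := by gcongr
  -- The new index `none` stands for `Q`, whose set is the part outside the stopped cubes and has at
  -- least half its measure. The other indices come from the families of the stopped cubes.
  refine ⟨Option (Σ p : S, ι p), inferInstance, fun o => o.elim Q fun s => P s.1 s.2,
    fun o => o.elim (gridCube 0 1 Q \ U) fun s => E s.1 s.2, ?_, ?_, ?_, ?_⟩
  · rintro (_ | ⟨p, i⟩)
    · exact ⟨le_rfl, subset_rfl⟩
    · exact ⟨(hS p p.2).1.le.trans (hP p i).1, (hP p i).2.trans (hS p p.2).2.2⟩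
  · rintro (_ | ⟨p, i⟩)
    · exact ⟨(measurableSet_gridCube Q).diff hUm, Set.sdiff_subset, hQU⟩
    · exact hE p i
  · rintro (_ | ⟨p, i⟩) (_ | ⟨q, j⟩) hne
    · exact absurd rfl hne
    · exact Set.disjoint_sdiff_left.mono_right (hEU q j)
    · exact (Set.disjoint_sdiff_left.mono_right (hEU p i)).symm
    · by_cases hpq : p = q
      · subst hpq
        exact hdisj p fun hij : i = j => hne (by rw [hij])
      · exact (hSd p.2 q.2 fun h => hpq (Subtype.ext h)).mono (hEp p i) (hEp q j)
  · rw [Fintype.sum_option, Fintype.sum_sigma, mul_add, Finset.mul_sum]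
    refine hform.trans (add_le_add (le_of_eq (mul_assoc _ _ _)) ?_)
    rw [← Finset.sum_coe_sort S]
    exact Finset.sum_le_sum fun p _ => hle p

end Sparse

/-! ### Weighted estimate for the bilinear form -/

section WeightedForm

theorem sum_sq_le_card_sq_mul {ι : Type*} (s : Finset ι) {x : ι → ℝ≥0∞} {Z : ℝ≥0∞}
    (h : ∀ i ∈ s, x i ^ 2 ≤ Z) : (∑ i ∈ s, x i) ^ 2 ≤ (s.card : ℝ≥0∞) ^ 2 * Z := by
  have hZ : (Z ^ (1 / 2 : ℝ)) ^ 2 = Z := by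
    rw [← ENNReal.rpow_natCast, ← ENNReal.rpow_mul]; norm_num
  have h1 : ∀ i ∈ s, x i ≤ Z ^ (1 / 2 : ℝ) := fun i hi => by
    rw [← ENNReal.pow_le_pow_left_iff two_ne_zero, hZ]; exact h i hi
  calc _ ≤ (∑ i ∈ s, Z ^ (1 / 2 : ℝ)) ^ 2 := pow_le_pow_left' (Finset.sum_le_sum h1) 2
    _ = _ := by rw [Finset.sum_const, nsmul_eq_mul, mul_pow, hZ]

variable {d : ℕ} {𝕜 : Type*} [RCLike 𝕜] {α : ℝ} {w : (Fin d → ℝ) → ℝ}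
variable {T : ((Fin d → ℝ) → 𝕜) → (Fin d → ℝ) → 𝕜} {K : (Fin d → ℝ) → (Fin d → ℝ) → 𝕜}

theorem IsStep.lintegral_weight_ne_top {N : ℤ} {f : (Fin d → ℝ) → 𝕜} (hf : IsStep N f)
    (hw : LocallyIntegrable w volume) : ∫⁻ x, ENNReal.ofReal (w x) * ‖f x‖ₑ ^ 2 ≠ ∞ := by
  obtain ⟨R, hR⟩ := hf.1
  set M := eLpNormEssSup f volume with hM
  have hMt : M ≠ ∞ := by
    have := (hf.memLp ∞).2.ne
    rwa [eLpNorm_exponent_top] at this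
  have hB : ∫⁻ x in Metric.closedBall (0 : Fin d → ℝ) R, ENNReal.ofReal (w x) ≠ ∞ :=
    ((lintegral_mono fun x => Real.ofReal_le_enorm (w x)).trans_lt
      (hw.integrableOn_isCompact (isCompact_closedBall _ _)).2).ne
  refine ne_top_of_le_ne_top (ENNReal.mul_ne_top hB (ENNReal.pow_ne_top (n := 2) hMt)) ?_
  rw [← lintegral_mul_const' _ _ (ENNReal.pow_ne_top hMt),
    ← lintegral_indicator Metric.isClosed_closedBall.measurableSet]
  refine lintegral_mono_ae ?_
  filter_upwards [ae_le_eLpNormEssSup (f := f) (μ := volume)] with x hx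
  by_cases h : x ∈ Metric.closedBall (0 : Fin d → ℝ) R
  · rw [Set.indicator_of_mem h]; gcongr
  · have : f x = 0 := hR x (by simpa using h)
    simp [this]

/-- The constant of the weighted estimate for the localised form. -/
noncomputable def localFormConst (d : ℕ) (α : ℝ) : ℝ≥0∞ :=
  (stepConst d α * 16 ^ d * 2 ^ d) ^ 2 * (2048 * (2 * 16 ^ d) ^ 2)

theorem volume_gridCube_sub_four (a : Fin d → ℝ) (q : Idx d) (m : Fin d → ℤ) :
    volume (gridCube a 1 (q.1 - 4, m)) = 16 ^ d * volume (gridCube (0 : Fin d → ℝ) 1 q) := by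
  rw [volume_gridCube, volume_gridCube, ← mul_pow]
  congr 1
  rw [show (16 : ℝ≥0∞) = ENNReal.ofReal 16 by norm_num, ← ENNReal.ofReal_mul (by norm_num)]
  congr 1
  rw [neg_sub, sub_eq_add_neg, zpow_add₀ (by norm_num)]
  norm_num

theorem IsStepCZ.localForm_sq_le (hd : 0 < d) (hα : 0 < α) (h : IsStepCZ T K α)
    (hA : IsA2Weight w) (hwm : Measurable w) (hw : ∀ x, 0 < w x) {N : ℤ}
    {f g : (Fin d → ℝ) → 𝕜} (hf : IsStep N f) (hg : IsStep N g) {Q : Idx d} (hQN : Q.1 ≤ N) :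
    localForm T f g Q ^ 2 ≤ localFormConst d α * (a2Const w *
      (aInftyConst w + aInftyConst fun x => (w x)⁻¹) *
        (∫⁻ x, ENNReal.ofReal (w x) * ‖f x‖ₑ ^ 2) *
          ∫⁻ x, ENNReal.ofReal (w x)⁻¹ * ‖g x‖ₑ ^ 2) := by
  classical
  obtain ⟨ι, _, P, E, hP, hE, hdisj, hle⟩ := h.exists_sparse_le hd hα hf hg hQN
  -- Every sparse cube has generation at least that of `Q`, so the translations depend on `Q.1`
  -- alone and `2^d` grids serve the whole family.
  have hsh := fun i => exists_shift_dilate_subset (hP i).1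
  choose u m hum using hsh
  set R : ι → Idx d := fun i => ((P i).1 - 4, m i) with hR
  set D : ι → Set (Fin d → ℝ) := fun i => gridCube (shift Q.1 (u i)) 1 (R i) with hD
  have hsub : ∀ i, gridCube (0 : Fin d → ℝ) 1 (P i) ⊆ D i := fun i =>
    (gridCube_subset_dilate one_pos _).trans (hum i)
  have hvol : ∀ i, volume (D i) = 16 ^ d * volume (gridCube (0 : Fin d → ℝ) 1 (P i)) := fun i =>
    volume_gridCube_sub_four _ _ _
  have h16 : (16 : ℝ≥0∞) ^ d ≠ 0 := pow_ne_zero _ (by norm_num)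
  have h16t : (16 : ℝ≥0∞) ^ d ≠ ∞ := ENNReal.pow_ne_top (by norm_num)
  have hterm : ∀ i, (∫⁻ y in dilate 0 1 (P i), ‖f y‖ₑ) /
      volume (gridCube (0 : Fin d → ℝ) 1 (P i)) * ∫⁻ y in gridCube 0 1 (P i), ‖g y‖ₑ ≤
      16 ^ d * ((volume (D i))⁻¹ * (∫⁻ y in D i, ‖f y‖ₑ) * ∫⁻ y in D i, ‖g y‖ₑ) := by
    intro i
    have h1 : (volume (gridCube (0 : Fin d → ℝ) 1 (P i)))⁻¹ = 16 ^ d * (volume (D i))⁻¹ := by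
      rw [hvol, ENNReal.mul_inv (Or.inl h16) (Or.inl h16t), ← mul_assoc,
        ENNReal.mul_inv_cancel h16 h16t, one_mul]
    rw [div_eq_mul_inv, h1]
    calc _ ≤ (∫⁻ y in D i, ‖f y‖ₑ) * (16 ^ d * (volume (D i))⁻¹) * ∫⁻ y in D i, ‖g y‖ₑ :=
          mul_le_mul' (mul_le_mul' (lintegral_mono_set (hum i)) le_rfl)
            (lintegral_mono_set (hsub i))
      _ = _ := by ring
  set Z := a2Const w * (aInftyConst w + aInftyConst fun x => (w x)⁻¹) *
    (∫⁻ x, ENNReal.ofReal (w x) * ‖f x‖ₑ ^ 2) *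
      ∫⁻ x, ENNReal.ofReal (w x)⁻¹ * ‖g x‖ₑ ^ 2 with hZ
  -- Enlarging the cubes multiplies volumes by `16 ^ d` and keeps the sets `E i`, so the sparseness
  -- constant becomes `2 * 16 ^ d`.
  have hgrid : ∀ v ∈ (Finset.univ : Finset (Fin d → Bool)),
      (∑ i with u i = v, (volume (D i))⁻¹ * (∫⁻ y in D i, ‖f y‖ₑ) * ∫⁻ y in D i, ‖g y‖ₑ) ^ 2 ≤
        2048 * (2 * 16 ^ d) ^ 2 * Z := by
    intro v _
    have hv : ∀ i ∈ Finset.univ.filter fun i => u i = v, D i = gridCube (shift Q.1 v) 1 (R i) :=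
      fun i hi => by simp only [hD, (Finset.mem_filter.1 hi).2]
    have := sparse_form_sq_le hd hA hwm hw one_pos (Finset.univ.filter fun i => u i = v) R E
      (a := shift Q.1 v) (Λ := 2 * 16 ^ d) (F := fun x => ‖f x‖ₑ) (G := fun x => ‖g x‖ₑ)
      (fun i _ => (hE i).1) (fun i hi => hv i hi ▸ (hE i).2.1.trans (hsub i))
      (fun i _ j _ hij => hdisj hij)
      (fun i hi => by
        rw [← hv i hi, hvol, mul_comm 2, mul_assoc]
        exact mul_le_mul' le_rfl (hE i).2.2)
      hf.measurable.enorm hg.measurable.enorm (hf.lintegral_weight_ne_top hA.locallyIntegrable)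
      (hg.lintegral_weight_ne_top (isA2Weight_inv hA).locallyIntegrable)
    rw [Finset.sum_congr rfl fun i hi => by rw [hv i hi]]
    refine this.trans (le_of_eq ?_)
    rw [hZ]; ring
  calc localForm T f g Q ^ 2
      ≤ (stepConst d α * (16 ^ d * ∑ v : Fin d → Bool, ∑ i with u i = v,
          (volume (D i))⁻¹ * (∫⁻ y in D i, ‖f y‖ₑ) * ∫⁻ y in D i, ‖g y‖ₑ)) ^ 2 := by
        refine pow_le_pow_left' (hle.trans (mul_le_mul' le_rfl ?_)) 2
        rw [Finset.sum_fiberwise, Finset.mul_sum]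
        exact Finset.sum_le_sum fun i _ => hterm i
    _ ≤ (stepConst d α * 16 ^ d) ^ 2 * (((Finset.univ : Finset (Fin d → Bool)).card : ℝ≥0∞) ^ 2 *
          (2048 * (2 * 16 ^ d) ^ 2 * Z)) := by
        rw [← mul_assoc, mul_pow]
        exact mul_le_mul' le_rfl (sum_sq_le_card_sq_mul _ hgrid)
    _ = _ := by
        rw [Finset.card_univ, Fintype.card_fun, Fintype.card_bool, Fintype.card_fin, localFormConst]
        push_cast
        ring

/-- The constant of the weighted estimate for the form. -/
noncomputable def formConst (d : ℕ) (α : ℝ) : ℝ≥0∞ := (2 ^ d) ^ 2 * localFormConst d α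

theorem formConst_ne_top (hα : 0 < α) : formConst d α ≠ ∞ := by
  have h1 := stepConst_ne_top (d := d) hα
  unfold formConst localFormConst; finiteness

/-- The cubes of side `2^r` with a corner at the origin: together they cover a large ball, and the
dilate of each one contains that ball, so localising to it does not change `f`. -/
theorem exists_top_cubes {R : ℝ} (N : ℤ) : ∃ (k : ℤ) (s : Finset (Fin d → ℤ)), k ≤ N ∧
    s.card = 2 ^ d ∧ ∀ x : Fin d → ℝ, ‖x‖ ≤ R →
      (∀ m ∈ s, x ∈ dilate (0 : Fin d → ℝ) 1 (k, m)) ∧ ∃ m ∈ s, x ∈ gridCube 0 1 (k, m) := by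
  obtain ⟨n, hn⟩ := pow_unbounded_of_one_lt R (one_lt_two)
  set r : ℕ := max n N.natAbs with hr
  have hRr : R < 2 ^ r := hn.trans_le (pow_le_pow_right₀ one_le_two (le_max_left _ _))
  have hside : (2 : ℝ) ^ (-(-(r : ℤ))) = 2 ^ r := by rw [neg_neg, zpow_natCast]
  have hpos : (0 : ℝ) < 2 ^ r := by positivity
  refine ⟨-r, Fintype.piFinset fun _ => {-1, 0}, ?_, ?_, ?_⟩
  · have : N.natAbs ≤ r := le_max_right _ _
    omega
  · rw [Fintype.card_piFinset]; simp
  · intro x hx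
    have hxi : ∀ i, -(2 : ℝ) ^ r < x i ∧ x i < 2 ^ r := fun i =>
      abs_lt.1 (((norm_le_pi_norm x i).trans hx).trans_lt hRr)
    constructor
    · intro m hm i
      have hmi := Fintype.mem_piFinset.1 hm i
      simp only [Finset.mem_insert, Finset.mem_singleton] at hmi
      simp only [Pi.zero_apply, hside]
      rcases hmi with h | h <;> rw [h] <;> push_cast <;>
        constructor <;> linarith [(hxi i).1, (hxi i).2]
    · refine ⟨fun i => if x i < 0 then -1 else 0, Fintype.mem_piFinset.2 fun i => ?_, fun i => ?_⟩
      · by_cases h : x i < 0 <;> simp [h]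
      · simp only [Pi.zero_apply, hside]
        by_cases h : x i < 0
        · simp only [h, if_true]; push_cast
          constructor <;> linarith [(hxi i).1, (hxi i).2]
        · simp only [h, if_false]; push_cast
          constructor <;> linarith [(hxi i).1, (hxi i).2]

/-- The weighted estimate for the form of a Calderón–Zygmund operator on step functions. -/
theorem IsStepCZ.form_sq_le (hd : 0 < d) (hα : 0 < α) (h : IsStepCZ T K α)
    (hA : IsA2Weight w) (hwm : Measurable w) (hw : ∀ x, 0 < w x) {N : ℤ}
    {f g : (Fin d → ℝ) → 𝕜} (hf : IsStep N f) (hg : IsStep N g) :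
    (∫⁻ x, ‖T f x‖ₑ * ‖g x‖ₑ) ^ 2 ≤ formConst d α * (a2Const w *
      (aInftyConst w + aInftyConst fun x => (w x)⁻¹) *
        (∫⁻ x, ENNReal.ofReal (w x) * ‖f x‖ₑ ^ 2) *
          ∫⁻ x, ENNReal.ofReal (w x)⁻¹ * ‖g x‖ₑ ^ 2) := by
  obtain ⟨R, hR⟩ := hf.1
  obtain ⟨R', hR'⟩ := hg.1
  obtain ⟨k, s, hkN, hs, hcov⟩ := exists_top_cubes (d := d) (R := max R R') N
  have hloc : ∀ m ∈ s, localize (k, m) f = f := fun m hm => by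
    rw [localize, Set.indicator_eq_self]
    intro x hx
    refine ((hcov x (not_lt.1 fun hlt => hx (hR x ((le_max_left _ _).trans_lt hlt)))).1 m hm)
  have h1 : ∫⁻ x, ‖T f x‖ₑ * ‖g x‖ₑ ≤ ∑ m ∈ s, localForm T f g (k, m) := by
    calc _ = ∫⁻ x in ⋃ m ∈ s, gridCube 0 1 (k, m), ‖T f x‖ₑ * ‖g x‖ₑ := by
          rw [← lintegral_indicator (s.measurableSet_biUnion fun m _ => measurableSet_gridCube _)]
          refine lintegral_congr fun x => ?_
          by_cases hx : x ∈ ⋃ m ∈ s, gridCube (0 : Fin d → ℝ) 1 (k, m)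
          · rw [Set.indicator_of_mem hx]
          · rw [Set.indicator_of_notMem hx]
            have : g x = 0 := hR' x (not_le.1 fun hle => hx ?_)
            · simp [this]
            · obtain ⟨m, hm, hxm⟩ := (hcov x (hle.trans (le_max_right _ _))).2
              exact Set.mem_biUnion hm hxm
      _ ≤ ∑ m ∈ s, ∫⁻ x in gridCube 0 1 (k, m), ‖T f x‖ₑ * ‖g x‖ₑ :=
          lintegral_biUnion_finset_le _ _ _
      _ = _ := Finset.sum_congr rfl fun m hm => by rw [localForm, hloc m hm]
  refine (pow_le_pow_left' h1 2).trans ((sum_sq_le_card_sq_mul s fun m _ =>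
    h.localForm_sq_le hd hα hA hwm hw hf hg (Q := (k, m)) hkN).trans (le_of_eq ?_))
  rw [hs, formConst]
  push_cast
  ring

end WeightedForm

/-! ### Density of step functions -/

section Density

theorem eLpNorm_two_sq {X E : Type*} [MeasurableSpace X] [NormedAddCommGroup E] {μ : Measure X}
    (f : X → E) : eLpNorm f 2 μ ^ 2 = ∫⁻ x, ‖f x‖ₑ ^ 2 ∂μ := by
  have := eLpNorm_nnreal_pow_eq_lintegral (μ := μ) (f := f) (p := 2) two_ne_zero
  simp only [NNReal.coe_ofNat, ENNReal.coe_ofNat, ENNReal.rpow_ofNat] at this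
  exact this

theorem eLpNorm_le_add_of_sub_le {X E : Type*} [MeasurableSpace X] [NormedAddCommGroup E]
    {μ : Measure X} {f g : X → E} {ε : ℝ≥0∞} (hf : AEStronglyMeasurable f μ)
    (hg : AEStronglyMeasurable g μ) (h : eLpNorm (f - g) 2 μ ≤ ε) :
    eLpNorm g 2 μ ≤ eLpNorm f 2 μ + ε := by
  calc eLpNorm g 2 μ = eLpNorm (f - (f - g)) 2 μ := by rw [sub_sub_cancel]
    _ ≤ eLpNorm f 2 μ + eLpNorm (f - g) 2 μ := eLpNorm_sub_le hf (hf.sub hg) (by norm_num)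
    _ ≤ _ := add_le_add le_rfl h

theorem memLp_two_of_lintegral_ne_top {X E : Type*} [MeasurableSpace X] [NormedAddCommGroup E]
    {μ : Measure X} {f : X → E} (hf : AEStronglyMeasurable f μ) (h : ∫⁻ x, ‖f x‖ₑ ^ 2 ∂μ ≠ ∞) :
    MemLp f 2 μ := by
  refine ⟨hf, ((ENNReal.pow_lt_top_iff (n := 2)).1 ?_).resolve_right two_ne_zero⟩
  rw [eLpNorm_two_sq]
  exact h.lt_top

theorem memLp_two_add_measure {X E : Type*} [MeasurableSpace X] [NormedAddCommGroup E]
    {μ ν : Measure X} {f : X → E} (hμ : MemLp f 2 μ) (hν : MemLp f 2 ν) : MemLp f 2 (μ + ν) := by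
  refine memLp_two_of_lintegral_ne_top (hμ.1.add_measure hν.1) ?_
  rw [lintegral_add_measure, ← eLpNorm_two_sq, ← eLpNorm_two_sq]
  exact ENNReal.add_ne_top.2 ⟨ENNReal.pow_ne_top hμ.2.ne, ENNReal.pow_ne_top hν.2.ne⟩

theorem le_of_forall_le_add_mul {a b K : ℝ≥0∞} (hK : K ≠ ∞)
    (h : ∀ ε : ℝ≥0∞, ε ≠ 0 → ε ≠ ∞ → a ≤ b + K * ε) : a ≤ b := by
  refine ENNReal.le_of_forall_pos_le_add fun δ hδ _ => ?_
  have hK1 : K + 1 ≠ ∞ := ENNReal.add_ne_top.2 ⟨hK, ENNReal.one_ne_top⟩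
  refine (h (δ / (K + 1)) (ENNReal.div_ne_zero.2 ⟨by exact_mod_cast hδ.ne', hK1⟩)
    (ENNReal.div_ne_top ENNReal.coe_ne_top (by simp))).trans (add_le_add le_rfl ?_)
  calc K * (δ / (K + 1)) ≤ (K + 1) * (δ / (K + 1)) := by gcongr; exact le_self_add
    _ = δ := ENNReal.mul_div_cancel (by simp) hK1

variable {d : ℕ} {𝕜 : Type*} [RCLike 𝕜] 

/-- The lower corner of the dyadic cube of side `2^{-N}` containing a point. -/
noncomputable def corner (N : ℤ) (x : Fin d → ℝ) : Fin d → ℝ :=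
  fun i => (2 : ℝ) ^ (-N) * gridIndex 0 1 N x i

theorem corner_mem (N : ℤ) (x : Fin d → ℝ) : corner N x ∈ gridCube 0 1 (N, gridIndex 0 1 N x) := by
  intro i
  have : (0 : ℝ) < 2 ^ (-N) := by positivity
  constructor <;> simp only [corner, Pi.zero_apply, zero_add, one_mul] <;> linarith

theorem norm_sub_corner_lt (N : ℤ) (x : Fin d → ℝ) : ‖x - corner N x‖ < 2 ^ (-N) := by
  simpa using norm_sub_lt_of_mem_gridCube one_pos
    (mem_gridCube_gridIndex one_pos N x) (corner_mem N x)

theorem exists_isStep_norm_sub_le {φ : (Fin d → ℝ) → 𝕜} (hφ : Continuous φ)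
    (hφs : HasCompactSupport φ) : ∃ R : ℝ, ∀ δ > 0, ∃ (N : ℤ) (g : (Fin d → ℝ) → 𝕜), IsStep N g ∧
      ∀ x, ‖φ x - g x‖ ≤ (Metric.closedBall (0 : Fin d → ℝ) R).indicator (fun _ => δ) x := by
  obtain ⟨R, hR⟩ := hφs.isCompact.isBounded.exists_norm_le
  have hφ0 : ∀ x, R < ‖x‖ → φ x = 0 := fun x hx =>
    image_eq_zero_of_notMem_tsupport fun h => absurd (hR x h) (not_le.2 hx)
  refine ⟨R + 1, fun δ hδ => ?_⟩
  obtain ⟨η, hη, hφη⟩ := Metric.uniformContinuous_iff.1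
    (hφs.uniformContinuous_of_continuous hφ) δ hδ
  obtain ⟨n, hn⟩ := exists_pow_lt_of_lt_one hη (show (1 / 2 : ℝ) < 1 by norm_num)
  have hn' : (2 : ℝ) ^ (-(n : ℤ)) < η := by
    rw [zpow_neg, zpow_natCast, ← inv_pow]; simpa using hn
  have hn1 : (2 : ℝ) ^ (-(n : ℤ)) ≤ 1 := zpow_le_one_of_nonpos₀ one_le_two (by omega)
  have hc : ∀ x : Fin d → ℝ, ‖x - corner n x‖ < 2 ^ (-(n : ℤ)) := fun x =>
    norm_sub_corner_lt (n : ℤ) x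
  have hfar : ∀ x : Fin d → ℝ, R + 1 < ‖x‖ → R < ‖corner (n : ℤ) x‖ := fun x hx => by
    have := norm_sub_norm_le x (corner (n : ℤ) x)
    linarith [hc x]
  -- Sampling at the lower corner of each cell gives a step function. Cells have side at most one,
  -- so its support grows by at most one, uniformly in `δ`.
  refine ⟨n, fun x => φ (corner n x), ⟨⟨R + 1, fun x hx => hφ0 _ (hfar x hx)⟩,
    fun x y hxy => congrArg φ (by simp only [corner, funext_iff, hxy, implies_true])⟩, fun x => ?_⟩
  by_cases hx : x ∈ Metric.closedBall (0 : Fin d → ℝ) (R + 1)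
  · rw [Set.indicator_of_mem hx, ← dist_eq_norm]
    refine (hφη ?_).le
    rw [dist_eq_norm]
    exact (hc x).trans hn'
  · have hx' : R + 1 < ‖x‖ := by simpa using hx
    have h1 : φ x = 0 := hφ0 x (by linarith)
    have h2 : φ (corner n x) = 0 := hφ0 _ (hfar x hx')
    rw [Set.indicator_of_notMem hx, h1]
    simp [h2]

/-- Stated for general measures finite on compacts so that, with the sum of Lebesgue measure and a
weighted one, a single approximant serves both norms. -/
theorem exists_isStep_eLpNorm_sub_le (ν : Measure (Fin d → ℝ))
    [IsFiniteMeasureOnCompacts ν] {f : (Fin d → ℝ) → 𝕜} (hf : MemLp f 2 ν) {ε : ℝ≥0∞}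
    (hε : ε ≠ 0) : ∃ (N : ℤ) (g : (Fin d → ℝ) → 𝕜), IsStep N g ∧ eLpNorm (f - g) 2 ν ≤ ε := by
  obtain ⟨ε', hε', hlt⟩ := exists_between (ENNReal.half_pos hε)
  obtain ⟨φ, hφs, hφ, hφc, -⟩ := hf.exists_hasCompactSupport_eLpNorm_sub_le
    (ENNReal.ofNat_ne_top) (ENNReal.half_pos hε).ne'
  obtain ⟨R, hR⟩ := exists_isStep_norm_sub_le hφc hφs
  set B := Metric.closedBall (0 : Fin d → ℝ) R
  have hB : ν B ≠ ∞ := (isCompact_closedBall (0 : Fin d → ℝ) R).measure_ne_top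
  have hBm : MeasurableSet B := Metric.isClosed_closedBall.measurableSet
  have hlt1 : ∃ δ : ℝ, 0 < δ ∧ ENNReal.ofReal δ * ν B ^ (1 / 2 : ℝ) ≤ ε / 2 := by
    set m := ν B ^ (1 / 2 : ℝ) + 1 with hm
    have hmt : m ≠ ∞ := by
      refine ENNReal.add_ne_top.2 ⟨ENNReal.rpow_ne_top_of_nonneg (by norm_num) hB, ENNReal.one_ne_top⟩
    have hεt : ε' ≠ ∞ := hlt.ne_top
    have hd0 : ε' / m ≠ 0 := ENNReal.div_ne_zero.2 ⟨hε'.ne', hmt⟩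
    have hdt : ε' / m ≠ ∞ := ENNReal.div_ne_top hεt (by simp [hm])
    refine ⟨(ε' / m).toReal, ENNReal.toReal_pos hd0 hdt, ?_⟩
    rw [ENNReal.ofReal_toReal hdt]
    calc _ ≤ ε' / m * m := by gcongr; exact le_self_add
      _ = ε' := ENNReal.div_mul_cancel (by simp [hm]) hmt
      _ ≤ _ := hlt.le
  obtain ⟨δ, hδ, hδε⟩ := hlt1
  obtain ⟨N, g, hg, hφg⟩ := hR δ hδ
  refine ⟨N, g, hg, ?_⟩
  have h1 : eLpNorm (φ - g) 2 ν ≤ ε / 2 := by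
    refine (eLpNorm_mono_real (g := B.indicator fun _ => δ) hφg).trans (le_trans (le_of_eq ?_) hδε)
    rw [eLpNorm_indicator_const hBm two_ne_zero ENNReal.ofNat_ne_top, Real.enorm_of_nonneg hδ.le]
    norm_num
  have h2 : f - g = (f - φ) + (φ - g) := by abel
  rw [h2]
  refine (eLpNorm_add_le (hf.1.sub hφc.aestronglyMeasurable)
    (hφc.aestronglyMeasurable.sub hg.measurable.aestronglyMeasurable) (by norm_num)).trans ?_
  calc _ ≤ ε / 2 + ε / 2 := add_le_add hφ h1
    _ = ε := ENNReal.add_halves ε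

end Density

/-! ### Duality and extension -/

section Extension

variable {d : ℕ} {𝕜 : Type*} [RCLike 𝕜] {v : (Fin d → ℝ) → ℝ}

theorem isFiniteMeasureOnCompacts_volume_add (hv : LocallyIntegrable v volume) :
    IsFiniteMeasureOnCompacts ((volume : Measure (Fin d → ℝ)) + weightMeasure v) := by
  refine ⟨fun C hC => ?_⟩
  rw [Measure.add_apply, weightMeasure_apply hC.measurableSet]
  exact ENNReal.add_lt_top.2 ⟨hC.measure_lt_top,
    (lintegral_mono fun x => Real.ofReal_le_enorm (v x)).trans_lt (hv.integrableOn_isCompact hC).2⟩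

/-- A weighted `L²` bound by duality with step functions. -/
theorem lintegral_weight_le_of_forall_step (hvm : Measurable v) (hv : ∀ x, 0 < v x)
    (hvi : LocallyIntegrable (fun x => (v x)⁻¹) volume) {u : (Fin d → ℝ) → 𝕜} (hum : Measurable u)
    (hu : MemLp u 2 volume) {c : ℝ≥0∞} (hc : c ≠ ∞)
    (h : ∀ (N : ℤ) (g : (Fin d → ℝ) → 𝕜), IsStep N g →
      (∫⁻ x, ‖u x‖ₑ * ‖g x‖ₑ) ^ 2 ≤ c * ∫⁻ x, ENNReal.ofReal (v x)⁻¹ * ‖g x‖ₑ ^ 2) :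
    ∫⁻ x, ENNReal.ofReal (v x) * ‖u x‖ₑ ^ 2 ≤ c := by
  set σ := weightMeasure fun x => (v x)⁻¹ with hσ
  have hσm : Measurable fun x => (v x)⁻¹ := hvm.inv
  have hcs : (c ^ (1 / 2 : ℝ)) ^ 2 = c := by
    rw [← ENNReal.rpow_natCast, ← ENNReal.rpow_mul]; norm_num
  have hct : c ^ (1 / 2 : ℝ) ≠ ∞ := ENNReal.rpow_ne_top_of_nonneg (by norm_num) hc
  have hσ2 : ∀ g : (Fin d → ℝ) → 𝕜, Measurable g →
      eLpNorm g 2 σ ^ 2 = ∫⁻ x, ENNReal.ofReal (v x)⁻¹ * ‖g x‖ₑ ^ 2 := fun g hg => by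
    rw [eLpNorm_two_sq, lintegral_weightMeasure hσm (hg.enorm.pow_const 2)]
  have hpair : ∀ a b : (Fin d → ℝ) → 𝕜, Measurable a → Measurable b →
      ∫⁻ x, ‖a x‖ₑ * ‖b x‖ₑ ≤ eLpNorm a 2 volume * eLpNorm b 2 volume := fun a b ha hb => by
    rw [← ENNReal.pow_le_pow_left_iff two_ne_zero, mul_pow, eLpNorm_two_sq, eLpNorm_two_sq]
    exact lintegral_mul_sq_le ha.enorm.aemeasurable hb.enorm.aemeasurable
  have hstep : ∀ (N : ℤ) (g : (Fin d → ℝ) → 𝕜), IsStep N g →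
      ∫⁻ x, ‖u x‖ₑ * ‖g x‖ₑ ≤ c ^ (1 / 2 : ℝ) * eLpNorm g 2 σ := fun N g hg => by
    rw [← ENNReal.pow_le_pow_left_iff two_ne_zero, mul_pow, hcs, hσ2 g hg.measurable]
    exact h N g hg
  -- Approximation in `L²(volume + σ)`: the unweighted norm controls the error in the pairing with
  -- `u`, the weighted one keeps the bound.
  have := isFiniteMeasureOnCompacts_volume_add hvi
  have hle1 : (volume : Measure (Fin d → ℝ)) ≤ volume + σ := Measure.le_add_right le_rfl
  have hle2 : σ ≤ volume + σ := Measure.le_add_left le_rfl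
  have hgen : ∀ g : (Fin d → ℝ) → 𝕜, Measurable g → MemLp g 2 volume → MemLp g 2 σ →
      ∫⁻ x, ‖u x‖ₑ * ‖g x‖ₑ ≤ c ^ (1 / 2 : ℝ) * eLpNorm g 2 σ := by
    intro g hgm hg1 hg2
    have hg : MemLp g 2 (volume + σ) := memLp_two_add_measure hg1 hg2
    refine le_of_forall_le_add_mul (K := c ^ (1 / 2 : ℝ) + eLpNorm u 2 volume)
      (ENNReal.add_ne_top.2 ⟨hct, hu.2.ne⟩) fun ε hε _ => ?_
    obtain ⟨N, s, hs, hsε⟩ := exists_isStep_eLpNorm_sub_le (volume + σ) hg hε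
    have h1 : eLpNorm (g - s) 2 volume ≤ ε := (eLpNorm_mono_measure _ hle1).trans hsε
    have h2 : eLpNorm (g - s) 2 σ ≤ ε := (eLpNorm_mono_measure _ hle2).trans hsε
    have h3 : eLpNorm s 2 σ ≤ eLpNorm g 2 σ + ε :=
      eLpNorm_le_add_of_sub_le hg2.1 hs.measurable.aestronglyMeasurable h2
    calc ∫⁻ x, ‖u x‖ₑ * ‖g x‖ₑ ≤ ∫⁻ x, (‖u x‖ₑ * ‖s x‖ₑ + ‖u x‖ₑ * ‖(g - s) x‖ₑ) := by
          refine lintegral_mono fun x => ?_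
          rw [← mul_add]
          refine mul_le_mul' le_rfl ?_
          calc ‖g x‖ₑ = ‖s x + (g - s) x‖ₑ := by simp
            _ ≤ _ := enorm_add_le _ _
      _ = (∫⁻ x, ‖u x‖ₑ * ‖s x‖ₑ) + ∫⁻ x, ‖u x‖ₑ * ‖(g - s) x‖ₑ := by
          have hm : Measurable fun x => ‖u x‖ₑ * ‖s x‖ₑ := hum.enorm.mul hs.measurable.enorm
          exact lintegral_add_left hm _
      _ ≤ c ^ (1 / 2 : ℝ) * (eLpNorm g 2 σ + ε) + eLpNorm u 2 volume * ε :=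
          add_le_add ((hstep N s hs).trans (mul_le_mul' le_rfl h3))
            ((hpair u (g - s) hum (hgm.sub hs.measurable)).trans (mul_le_mul' le_rfl h1))
      _ = _ := by ring
  -- test against truncations of `|u| v`
  set E : ℕ → Set (Fin d → ℝ) := fun n => {x | v x ≤ n} with hE
  have hEm : ∀ n, MeasurableSet (E n) := fun n => measurableSet_le hvm measurable_const
  have hEmono : Monotone E := fun m n hmn x (hx : v x ≤ m) =>
    show v x ≤ n from hx.trans (by exact_mod_cast hmn)
  have hEU : ⋃ n, E n = Set.univ := Set.eq_univ_of_forall fun x =>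
    Set.mem_iUnion.2 (exists_nat_ge (v x))
  have hu2 : ∫⁻ x, ‖u x‖ₑ ^ 2 ≠ ∞ := by
    rw [← eLpNorm_two_sq]; exact ENNReal.pow_ne_top hu.2.ne
  have hbound : ∀ n, ∫⁻ x in E n, ENNReal.ofReal (v x) * ‖u x‖ₑ ^ 2 ≤ c := by
    intro n
    set I := ∫⁻ x in E n, ENNReal.ofReal (v x) * ‖u x‖ₑ ^ 2 with hI
    have hIt : I ≠ ∞ := by
      refine ne_top_of_le_ne_top (ENNReal.mul_ne_top (ENNReal.natCast_ne_top n) hu2) ?_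
      rw [← lintegral_const_mul _ (hum.enorm.pow_const 2)]
      refine (setLIntegral_mono' (hEm n) fun x hx => ?_).trans (setLIntegral_le_lintegral (E n) _)
      refine mul_le_mul' ?_ le_rfl
      rw [← ENNReal.ofReal_natCast]
      exact ENNReal.ofReal_le_ofReal hx
    -- The extremal test function: its pairing with `u` and its squared `σ`-norm both equal `I`,
    -- giving `I ^ 2 ≤ c * I`. The truncation makes `I` finite, so that it cancels.
    set g : (Fin d → ℝ) → 𝕜 := (E n).indicator fun x => ((‖u x‖ * v x : ℝ) : 𝕜) with hg
    have hgm : Measurable g :=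
      (RCLike.measurable_ofReal.comp (hum.norm.mul hvm)).indicator (hEm n)
    have hge : ∀ x ∈ E n, ‖g x‖ₑ = ‖u x‖ₑ * ENNReal.ofReal (v x) := fun x hx => by
      rw [hg, Set.indicator_of_mem hx, ← ofReal_norm, RCLike.norm_ofReal, abs_mul, abs_norm,
        abs_of_pos (hv x), ENNReal.ofReal_mul (norm_nonneg _), ofReal_norm]
    have hg0 : ∀ x ∉ E n, ‖g x‖ₑ = 0 := fun x hx => by
      rw [hg, Set.indicator_of_notMem hx, enorm_zero]
    have hgI : ∫⁻ x, ENNReal.ofReal (v x)⁻¹ * ‖g x‖ₑ ^ 2 = I := by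
      rw [hI, ← lintegral_indicator (hEm n)]
      refine lintegral_congr fun x => ?_
      by_cases hx : x ∈ E n
      · have h0 : ENNReal.ofReal (v x) ≠ 0 := by simpa using hv x
        rw [Set.indicator_of_mem hx, hge x hx, ofReal_inv_weight hv, mul_pow, sq (ENNReal.ofReal _)]
        calc _ = (ENNReal.ofReal (v x))⁻¹ * ENNReal.ofReal (v x) *
              (ENNReal.ofReal (v x) * ‖u x‖ₑ ^ 2) := by ring
          _ = _ := by rw [ENNReal.inv_mul_cancel h0 ENNReal.ofReal_ne_top, one_mul]
      · rw [Set.indicator_of_notMem hx, hg0 x hx]; simp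
    have hgu : ∫⁻ x, ‖u x‖ₑ * ‖g x‖ₑ = I := by
      rw [hI, ← lintegral_indicator (hEm n)]
      refine lintegral_congr fun x => ?_
      by_cases hx : x ∈ E n
      · rw [Set.indicator_of_mem hx, hge x hx]; ring
      · rw [Set.indicator_of_notMem hx, hg0 x hx, mul_zero]
    have hgσ : eLpNorm g 2 σ ^ 2 = I := (hσ2 g hgm).trans hgI
    have hg2 : MemLp g 2 σ := ⟨hgm.aestronglyMeasurable, by
      refine lt_top_iff_ne_top.2 fun htop => hIt ?_
      rw [← hgσ, htop]; simp⟩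
    have hg1 : MemLp g 2 volume := by
      refine MemLp.of_le_mul (c := n) hu hgm.aestronglyMeasurable (Filter.Eventually.of_forall fun x => ?_)
      by_cases hx : x ∈ E n
      · rw [hg, Set.indicator_of_mem hx, RCLike.norm_ofReal, abs_mul, abs_norm, abs_of_pos (hv x),
          mul_comm]
        exact mul_le_mul_of_nonneg_right hx (norm_nonneg _)
      · rw [hg, Set.indicator_of_notMem hx, norm_zero]; positivity
    have hfin := pow_le_pow_left' (hgen g hgm hg1 hg2) 2
    rw [hgu, mul_pow, hcs, hgσ, sq] at hfin
    rcases eq_or_ne I 0 with h0 | h0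
    · rw [h0]; exact zero_le
    · exact (ENNReal.mul_le_mul_iff_left h0 hIt).1 hfin
  rw [← setLIntegral_univ, ← hEU, setLIntegral_iUnion_of_directed _ hEmono.directed_le]
  exact iSup_le hbound

/-- Extension of an `L²(μ)` bounded operator to `L²(ν)`. -/
theorem exists_unique_extension {X : Type*} [MeasurableSpace X] {μ ν : Measure X} (hμν : μ ≪ ν)
    (hνμ : ν ≪ μ) (T : Lp 𝕜 2 μ →L[𝕜] Lp 𝕜 2 μ) {M : ℝ≥0∞} (hM : M ≠ ∞)
    (hT : ∀ f : Lp 𝕜 2 μ, MemLp f 2 ν → eLpNorm (T f) 2 ν ≤ M * eLpNorm f 2 ν)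
    (hdense : ∀ g : X → 𝕜, MemLp g 2 ν → ∀ ε : ℝ≥0∞, ε ≠ 0 →
      ∃ f, MemLp f 2 μ ∧ MemLp f 2 ν ∧ eLpNorm (g - f) 2 ν ≤ ε) :
    ∃ S : Lp 𝕜 2 ν →L[𝕜] Lp 𝕜 2 ν,
      (∀ (f : Lp 𝕜 2 μ) (g : Lp 𝕜 2 ν), g =ᵐ[μ] f → S g =ᵐ[μ] T f) ∧
      (∀ S' : Lp 𝕜 2 ν →L[𝕜] Lp 𝕜 2 ν,
        (∀ (f : Lp 𝕜 2 μ) (g : Lp 𝕜 2 ν), g =ᵐ[μ] f → S' g =ᵐ[μ] T f) → S' = S) ∧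
      ‖S‖ₑ ≤ M := by
  -- The intersection of the two spaces, as pairs of classes of one function. `T` acts on the first
  -- component, and the second one embeds `V` densely in `L²(ν)`.
  set V : Submodule 𝕜 (Lp 𝕜 2 μ × Lp 𝕜 2 ν) :=
    { carrier := {p | p.1 =ᵐ[ν] p.2}
      zero_mem' := (hνμ.ae_eq (Lp.coeFn_zero 𝕜 2 μ)).trans (Lp.coeFn_zero 𝕜 2 ν).symm
      add_mem' := fun {p q} (hp : p.1 =ᵐ[ν] p.2) (hq : q.1 =ᵐ[ν] q.2) => (hνμ.ae_eq (Lp.coeFn_add p.1 q.1)).trans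
        ((Filter.EventuallyEq.add hp hq).trans (Lp.coeFn_add p.2 q.2).symm)
      smul_mem' := fun c p (hp : p.1 =ᵐ[ν] p.2) => (hνμ.ae_eq (Lp.coeFn_smul c p.1)).trans
        ((Filter.EventuallyEq.const_smul hp c).trans (Lp.coeFn_smul c p.2).symm) } with hV
  have hae : ∀ p : V, p.1.1 =ᵐ[ν] p.1.2 := fun p => p.2
  have hmem : ∀ p : V, MemLp (p.1.1 : X → 𝕜) 2 ν := fun p => (memLp_congr_ae (hae p)).2 (Lp.memLp p.1.2)
  have hbd : ∀ p : V, eLpNorm (T p.1.1) 2 ν ≤ M * eLpNorm (p.1.2 : X → 𝕜) 2 ν := fun p => by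
    rw [← eLpNorm_congr_ae (hae p)]; exact hT _ (hmem p)
  have hTm : ∀ p : V, MemLp (T p.1.1) 2 ν := fun p =>
    ⟨(Lp.stronglyMeasurable _).aestronglyMeasurable,
      (hbd p).trans_lt (ENNReal.mul_lt_top hM.lt_top (Lp.memLp p.1.2).2)⟩
  let F : V →ₗ[𝕜] Lp 𝕜 2 ν :=
    { toFun := fun p => (hTm p).toLp _
      map_add' := fun p q => by
        refine Lp.ext ?_
        refine (hTm (p + q)).coeFn_toLp.trans (.trans ?_ (Lp.coeFn_add _ _).symm)
        refine .trans ?_ ((hTm p).coeFn_toLp.symm.add (hTm q).coeFn_toLp.symm)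
        have : T (p + q : V).1.1 = T p.1.1 + T q.1.1 := map_add T _ _
        rw [this]
        exact hνμ.ae_eq (Lp.coeFn_add _ _)
      map_smul' := fun c p => by
        refine Lp.ext ?_
        refine (hTm (c • p)).coeFn_toLp.trans (.trans ?_ (Lp.coeFn_smul _ _).symm)
        refine .trans ?_ ((hTm p).coeFn_toLp.symm.const_smul c)
        have : T (c • p : V).1.1 = c • T p.1.1 := map_smul T _ _
        rw [this]
        exact hνμ.ae_eq (Lp.coeFn_smul _ _) }
  let e : V →ₗ[𝕜] Lp 𝕜 2 ν := (LinearMap.snd 𝕜 _ _).comp V.subtype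
  have hFe : ∀ p, ‖F p‖ ≤ M.toReal * ‖e p‖ := fun p => by
    have h1 : ‖F p‖ = (eLpNorm (T p.1.1) 2 ν).toReal := Lp.norm_toLp _ (hTm p)
    have h2 : ‖e p‖ = (eLpNorm (p.1.2 : X → 𝕜) 2 ν).toReal := Lp.norm_def _
    rw [h1, h2, ← ENNReal.toReal_mul]
    exact ENNReal.toReal_mono (ENNReal.mul_ne_top hM (Lp.memLp p.1.2).2.ne) (hbd p)
  have hdr : DenseRange e := by
    intro g
    rw [EMetric.mem_closure_iff]
    intro ε hε
    obtain ⟨ε', hε', hlt⟩ := exists_between hε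
    obtain ⟨f, hf1, hf2, hf3⟩ := hdense g (Lp.memLp g) ε' hε'.ne'
    refine ⟨hf2.toLp f, ⟨⟨(hf1.toLp f, hf2.toLp f),
      (hνμ.ae_eq hf1.coeFn_toLp).trans hf2.coeFn_toLp.symm⟩, rfl⟩, ?_⟩
    rw [Lp.edist_def]
    refine lt_of_le_of_lt (le_trans (le_of_eq ?_) hf3) hlt
    exact eLpNorm_congr_ae ((Filter.EventuallyEq.refl _ _).sub hf2.coeFn_toLp)
  have hS : ∀ p, F.extendOfNorm e (e p) = F p := LinearMap.extendOfNorm_eq hdr ⟨_, hFe⟩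
  refine ⟨F.extendOfNorm e, fun f g hgf => ?_, fun S' hS' => ?_, ?_⟩
  · have h1 := hS ⟨(f, g), (hνμ.ae_eq hgf).symm⟩
    have h2 : F ⟨(f, g), (hνμ.ae_eq hgf).symm⟩ =ᵐ[ν] T f := (hTm ⟨(f, g), _⟩).coeFn_toLp
    rw [← h1] at h2
    exact hμν.ae_eq h2
  · refine (LinearMap.extendOfNorm_unique hdr _ hFe S' (LinearMap.ext fun p => Lp.ext ?_)).symm
    exact (hνμ.ae_eq (hS' p.1.1 p.1.2 (hμν.ae_eq (hae p).symm))).trans (hTm p).coeFn_toLp.symm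
  · have := LinearMap.opNorm_extendOfNorm_le hdr ENNReal.toReal_nonneg hFe
    rw [← ofReal_norm, ← ENNReal.ofReal_toReal hM]
    exact ENNReal.ofReal_le_ofReal this

end Extension

/-! ### The theorem -/

section Main

variable {d : ℕ} {𝕜 : Type*} [RCLike 𝕜] {α : ℝ}

/-- The action of an `L²` operator on functions, normalised by a constant. -/
noncomputable def opFun
    (T : Lp 𝕜 2 (volume : Measure (Fin d → ℝ)) →L[𝕜] Lp 𝕜 2 (volume : Measure (Fin d → ℝ)))
    (B : ℝ≥0) (f : (Fin d → ℝ) → 𝕜) : (Fin d → ℝ) → 𝕜 :=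
  open scoped Classical in
  if h : MemLp f 2 volume then (((B : ℝ) : 𝕜)⁻¹) • (T (h.toLp f) : (Fin d → ℝ) → 𝕜) else 0

variable {T : Lp 𝕜 2 (volume : Measure (Fin d → ℝ)) →L[𝕜] Lp 𝕜 2 (volume : Measure (Fin d → ℝ))}
  {K : (Fin d → ℝ) → (Fin d → ℝ) → 𝕜} {B : ℝ≥0}

theorem opFun_of_memLp {f : (Fin d → ℝ) → 𝕜} (h : MemLp f 2 volume) :
    opFun T B f = (((B : ℝ) : 𝕜)⁻¹) • (T (h.toLp f) : (Fin d → ℝ) → 𝕜) := dif_pos h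

/-- Step functions are finite combinations of indicators of cubes, hence lie in the dense subspace
on which the representation is given. -/
theorem IsCalderonZygmund.rep_of_isStep (h : IsCalderonZygmund T K α) {N : ℤ}
    {f : (Fin d → ℝ) → 𝕜} (hf : IsStep N f) : ∀ᵐ x, (∃ U ∈ 𝓝 x, ∀ y ∈ U, f y = 0) →
      T ((hf.memLp 2).toLp f) x = ∫ y, K x y * f y := by
  obtain ⟨D, -, hcube, hrep⟩ := h.kernel_rep
  obtain ⟨s, c, hsum⟩ := hf.exists_eq_sum
  have hD : (hf.memLp 2).toLp f ∈ D := by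
    choose φ hφD hφ using fun m : Fin d → ℤ => hcube
      (fun i => (0 : Fin d → ℝ) i + 1 * (2 : ℝ) ^ (-N) * (m i : ℝ)) (1 * (2 : ℝ) ^ (-N)) (by positivity)
    have : (hf.memLp 2).toLp f = ∑ m ∈ s, c m • φ m := by
      refine Lp.ext ((hf.memLp 2).coeFn_toLp.trans ?_)
      refine .trans ?_ (Lp.coeFn_finsetSum s _).symm
      have h1 : ∀ᵐ x, ∀ m ∈ s, (c m • φ m : Lp 𝕜 2 volume) x =
          (gridCube (0 : Fin d → ℝ) 1 (N, m)).indicator (fun _ => c m) x := by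
        refine (Finset.eventually_all s).2 fun m _ => ?_
        filter_upwards [Lp.coeFn_smul (c m) (φ m), hφ m] with x hx1 hx2
        rw [hx1, Pi.smul_apply, hx2]
        by_cases hx : x ∈ gridCube (0 : Fin d → ℝ) 1 (N, m)
        · rw [Set.indicator_of_mem hx, Set.indicator_of_mem (show x ∈ cube _ _ from hx), smul_eq_mul,
            mul_one]
        · rw [Set.indicator_of_notMem hx, Set.indicator_of_notMem (show x ∉ cube _ _ from hx),
            smul_zero]
      filter_upwards [h1] with x hx
      rw [hsum, Finset.sum_apply, Finset.sum_apply]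
      exact Finset.sum_congr rfl fun m hm => (hx m hm).symm
    rw [this]
    exact D.sum_mem fun m _ => D.smul_mem _ (hφD m)
  have hae := (hf.memLp 2).coeFn_toLp
  filter_upwards [hrep _ hD] with x hx hU
  obtain ⟨U, hU, hUf⟩ := hU
  have hx' := hx ⟨interior U, interior_mem_nhds.2 hU, by
    filter_upwards [ae_restrict_of_ae hae, ae_restrict_mem isOpen_interior.measurableSet]
      with y hy hyU
    rw [hy, hUf y (interior_subset hyU), Pi.zero_apply]⟩
  rw [hx']
  refine integral_congr_ae ?_
  filter_upwards [hae] with y hy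
  rw [hy]

/-- Normalising by a common bound `B` makes all later constants depend on `d` and `α` only;
linearity restores `B` at the end. -/
theorem IsCalderonZygmund.isStepCZ (h : IsCalderonZygmund T K α) (hB : 0 < B)
    (hT : ‖T‖ ≤ B) (hK : KernelHolderBound K α B) :
    IsStepCZ (opFun T B) (fun x y => ((B : ℝ) : 𝕜)⁻¹ * K x y) α where
  measurable f := by
    by_cases hf : MemLp f 2 volume
    · rw [opFun_of_memLp hf]
      exact ((Lp.stronglyMeasurable _).measurable).const_smul _
    · rw [opFun, dif_neg hf]; exact measurable_const
  add N f g hf hg := by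
    rw [opFun_of_memLp (hf.memLp 2), opFun_of_memLp (hg.memLp 2), opFun_of_memLp ((hf.add hg).memLp 2),
      MemLp.toLp_add (hf.memLp 2) (hg.memLp 2), map_add, ← smul_add]
    exact (Lp.coeFn_add _ _).const_smul _
  bound N f hf := by
    have hB0 : (B : ℝ≥0∞) ≠ 0 := by exact_mod_cast hB.ne'
    rw [opFun_of_memLp (hf.memLp 2), ← eLpNorm_two_sq, ← eLpNorm_two_sq, eLpNorm_const_smul]
    refine pow_le_pow_left' ?_ 2
    have h1 : eLpNorm (T ((hf.memLp 2).toLp f)) 2 volume ≤ B * eLpNorm f 2 volume := by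
      have h2 : ‖T ((hf.memLp 2).toLp f)‖ₑ ≤ B * ‖(hf.memLp 2).toLp f‖ₑ := by
        rw [← ofReal_norm, ← ofReal_norm, ← ENNReal.ofReal_coe_nnreal, ← ENNReal.ofReal_mul B.coe_nonneg]
        exact ENNReal.ofReal_le_ofReal (T.le_of_opNorm_le hT _)
      rwa [Lp.enorm_def, Lp.enorm_def, eLpNorm_congr_ae (hf.memLp 2).coeFn_toLp] at h2
    have h3 : ‖((B : ℝ) : 𝕜)⁻¹‖ₑ = (B : ℝ≥0∞)⁻¹ := by
      rw [← ofReal_norm, norm_inv, RCLike.norm_ofReal, abs_of_nonneg B.coe_nonneg,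
        ENNReal.ofReal_inv_of_pos (by exact_mod_cast hB), ENNReal.ofReal_coe_nnreal]
    calc _ ≤ (B : ℝ≥0∞)⁻¹ * (B * eLpNorm f 2 volume) := by rw [h3]; exact mul_le_mul' le_rfl h1
      _ = _ := by rw [← mul_assoc, ENNReal.inv_mul_cancel hB0 ENNReal.coe_ne_top, one_mul]
  size := by
    obtain ⟨C, hC⟩ := h.size
    refine ⟨B⁻¹ * C, fun x y hxy => ?_⟩
    rw [norm_mul, norm_inv, RCLike.norm_ofReal, abs_of_nonneg B.coe_nonneg]
    push_cast
    rw [mul_div_assoc]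
    exact mul_le_mul_of_nonneg_left (hC x y hxy) (by positivity)
  holder x x' y hxy := by
    have hB' : (0 : ℝ) < B := hB
    rw [← mul_sub, ← mul_sub, norm_mul, norm_mul, ← mul_add, norm_inv, RCLike.norm_ofReal,
      abs_of_nonneg B.coe_nonneg]
    calc (B : ℝ)⁻¹ * _ ≤ (B : ℝ)⁻¹ * (B / ‖x - y‖ ^ d * (‖x - x'‖ / ‖x - y‖) ^ α) :=
          mul_le_mul_of_nonneg_left (hK x x' y hxy) (by positivity)
      _ = ((B : ℝ)⁻¹ * B) / ‖x - y‖ ^ d * (‖x - x'‖ / ‖x - y‖) ^ α := by ring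
      _ = _ := by rw [inv_mul_cancel₀ hB'.ne']; norm_num
  rep N f hf := by
    filter_upwards [h.rep_of_isStep hf] with x hx U hU hUf
    rw [opFun_of_memLp (hf.memLp 2), Pi.smul_apply, hx ⟨U, hU, hUf⟩, ← integral_smul]
    simp only [smul_eq_mul, mul_assoc]

/-- The square of the norm bound, for a normalised operator. -/
noncomputable def weightedConst (d : ℕ) (α : ℝ) (w : (Fin d → ℝ) → ℝ) : ℝ≥0∞ :=
  formConst d α * (a2Const w * (aInftyConst w + aInftyConst fun x => (w x)⁻¹))

theorem weightedConst_ne_top (hα : 0 < α) {w : (Fin d → ℝ) → ℝ} (hA : IsA2Weight w) :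
    weightedConst d α w ≠ ∞ := by
  have h0 := hA.a2Const_lt_top.ne
  have h1 : aInftyConst w ≠ ∞ := ne_top_of_le_ne_top (by finiteness) (aInftyConst_le hA)
  have h2 : (aInftyConst fun x => (w x)⁻¹) ≠ ∞ := by
    refine ne_top_of_le_ne_top ?_ (aInftyConst_le (isA2Weight_inv hA))
    rw [a2Const_inv]; finiteness
  have h3 := formConst_ne_top (d := d) hα
  unfold weightedConst; finiteness

theorem IsStepCZ.eLpNorm_weight_le {T : ((Fin d → ℝ) → 𝕜) → (Fin d → ℝ) → 𝕜} (hd : 0 < d)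
    (hα : 0 < α) (h : IsStepCZ T K α) {v : (Fin d → ℝ) → ℝ} (hA : IsA2Weight v)
    (hvm : Measurable v) (hv : ∀ x, 0 < v x) {N : ℤ} {f : (Fin d → ℝ) → 𝕜} (hf : IsStep N f) :
    eLpNorm (T f) 2 (weightMeasure v) ≤
      weightedConst d α v ^ (1 / 2 : ℝ) * eLpNorm f 2 (weightMeasure v) := by
  have hZ : (weightedConst d α v ^ (1 / 2 : ℝ)) ^ 2 = weightedConst d α v := by
    rw [← ENNReal.rpow_natCast, ← ENNReal.rpow_mul]; norm_num
  have hT2 : MemLp (T f) 2 volume := by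
    refine memLp_two_of_lintegral_ne_top (h.measurable f).aestronglyMeasurable
      (ne_top_of_le_ne_top ?_ (h.bound N f hf))
    rw [← eLpNorm_two_sq]
    exact ENNReal.pow_ne_top (hf.memLp 2).2.ne
  rw [← ENNReal.pow_le_pow_left_iff two_ne_zero, mul_pow, hZ, eLpNorm_two_sq, eLpNorm_two_sq,
    lintegral_weightMeasure hvm ((h.measurable f).enorm.pow_const 2),
    lintegral_weightMeasure hvm (hf.measurable.enorm.pow_const 2)]
  refine lintegral_weight_le_of_forall_step hvm hv (isA2Weight_inv hA).locallyIntegrable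
    (h.measurable f) hT2 (ENNReal.mul_ne_top (weightedConst_ne_top hα hA)
      (hf.lintegral_weight_ne_top hA.locallyIntegrable)) fun M g hg => ?_
  -- The form estimate needs a common scale, so both functions are regarded as steps of the finer
  -- one.
  refine (h.form_sq_le hd hα hA hvm hv (hf.mono (le_max_left N M))
    (hg.mono (le_max_right N M))).trans (le_of_eq ?_)
  rw [weightedConst]; ring

/-- Steps approximate `f` in both norms at once. Unweighted convergence gives almost everywhere
convergence of the images along a subsequence, and Fatou's lemma transfers the weighted bound. -/
theorem IsCalderonZygmund.eLpNorm_weight_le (hd : 0 < d) (hα : 0 < α)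
    (h : IsCalderonZygmund T K α) (hB : 0 < B) (hT : ‖T‖ ≤ B) (hK : KernelHolderBound K α B)
    {v : (Fin d → ℝ) → ℝ} (hA : IsA2Weight v) (hvm : Measurable v) (hv : ∀ x, 0 < v x)
    {f : Lp 𝕜 2 (volume : Measure (Fin d → ℝ))} (hf : MemLp f 2 (weightMeasure v)) :
    eLpNorm (T f) 2 (weightMeasure v) ≤
      B * weightedConst d α v ^ (1 / 2 : ℝ) * eLpNorm f 2 (weightMeasure v) := by
  set σ := weightMeasure v with hσ
  have hσv : σ ≪ volume := withDensity_absolutelyContinuous _ _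
  have hCZ := h.isStepCZ hB hT hK
  have hBk : ((B : ℝ) : 𝕜) ≠ 0 := by
    rw [Ne, RCLike.ofReal_eq_zero]; exact_mod_cast hB.ne'
  have hBn : ‖((B : ℝ) : 𝕜)‖ₑ = B := by
    rw [← ofReal_norm, RCLike.norm_ofReal, abs_of_nonneg B.coe_nonneg, ENNReal.ofReal_coe_nnreal]
  have hstep : ∀ (N : ℤ) (g : (Fin d → ℝ) → 𝕜) (hg : IsStep N g),
      eLpNorm (T ((hg.memLp 2).toLp g)) 2 σ ≤
        B * weightedConst d α v ^ (1 / 2 : ℝ) * eLpNorm g 2 σ := by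
    intro N g hg
    have h1 : (T ((hg.memLp 2).toLp g) : (Fin d → ℝ) → 𝕜) = ((B : ℝ) : 𝕜) • opFun T B g := by
      rw [opFun_of_memLp (hg.memLp 2), smul_smul, mul_inv_cancel₀ hBk, one_smul]
    rw [h1, eLpNorm_const_smul, hBn, mul_assoc]
    exact mul_le_mul' le_rfl (hCZ.eLpNorm_weight_le hd hα hA hvm hv hg)
  have := isFiniteMeasureOnCompacts_volume_add hA.locallyIntegrable
  have hle1 : (volume : Measure (Fin d → ℝ)) ≤ volume + σ := Measure.le_add_right le_rfl
  have hle2 : σ ≤ volume + σ := Measure.le_add_left le_rfl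
  have hf' : MemLp f 2 (volume + σ) := memLp_two_add_measure (Lp.memLp f) hf
  choose N g hg hgε using fun n : ℕ => exists_isStep_eLpNorm_sub_le (volume + σ) hf'
    (ε := ((n : ℝ≥0∞) + 1)⁻¹) (ENNReal.inv_ne_zero.2 (by finiteness))
  have hε : Filter.Tendsto (fun n : ℕ => ((n : ℝ≥0∞) + 1)⁻¹) Filter.atTop (𝓝 0) := by
    have := (Filter.tendsto_add_atTop_iff_nat 1).2 ENNReal.tendsto_inv_nat_nhds_zero
    simpa using this
  have hlim : Filter.Tendsto (fun n => ((hg n).memLp 2).toLp (g n)) Filter.atTop (𝓝 f) := by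
    rw [tendsto_iff_edist_tendsto_0]
    refine tendsto_of_tendsto_of_tendsto_of_le_of_le tendsto_const_nhds hε (fun _ => zero_le)
      fun n => ?_
    simp only
    rw [edist_comm, Lp.edist_def]
    refine le_trans (le_of_eq ?_) ((eLpNorm_mono_measure _ hle1).trans (hgε n))
    exact eLpNorm_congr_ae ((Filter.EventuallyEq.refl _ _).sub ((hg n).memLp 2).coeFn_toLp)
  have hTlim := tendstoInMeasure_of_tendsto_Lp (T.continuous.tendsto f |>.comp hlim)
  obtain ⟨ns, hns, hae⟩ := hTlim.exists_seq_tendsto_ae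
  have hgn : ∀ n, eLpNorm (g n) 2 σ ≤ eLpNorm f 2 σ + ((n : ℝ≥0∞) + 1)⁻¹ := fun n =>
    eLpNorm_le_add_of_sub_le hf.1 (hg n).measurable.aestronglyMeasurable
      ((eLpNorm_mono_measure _ hle2).trans (hgε n))
  have hMt : (B : ℝ≥0∞) * weightedConst d α v ^ (1 / 2 : ℝ) ≠ ∞ := ENNReal.mul_ne_top
    ENNReal.coe_ne_top (ENNReal.rpow_ne_top_of_nonneg (by norm_num) (weightedConst_ne_top hα hA))
  have hb : Filter.Tendsto (fun n : ℕ => (B : ℝ≥0∞) * weightedConst d α v ^ (1 / 2 : ℝ) *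
      (eLpNorm f 2 σ + ((n : ℝ≥0∞) + 1)⁻¹)) Filter.atTop
      (𝓝 (B * weightedConst d α v ^ (1 / 2 : ℝ) * eLpNorm f 2 σ)) := by
    refine ENNReal.Tendsto.const_mul ?_ (Or.inr hMt)
    simpa using (tendsto_const_nhds (x := eLpNorm f 2 σ)).add hε
  refine (Lp.eLpNorm_lim_le_liminf_eLpNorm
    (fun n => (Lp.stronglyMeasurable _).aestronglyMeasurable) _ (hσv.ae_le hae)).trans ?_
  rw [← (hb.comp hns.tendsto_atTop).liminf_eq]
  exact Filter.liminf_le_liminf (Filter.Eventually.of_forall fun n =>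
    (hstep _ _ (hg (ns n))).trans (mul_le_mul' le_rfl (hgn _)))

/-- The normalising constant must be positive and admissible, while the sum of the norms may vanish
and the infimum is not known to be attained. Adding `ε` settles both, and then `ε` tends to zero. -/
theorem IsCalderonZygmund.eLpNorm_weight_le_norm (hd : 0 < d) (hα : 0 < α)
    (h : IsCalderonZygmund T K α) {v : (Fin d → ℝ) → ℝ} (hA : IsA2Weight v) (hvm : Measurable v)
    (hv : ∀ x, 0 < v x) {f : Lp 𝕜 2 (volume : Measure (Fin d → ℝ))}
    (hf : MemLp f 2 (weightMeasure v)) :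
    eLpNorm (T f) 2 (weightMeasure v) ≤ (‖T‖ₑ + kernelHolderNorm K α) *
      weightedConst d α v ^ (1 / 2 : ℝ) * eLpNorm f 2 (weightMeasure v) := by
  have hκ : kernelHolderNorm K α ≠ ∞ := by
    obtain ⟨C, hC⟩ := h.holder
    exact ne_top_of_le_ne_top ENNReal.coe_ne_top (iInf₂_le C hC)
  have hMt : weightedConst d α v ^ (1 / 2 : ℝ) * eLpNorm f 2 (weightMeasure v) ≠ ∞ :=
    ENNReal.mul_ne_top (ENNReal.rpow_ne_top_of_nonneg (by norm_num) (weightedConst_ne_top hα hA))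
      hf.2.ne
  rw [mul_assoc]
  refine le_of_forall_le_add_mul hMt fun ε hε hεt => ?_
  obtain ⟨B, hB⟩ : ∃ B : ℝ≥0, (B : ℝ≥0∞) = ‖T‖ₑ + kernelHolderNorm K α + ε :=
    ⟨_, ENNReal.coe_toNNReal (by finiteness)⟩
  have hlt : ‖T‖ₑ + kernelHolderNorm K α < B := by
    rw [hB]; exact ENNReal.lt_add_right (by finiteness) hε
  have hTB : ‖T‖ ≤ B := by
    have : ‖T‖ₑ ≤ B := le_self_add.trans hlt.le
    rw [enorm_le_coe] at this
    exact_mod_cast this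
  obtain ⟨C, hC, hCB⟩ : ∃ C : ℝ≥0, KernelHolderBound K α C ∧ C < B := by
    have h1 : kernelHolderNorm K α < B := le_add_self.trans_lt hlt
    simp only [kernelHolderNorm, iInf_lt_iff] at h1
    obtain ⟨C, hC, h2⟩ := h1
    exact ⟨C, hC, by exact_mod_cast h2⟩
  have hKB : KernelHolderBound K α B := fun x x' y hxy => (hC x x' y hxy).trans (by gcongr)
  refine (h.eLpNorm_weight_le hd hα (pos_of_gt hCB) hTB hKB hA hvm hv hf).trans (le_of_eq ?_)
  rw [hB]; ring

theorem weightedConst_rpow_le (w : (Fin d → ℝ) → ℝ) : weightedConst d α w ^ (1 / 2 : ℝ) ≤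
    formConst d α ^ (1 / 2 : ℝ) * (a2Const w ^ (1 / 2 : ℝ) *
      (aInftyConst w ^ (1 / 2 : ℝ) + aInftyConst (fun x => (w x)⁻¹) ^ (1 / 2 : ℝ))) := by
  have h : (0 : ℝ) ≤ 1 / 2 := by norm_num
  rw [weightedConst, ENNReal.mul_rpow_of_nonneg _ _ h, ENNReal.mul_rpow_of_nonneg _ _ h]
  exact mul_le_mul' le_rfl (mul_le_mul' le_rfl
    (ENNReal.rpow_add_le_add_rpow _ _ h (by norm_num)))

theorem a2Const_rpow_mul_le {w : (Fin d → ℝ) → ℝ} (hA : IsA2Weight w) :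
    a2Const w ^ (1 / 2 : ℝ) *
      (aInftyConst w ^ (1 / 2 : ℝ) + aInftyConst (fun x => (w x)⁻¹) ^ (1 / 2 : ℝ)) ≤
      4 * a2Const w := by
  have h : (0 : ℝ) ≤ 1 / 2 := by norm_num
  have h4 : (4 : ℝ≥0∞) ^ (1 / 2 : ℝ) = 2 := by
    rw [show (4 : ℝ≥0∞) = 2 ^ (2 : ℝ) by norm_num, ← ENNReal.rpow_mul]; norm_num
  have hsq : a2Const w ^ (1 / 2 : ℝ) * a2Const w ^ (1 / 2 : ℝ) = a2Const w := by
    rw [← ENNReal.rpow_add_of_nonneg _ _ h h]; norm_num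
  have h1 : aInftyConst w ^ (1 / 2 : ℝ) ≤ 2 * a2Const w ^ (1 / 2 : ℝ) := by
    rw [← h4, ← ENNReal.mul_rpow_of_nonneg _ _ h]
    exact ENNReal.rpow_le_rpow (aInftyConst_le hA) h
  have h2 : aInftyConst (fun x => (w x)⁻¹) ^ (1 / 2 : ℝ) ≤ 2 * a2Const w ^ (1 / 2 : ℝ) := by
    rw [← h4, ← ENNReal.mul_rpow_of_nonneg _ _ h, ← a2Const_inv]
    exact ENNReal.rpow_le_rpow (aInftyConst_le (isA2Weight_inv hA)) h
  calc _ ≤ a2Const w ^ (1 / 2 : ℝ) * (2 * a2Const w ^ (1 / 2 : ℝ) + 2 * a2Const w ^ (1 / 2 : ℝ)) :=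
        mul_le_mul' le_rfl (add_le_add h1 h2)
    _ = 4 * (a2Const w ^ (1 / 2 : ℝ) * a2Const w ^ (1 / 2 : ℝ)) := by ring
    _ = _ := by rw [hsq]

end Main

theorem mainTheorem1 (d : ℕ) (hd : 0 < d) (α : ℝ) (hα₀ : 0 < α) (hα₁ : α < 1) :
    ∃ C : ℝ≥0, ∀ (𝕜 : Type) [RCLike 𝕜]
      (T : Lp 𝕜 2 (volume : Measure (Fin d → ℝ)) →L[𝕜] Lp 𝕜 2 (volume : Measure (Fin d → ℝ)))
      (K : (Fin d → ℝ) → (Fin d → ℝ) → 𝕜) (w : (Fin d → ℝ) → ℝ),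
      IsCalderonZygmund T K α → IsA2Weight w →
      (∃ S : Lp 𝕜 2 (weightMeasure w) →L[𝕜] Lp 𝕜 2 (weightMeasure w),
        AgreesOnWeighted w T S ∧ (∀ S', AgreesOnWeighted w T S' → S' = S) ∧
        ‖S‖ₑ ≤ C * ((‖T‖ₑ + kernelHolderNorm K α) * a2Const w ^ (1 / 2 : ℝ) *
          (aInftyConst w ^ (1 / 2 : ℝ) + aInftyConst (fun x => (w x)⁻¹) ^ (1 / 2 : ℝ)))) ∧
      (‖T‖ₑ + kernelHolderNorm K α) * a2Const w ^ (1 / 2 : ℝ) *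
          (aInftyConst w ^ (1 / 2 : ℝ) + aInftyConst (fun x => (w x)⁻¹) ^ (1 / 2 : ℝ)) ≤
        C * ((‖T‖ₑ + kernelHolderNorm K α) * a2Const w) := by
  have hFt : formConst d α ^ (1 / 2 : ℝ) ≠ ∞ :=
    ENNReal.rpow_ne_top_of_nonneg (by norm_num) (formConst_ne_top hα₀)
  have hC : (((formConst d α ^ (1 / 2 : ℝ)).toNNReal + 4 : ℝ≥0) : ℝ≥0∞) =
      formConst d α ^ (1 / 2 : ℝ) + 4 := by
    rw [ENNReal.coe_add, ENNReal.coe_toNNReal hFt]; rfl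
  -- The first summand serves the norm bound; the 4 serves the comparison with `[w]_{A_2}`, where
  -- each `A_∞` root contributes 2.
  refine ⟨(formConst d α ^ (1 / 2 : ℝ)).toNNReal + 4, fun 𝕜 _ T K w hT hA => ⟨?_, ?_⟩⟩
  · rw [hC]
    obtain ⟨v, hvm, hv, hwv, hAv⟩ := exists_measurable_weight hA
    have hκ : kernelHolderNorm K α ≠ ∞ := by
      obtain ⟨C, hC⟩ := hT.holder
      exact ne_top_of_le_ne_top ENNReal.coe_ne_top (iInf₂_le C hC)
    have hwm : weightMeasure w = weightMeasure v := weightMeasure_congr hwv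
    have hνμ : weightMeasure w ≪ volume := withDensity_absolutelyContinuous _ _
    have hμν : volume ≪ weightMeasure w := by
      rw [hwm]
      exact withDensity_absolutelyContinuous' hvm.ennreal_ofReal.aemeasurable
        (Filter.Eventually.of_forall fun x => by simpa using hv x)
    have : IsFiniteMeasureOnCompacts (weightMeasure w) := by
      have := isFiniteMeasureOnCompacts_volume_add hA.locallyIntegrable
      have hle : weightMeasure w ≤ volume + weightMeasure w := Measure.le_add_left le_rfl
      exact ⟨fun C hC => (hle C).trans_lt hC.measure_lt_top⟩
    obtain ⟨S, hS1, hS2, hS3⟩ := exists_unique_extension hμν hνμ T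
      (M := (‖T‖ₑ + kernelHolderNorm K α) * weightedConst d α v ^ (1 / 2 : ℝ))
      (ENNReal.mul_ne_top (by finiteness)
        (ENNReal.rpow_ne_top_of_nonneg (by norm_num) (weightedConst_ne_top hα₀ hAv)))
      (by
        rw [hwm]
        exact fun f hf => hT.eLpNorm_weight_le_norm hd hα₀ hAv hvm hv hf)
      (fun g hg ε hε => by
        obtain ⟨N, f, hf, hfε⟩ := exists_isStep_eLpNorm_sub_le (weightMeasure w) hg hε
        refine ⟨f, hf.memLp 2, ?_, hfε⟩
        refine memLp_two_of_lintegral_ne_top hf.measurable.aestronglyMeasurable ?_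
        rw [hwm, lintegral_weightMeasure hvm (hf.measurable.enorm.pow_const 2)]
        exact hf.lintegral_weight_ne_top hAv.locallyIntegrable)
    refine ⟨S, hS1, hS2, hS3.trans ?_⟩
    rw [a2Const_congr hwv, aInftyConst_congr hwv, aInftyConst_congr (inv_ae_eq hwv)]
    calc _ ≤ _ := mul_le_mul' le_rfl (weightedConst_rpow_le v)
      _ = formConst d α ^ (1 / 2 : ℝ) * ((‖T‖ₑ + kernelHolderNorm K α) * a2Const v ^ (1 / 2 : ℝ) *
          (aInftyConst v ^ (1 / 2 : ℝ) + aInftyConst (fun x => (v x)⁻¹) ^ (1 / 2 : ℝ))) := by ring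
      _ ≤ _ := mul_le_mul' le_self_add le_rfl
  · rw [hC, mul_assoc]
    calc _ ≤ (‖T‖ₑ + kernelHolderNorm K α) * (4 * a2Const w) :=
          mul_le_mul' le_rfl (a2Const_rpow_mul_le hA)
      _ = 4 * ((‖T‖ₑ + kernelHolderNorm K α) * a2Const w) := by ring
      _ ≤ _ := mul_le_mul' le_add_self le_rfl
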